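/- Let $k$ be a field; all vector spaces (and all modules) are finite-dimensional over $k$, $\otimes=\otimes_k$, $\tau$ denotes transpositions $v\otimes w\mapsto w\otimes v$, and UAA means unital associative $k$-algebra. For a bialgebra $(H,\mu,\nu,\Delta,\varepsilon)$ the dual $H^*$ is a bialgebra via $$\langle l_1l_2,h\rangle=\langle l_1,h_{(2)}\rangle\langle l_2,h_{(1)}\rangle,\qquad \langle l,hh'\rangle=\langle l_{(1)},h'\rangle\langle l_{(2)},h\rangle,$$ with unit $\varepsilon^*$ (the element $\varepsilon$) and counit $\nu^*\colon l\mapsto l(1)$. $H^{op}$ (resp. $H^{cop}$) is $H$ with the opposite multiplication (resp. comultiplication). **Definitions.** A *bipointed braided system of rank $r$* consists of spaces $V_1,\dots,V_r$, linear maps $\sigma_{i,j}\colon V_i\otimes V_j\to V_j\otimes V_i$ for $i\le j$ satisfying the Yang–Baxter equation $(\sigma_{j,l}\otimes \mathrm{Id})(\mathrm{Id}\otimes\sigma_{i,l})(\sigma_{i,j}\otimes \mathrm{Id})=(\mathrm{Id}\otimes\sigma_{i,j})(\sigma_{i,l}\otimes \mathrm{Id})(\mathrm{Id}\otimes\sigma_{j,l})$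 on $V_i\otimes V_j\otimes V_l$ for all $i\le j\le l$, and units $\nu_i\colon k\to V_i$ and counits $\varepsilon_i\colon V_i\to k$ with $\varepsilon_i\nu_i=\mathrm{Id}$. A morphism is a family of linear maps $f_i\colon V_i\to V'_i$ with $(f_j\otimes f_i)\sigma_{i,j}=\sigma'_{i,j}(f_i\otimes f_j)$, respecting units and counits. A *braided module* over the system is a space $M$ with maps $\rho_i\colon M\otimes V_i\to M$ such that $\rho_j(\rho_i\otimes \mathrm{Id})=\rho_i(\rho_j\otimes \mathrm{Id})(\mathrm{Id}_M\otimes\sigma_{i,j})$ for $i\le j$ and $\rho_i(\mathrm{Id}_M\otimes\nu_i)=\mathrm{Id}_M$; morphisms are linear maps commuting with all $\rho_i$. The system is one *of UAAs* if every $V_i$ is a UAA with unit $\nu_i$, $\sigma_{i,i}=\sigma_{Ass}(V_i):=\nu_i\otimes\mu_i$ (i.e. $v\otimes w\mapsto 1\otimes vw$), and $\sigma_{i,j}(1\otimes w)=w\otimes1$, $\sigma_{i,j}(v\otimes1)=1\otimes v$ for $i<j$; then $\xi_{i,j}:=\sigma_{i,j}$ for $i<j$. For $r=4$ its *braided tensor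 product* $V_4\otimes_\xi V_3\otimes_\xi V_2\otimes_\xi V_1$ is $V_4\otimes V_3\otimes V_2\otimes V_1$ with unit $1\otimes1\otimes1\otimes1$ and multiplication $$(\mu_4\otimes\mu_3\otimes\mu_2\otimes\mu_1)\circ\xi_{1,2}^{6}\circ(\xi_{2,3}^{4}\circ\xi_{1,3}^{5})\circ(\xi_{3,4}^{2}\circ\xi_{2,4}^{3}\circ\xi_{1,4}^{4}),$$ where the superscript $p$ means that the map is applied to the tensor factors $p$ and $p+1$. For $\theta\in S_r$, if the $\xi_{i,j}$ are invertible, the *component permutation* of the system is $(V_{\theta^{-1}(1)},\dots,V_{\theta^{-1}(r)})$, with the units, counits and multiplications permuted accordingly, with the braiding $\sigma_{a,b}$, where $(a,b)=(\theta^{-1}(i),\theta^{-1}(j))$ and $i\le j$, if $a\le b$, and with $\sigma_{b,a}^{-1}$ if $a>b$. For a bialgebra $A$ put $\sigma_{bi}(A)\colon A\otimes A^*\to A^*\otimes A$, $h\otimes l\mapsto\langle l_{(1)},h_{(2)}\rangle\, l_{(2)}\otimes h_{(1)}$. For a bialgebra $H$ put $$\mathcal B'(H)=(V_1=H,\ V_2=H^{op},\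 V_3=H^*,\ V_4=(H^{cop})^*)$$ with $\sigma_{i,i}=\sigma_{Ass}(V_i)$, $\sigma_{1,2}=\tau$, $\sigma_{3,4}=\tau$, $\sigma_{1,3}=\sigma_{bi}(H)$, $\sigma_{2,3}=\sigma_{bi}(H^{op})$, $\sigma_{1,4}=\sigma_{bi}(H^{cop})$, $\sigma_{2,4}=\sigma_{bi}(H^{op,cop})$, units $\nu,\nu,\varepsilon^*,\varepsilon^*$ and counits $\varepsilon,\varepsilon,\nu^*,\nu^*$. A *Hopf bimodule* over $H$ is a space $M$ with a bimodule structure ($\rho\colon M\otimes H\to M$, $\lambda\colon H\otimes M\to M$) and a bicomodule structure ($\delta\colon M\to M\otimes H$, $\gamma\colon M\to H\otimes M$) such that $\delta$ and $\gamma$ are morphisms of bimodules, where $H$ acts on $M\otimes H$ and on $H\otimes M$ diagonally, through $\Delta$; morphisms are linear maps respecting the four structures. **Theorem.** 1. The assignment $H\mapsto\mathcal B'(H)$, $f\mapsto(f,f,(f^{-1})^*,(f^{-1})^*)$ is a (well-defined) fully faithful functor from the category of finite-dimensional bialgebras and bialgebra isomorphisms to the category of bipointed braided systems of rank $4$ and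 their isomorphisms. 2. Let $H$ be a finite-dimensional bialgebra. Then $\mathcal B'(H)$ is a bipointed braided system of UAAs, the braided tensor product $\mathscr W(H)=(H^{cop})^*\otimes_\xi H^*\otimes_\xi H^{op}\otimes_\xi H$ is a UAA, and there are (well-defined) category equivalences $$\{\text{Hopf bimodules over }H\}\ \to\ \mathbf{Mod}_{\mathcal B'(H)}\ \to\ \mathbf{Mod}_{\mathscr W(H)}.$$ The first is $(M,\rho,\lambda,\delta,\gamma)\mapsto(M;\rho,\mathcal R(\lambda),\delta^{co},\mathcal R(\gamma^{co}))$, where $\delta^{co}=(\mathrm{Id}_M\otimes ev)(\delta\otimes \mathrm{Id})\colon M\otimes H^*\to M$, $\gamma^{co}=(ev\otimes \mathrm{Id}_M)(\mathrm{Id}\otimes\gamma)\colon H^*\otimes M\to M$ and $\mathcal R$ is precomposition with $\tau$. The second takes $(M;\rho_1,\dots,\rho_4)$ to $M$ with the right action $m\cdot(v_4\otimes v_3\otimes v_2\otimes v_1)=(((m\cdot v_4)\cdot v_3)\cdot v_2)\cdot v_1$. Both are the identity on underlying spaces and on morphisms. Modules over algebras are right modules. 3. Let $H$ be a finite-dimensional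 Hopf algebra with antipode $s$. Then the $\sigma_{i,j}$ of $\mathcal B'(H)$ with $i<j$ are bijective. For every $\theta\in S_4$ the component permutation $\theta\mathcal B'(H)$ is a bipointed braided system of UAAs, its braided tensor product $\theta\cdot\mathscr W(H)$ is a UAA, and there are category equivalences $$\{\text{Hopf bimodules over }H\}\ \to\ \mathbf{Mod}_{\theta\mathcal B'(H)}\ \to\ \mathbf{Mod}_{\theta\cdot\mathscr W(H)}.$$ The first is the first functor of Part 2 followed by the permutation $(M,(\rho_i))\mapsto(M,(\rho_{\theta^{-1}(i)}))$, and the second is the iterated action as in Part 2. Moreover, there are algebra isomorphisms $\Phi_\theta\colon\mathscr W(H)\to\theta\cdot\mathscr W(H)$ such that $\Phi_\theta$ is, for every minimal decomposition of $\theta$ into adjacent transpositions $s_p=(p,p+1)$, the composite of the corresponding maps $\mathrm{Id}\otimes\xi_{p,p+1}^{-1}\otimes \mathrm{Id}$ ($\xi_{p,p+1}$ being that of the intermediate permuted system); in particular this composite does not depend on the decomposition. The functor $(M,\rho)\mapsto(M,\rho\circ(\mathrm{Id}_M\otimes\Phi_\theta^{-1}))$ is an equivalence $\mathbf{Mod}_{\mathscr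 W(H)}\to\mathbf{Mod}_{\theta\cdot\mathscr W(H)}$, and it takes the $\mathscr W(H)$-module of any braided $\mathcal B'(H)$-module to the $\theta\cdot\mathscr W(H)$-module of its permuted version. Finally, the following three algebras (of Cibils–Rosso and Panaite) are, up to the evident rebracketing of tensor factors, the algebras $\theta\cdot\mathscr W(H)$ for $\theta=(1,4)(2,3)$, $(1,2,3,4)$ and $(3,4)$ respectively. Here $l(g-h)$ is the functional $x\mapsto l(gxh)$, $\cdot_{op}$ is an opposite multiplication, and $(H^*)^{op}=(H^{cop})^*$ as algebras. * $\mathscr X(H)=(H\otimes H^{op})\,\underline\otimes\,(H^*\otimes(H^*)^{op})$: the twisted product algebra in which both brackets are subalgebras, $(h\otimes g)\cdot(l\otimes l')=(h\otimes g)\otimes(l\otimes l')$ and $$(l\otimes l')\cdot(h\otimes g)=(h_{(2)}\otimes g_{(2)})\otimes\bigl(l(s^{-1}(g_{(3)})-s(h_{(3)}))\otimes l'(s(g_{(1)})-s^{-1}(h_{(1)}))\bigr).$$ * $\mathscr Y(H)=H^*\#(H^{op}\otimes H)\#(H^*)^{op}$: the two-sided crossed product, i.e. for $b,b'\in H^{op}\otimes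 H$ $$(l\# b\# l')(m\# b'\# m')=l\,(b_{(2)}\triangleright m)\ \#\ b_{(1)}b'_{(2)}\ \#\ (l'\triangleleft b'_{(1)})\cdot_{op}m',$$ with $(g\otimes h)\triangleright l=l(g-h)$, $l\triangleleft(g\otimes h)=l(s(g)-s^{-1}(h))$ and $b_{(1)}\otimes b_{(2)}$ the tensor product comultiplication. * $\mathscr Z(H)=(H^*\otimes(H^*)^{op})\bowtie(H^{op}\otimes H)$: the diagonal crossed product, $$((l\otimes l')\bowtie(g\otimes h))((m\otimes m')\bowtie(g'\otimes h'))=\bigl(l\,m(g_{(3)}-h_{(3)})\otimes l'\cdot_{op}m'(g_{(1)}-h_{(1)})\bigr)\bowtie(g_{(2)}\cdot_{op}g'\otimes h_{(2)}h').$$ -/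

import Mathlib

open CategoryTheory
open scoped TensorProduct

universe u

set_option maxSynthPendingDepth 3

noncomputable section

namespace HopfBraid

/-! ### Unital associative algebras, bialgebras and duality, through their structure maps -/

section Structures

variable {k : Type u} [Field k]
variable {A B C D : Type u} [AddCommGroup A] [Module k A] [AddCommGroup B] [Module k B]
  [AddCommGroup C] [Module k C] [AddCommGroup D] [Module k D]

/-- A multiplication `A ⊗ A → A` together with an element of `A` (the image of `1` under the unit
map `k → A`). The axioms are the predicate `AlgStr.IsUAA`. -/
structure AlgStr (k : Type u) [Field k] (A : Type u) [AddCommGroup A] [Module k A] where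
  mul : A ⊗[k] A →ₗ[k] A
  one : A

/-- The axioms of a unital associative algebra (UAA). -/
structure AlgStr.IsUAA (S : AlgStr k A) : Prop where
  mul_assoc : ∀ x y z : A, S.mul (S.mul (x ⊗ₜ y) ⊗ₜ z) = S.mul (x ⊗ₜ S.mul (y ⊗ₜ z))
  one_mul : ∀ x : A, S.mul (S.one ⊗ₜ x) = x
  mul_one : ∀ x : A, S.mul (x ⊗ₜ S.one) = x

/-- The opposite multiplication. -/
def AlgStr.op (S : AlgStr k A) : AlgStr k A where
  mul := S.mul ∘ₗ (TensorProduct.comm k A A).toLinearMap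
  one := S.one

/-- The (untwisted) tensor product of two algebras. -/
def AlgStr.tensor (S : AlgStr k A) (T : AlgStr k B) : AlgStr k (A ⊗[k] B) where
  mul := TensorProduct.map S.mul T.mul ∘ₗ
    (TensorProduct.tensorTensorTensorComm k A B A B).toLinearMap
  one := S.one ⊗ₜ T.one

/-- A linear isomorphism which respects multiplications and units. -/
structure IsAlgIso (S : AlgStr k A) (T : AlgStr k B) (e : A ≃ₗ[k] B) : Prop where
  map_mul : ∀ x y : A, e (S.mul (x ⊗ₜ y)) = T.mul (e x ⊗ₜ e y)
  map_one : e S.one = T.one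

/-- The associativity braiding `ν ⊗ μ`, i.e. `v ⊗ w ↦ 1 ⊗ v w`. -/
def AlgStr.sigmaAss (S : AlgStr k A) : A ⊗[k] A →ₗ[k] A ⊗[k] A :=
  TensorProduct.mk k A A S.one ∘ₗ S.mul

/-- The four structure maps of a bialgebra. -/
structure BialgStr (k : Type u) [Field k] (A : Type u) [AddCommGroup A] [Module k A]
    extends AlgStr k A where
  comul : A →ₗ[k] A ⊗[k] A
  counit : A →ₗ[k] k

/-- The structure maps of a bialgebra in the sense of Mathlib. -/
def BialgStr.of (k : Type u) [Field k] (H : Type u) [Ring H] [Bialgebra k H] : BialgStr k H where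
  mul := LinearMap.mul' k H
  one := 1
  comul := Coalgebra.comul
  counit := Coalgebra.counit

/-- `H^op`: the multiplication is composed with the transposition. -/
def BialgStr.op (S : BialgStr k A) : BialgStr k A where
  toAlgStr := S.toAlgStr.op
  comul := S.comul
  counit := S.counit

/-- `H^cop`: the comultiplication is composed with the transposition. -/
def BialgStr.cop (S : BialgStr k A) : BialgStr k A where
  toAlgStr := S.toAlgStr
  comul := (TensorProduct.comm k A A).toLinearMap ∘ₗ S.comul
  counit := S.counit

/-- The tensor product of two bialgebras. -/
def BialgStr.tensor (S : BialgStr k A) (T : BialgStr k B) : BialgStr k (A ⊗[k] B) where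
  toAlgStr := S.toAlgStr.tensor T.toAlgStr
  comul := (TensorProduct.tensorTensorTensorComm k A A B B).toLinearMap ∘ₗ
    TensorProduct.map S.comul T.comul
  counit := (TensorProduct.lid k k).toLinearMap ∘ₗ TensorProduct.map S.counit T.counit

/-- The dual `A^*` of a finite-dimensional bialgebra, for the "rainbow" extension of the evaluation
pairing to tensor squares:
`⟨l₁ l₂, h⟩ = ⟨l₁, h₍₂₎⟩ ⟨l₂, h₍₁₎⟩` and `⟨l, h h'⟩ = ⟨l₍₁₎, h'⟩ ⟨l₍₂₎, h⟩`;
the unit is the counit of `A`, and the counit is the evaluation at the unit of `A`. -/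
def BialgStr.dual [Module.Finite k A] (S : BialgStr k A) : BialgStr k (Module.Dual k A) where
  mul := S.comul.dualMap ∘ₗ TensorProduct.dualDistrib k A A ∘ₗ
    (TensorProduct.comm k (Module.Dual k A) (Module.Dual k A)).toLinearMap
  one := S.counit
  comul := (TensorProduct.comm k (Module.Dual k A) (Module.Dual k A)).toLinearMap ∘ₗ
    (TensorProduct.dualDistribEquiv k A A).symm.toLinearMap ∘ₗ S.mul.dualMap
  counit := Module.Dual.eval k A S.one

/-- `σ_bi : A ⊗ A^* → A^* ⊗ A`, `h ⊗ l ↦ ⟨l₍₁₎, h₍₂₎⟩ l₍₂₎ ⊗ h₍₁₎`. -/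
def BialgStr.sigmaBi [Module.Finite k A] (S : BialgStr k A) :
    A ⊗[k] Module.Dual k A →ₗ[k] Module.Dual k A ⊗[k] A :=
  (TensorProduct.comm k A (Module.Dual k A)).toLinearMap ∘ₗ
    LinearMap.lTensor A
      ((TensorProduct.lid k (Module.Dual k A)).toLinearMap ∘ₗ
        LinearMap.rTensor (Module.Dual k A) (contractRight k A) ∘ₗ
        (TensorProduct.assoc k A (Module.Dual k A) (Module.Dual k A)).symm.toLinearMap) ∘ₗ
    (TensorProduct.assoc k A A (Module.Dual k A ⊗[k] Module.Dual k A)).toLinearMap ∘ₗ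
    TensorProduct.map S.comul S.dual.comul

open Classical in
/-- The inverse of a bijective linear map (and `0` if the map is not bijective). -/
def linInv (f : A →ₗ[k] B) : B →ₗ[k] A :=
  if h : Function.Bijective f then (LinearEquiv.ofBijective f h).symm.toLinearMap else 0

/-- For `ξ : B ⊗ A → A ⊗ B`, the twisted product on `A ⊗ B`:
`(μ_A ⊗ μ_B) ∘ (Id_A ⊗ ξ ⊗ Id_B)`, with unit `1 ⊗ 1`. -/
def AlgStr.twisted (S : AlgStr k A) (T : AlgStr k B) (ξ : B ⊗[k] A →ₗ[k] A ⊗[k] B) :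
    AlgStr k (A ⊗[k] B) where
  mul := TensorProduct.map S.mul T.mul ∘ₗ
    (TensorProduct.assoc k A A (B ⊗[k] B)).symm.toLinearMap ∘ₗ
    LinearMap.lTensor A
      ((TensorProduct.assoc k A B B).toLinearMap ∘ₗ LinearMap.rTensor B ξ ∘ₗ
        (TensorProduct.assoc k B A B).symm.toLinearMap) ∘ₗ
    (TensorProduct.assoc k A B (A ⊗[k] B)).toLinearMap
  one := S.one ⊗ₜ T.one

/-- Moving `C` to the left through `B` by `ζ`, and then through `A` by `ξ`. -/
def passLeft (ξ : A ⊗[k] C →ₗ[k] C ⊗[k] A) (ζ : B ⊗[k] C →ₗ[k] C ⊗[k] B) :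
    (A ⊗[k] B) ⊗[k] C →ₗ[k] C ⊗[k] (A ⊗[k] B) :=
  (TensorProduct.assoc k C A B).toLinearMap ∘ₗ LinearMap.rTensor B ξ ∘ₗ
    (TensorProduct.assoc k A C B).symm.toLinearMap ∘ₗ LinearMap.lTensor A ζ ∘ₗ
    (TensorProduct.assoc k A B C).toLinearMap

end Structures

/-! ### Braided systems -/

/-- The data of a bipointed braided system of rank `r` in finite-dimensional vector spaces:
components `V i`, braiding components `σ i j` for `i ≤ j` only, units and counits. A unit
`k → V i` is given by the image of `1`. -/
structure BraidedData (k : Type u) [Field k] (r : ℕ) where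
  V : Fin r → Type u
  [addCommGroup : ∀ i, AddCommGroup (V i)]
  [module : ∀ i, Module k (V i)]
  [finite : ∀ i, Module.Finite k (V i)]
  σ : ∀ i j : Fin r, i ≤ j → (V i ⊗[k] V j →ₗ[k] V j ⊗[k] V i)
  unit : ∀ i, V i
  counit : ∀ i, V i →ₗ[k] k

attribute [instance] BraidedData.addCommGroup BraidedData.module BraidedData.finite

namespace BraidedData

variable {k : Type u} [Field k] {r : ℕ}

/-- The axioms of a bipointed braided system: the coloured Yang-Baxter equation on
`V i ⊗ V j ⊗ V l` for all `i ≤ j ≤ l`, and `ε_i(ν_i) = 1`. -/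
structure IsBipointedBraided (S : BraidedData k r) : Prop where
  yang_baxter : ∀ (i j l : Fin r) (hij : i ≤ j) (hjl : j ≤ l),
    LinearMap.rTensor (S.V i) (S.σ j l hjl) ∘ₗ
      (TensorProduct.assoc k (S.V j) (S.V l) (S.V i)).symm.toLinearMap ∘ₗ
      LinearMap.lTensor (S.V j) (S.σ i l (hij.trans hjl)) ∘ₗ
      (TensorProduct.assoc k (S.V j) (S.V i) (S.V l)).toLinearMap ∘ₗ
      LinearMap.rTensor (S.V l) (S.σ i j hij) =
    (TensorProduct.assoc k (S.V l) (S.V j) (S.V i)).symm.toLinearMap ∘ₗ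
      LinearMap.lTensor (S.V l) (S.σ i j hij) ∘ₗ
      (TensorProduct.assoc k (S.V l) (S.V i) (S.V j)).toLinearMap ∘ₗ
      LinearMap.rTensor (S.V j) (S.σ i l (hij.trans hjl)) ∘ₗ
      (TensorProduct.assoc k (S.V i) (S.V l) (S.V j)).symm.toLinearMap ∘ₗ
      LinearMap.lTensor (S.V i) (S.σ j l hjl) ∘ₗ
      (TensorProduct.assoc k (S.V i) (S.V j) (S.V l)).toLinearMap
  normalized : ∀ i, S.counit i (S.unit i) = 1

/-- A family of linear maps is a morphism of bipointed braided systems if it respects all the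
braiding components, the units and the counits. -/
structure IsMorphism (S T : BraidedData k r) (f : ∀ i, S.V i →ₗ[k] T.V i) : Prop where
  braiding : ∀ (i j : Fin r) (h : i ≤ j),
    TensorProduct.map (f j) (f i) ∘ₗ S.σ i j h = T.σ i j h ∘ₗ TensorProduct.map (f i) (f j)
  unit : ∀ i, f i (S.unit i) = T.unit i
  counit : ∀ i, T.counit i ∘ₗ f i = S.counit i

/-- The axioms of a right braided module `(M, (ρ i))` over a pointed braided system:
`ρ_j ∘ (ρ_i ⊗ Id_j) = ρ_i ∘ (ρ_j ⊗ Id_i) ∘ (Id_M ⊗ σ_{i,j})` for `i ≤ j`, and the units act by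
the identity. -/
structure IsModule (S : BraidedData k r) (M : Type u) [AddCommGroup M] [Module k M]
    (ρ : ∀ i, M ⊗[k] S.V i →ₗ[k] M) : Prop where
  compat : ∀ (i j : Fin r) (h : i ≤ j),
    ρ j ∘ₗ LinearMap.rTensor (S.V j) (ρ i) =
      ρ i ∘ₗ LinearMap.rTensor (S.V i) (ρ j) ∘ₗ
        (TensorProduct.assoc k M (S.V j) (S.V i)).symm.toLinearMap ∘ₗ
        LinearMap.lTensor M (S.σ i j h) ∘ₗ
        (TensorProduct.assoc k M (S.V i) (S.V j)).toLinearMap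
  unit : ∀ i (m : M), ρ i (m ⊗ₜ S.unit i) = m

end BraidedData

/-- Bipointed braided systems of rank `r` in finite-dimensional vector spaces. -/
structure BrSyst (k : Type u) [Field k] (r : ℕ) extends BraidedData k r where
  isBraided : toBraidedData.IsBipointedBraided

namespace BrSyst

variable {k : Type u} [Field k] {r : ℕ}

/-- Morphisms of bipointed braided systems. -/
@[ext]
structure Hom (S T : BrSyst k r) where
  app : ∀ i, S.V i →ₗ[k] T.V i
  isMorphism : BraidedData.IsMorphism S.toBraidedData T.toBraidedData app

instance : Category (BrSyst k r) where
  Hom S T := Hom S T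
  id S := ⟨fun _ => LinearMap.id, by
    refine ⟨fun i j h => ?_, fun i => rfl, fun i => rfl⟩
    simp [TensorProduct.map_id]⟩
  comp f g := ⟨fun i => g.app i ∘ₗ f.app i, by
    refine ⟨fun i j h => ?_, fun i => ?_, fun i => ?_⟩
    · rw [TensorProduct.map_comp, TensorProduct.map_comp, LinearMap.comp_assoc,
        f.isMorphism.braiding, ← LinearMap.comp_assoc, g.isMorphism.braiding,
        LinearMap.comp_assoc]
    · rw [LinearMap.comp_apply, f.isMorphism.unit, g.isMorphism.unit]
    · rw [← LinearMap.comp_assoc, g.isMorphism.counit, f.isMorphism.counit]⟩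

end BrSyst

/-- Right braided modules over a pointed braided system. -/
structure BrMod {k : Type u} [Field k] {r : ℕ} (S : BraidedData k r) where
  M : Type u
  [addCommGroup : AddCommGroup M]
  [module : Module k M]
  [finite : Module.Finite k M]
  ρ : ∀ i, M ⊗[k] S.V i →ₗ[k] M
  isModule : S.IsModule M ρ

attribute [instance] BrMod.addCommGroup BrMod.module BrMod.finite

namespace BrMod

variable {k : Type u} [Field k] {r : ℕ} {S : BraidedData k r}

/-- Morphisms of braided modules. -/
@[ext]
structure Hom (X Y : BrMod S) where
  map : X.M →ₗ[k] Y.M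
  comm : ∀ i, map ∘ₗ X.ρ i = Y.ρ i ∘ₗ LinearMap.rTensor (S.V i) map

instance : Category (BrMod S) where
  Hom X Y := Hom X Y
  id X := ⟨LinearMap.id, fun i => by simp⟩
  comp f g := ⟨g.map ∘ₗ f.map, fun i => by
    rw [LinearMap.rTensor_comp, LinearMap.comp_assoc, f.comm, ← LinearMap.comp_assoc, g.comm,
      LinearMap.comp_assoc]⟩

end BrMod

/-! ### Modules over an algebra -/

section AlgMod

variable {k : Type u} [Field k] {A : Type u} [AddCommGroup A] [Module k A]

/-- The axioms of a right module. -/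
structure AlgStr.IsModule (S : AlgStr k A) (M : Type u) [AddCommGroup M] [Module k M]
    (ρ : M ⊗[k] A →ₗ[k] M) : Prop where
  assoc : ∀ (m : M) (a b : A), ρ (ρ (m ⊗ₜ a) ⊗ₜ b) = ρ (m ⊗ₜ S.mul (a ⊗ₜ b))
  unit : ∀ m : M, ρ (m ⊗ₜ S.one) = m

/-- Finite-dimensional right modules. -/
structure AlgMod (S : AlgStr k A) where
  M : Type u
  [addCommGroup : AddCommGroup M]
  [module : Module k M]
  [finite : Module.Finite k M]
  ρ : M ⊗[k] A →ₗ[k] M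
  isModule : S.IsModule M ρ

attribute [instance] AlgMod.addCommGroup AlgMod.module AlgMod.finite

/-- Morphisms of right modules. -/
@[ext]
structure AlgMod.Hom {S : AlgStr k A} (X Y : AlgMod S) where
  map : X.M →ₗ[k] Y.M
  comm : map ∘ₗ X.ρ = Y.ρ ∘ₗ LinearMap.rTensor A map

instance (S : AlgStr k A) : Category (AlgMod S) where
  Hom X Y := AlgMod.Hom X Y
  id X := ⟨LinearMap.id, by simp⟩
  comp f g := ⟨g.map ∘ₗ f.map, by
    rw [LinearMap.rTensor_comp, LinearMap.comp_assoc, f.comm, ← LinearMap.comp_assoc, g.comm,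
      LinearMap.comp_assoc]⟩

/-- Transport of modules along an algebra isomorphism `e : A → B`:
`(M, ρ) ↦ (M, ρ ∘ (Id_M ⊗ e⁻¹))`. -/
def AlgMod.transport {B : Type u} [AddCommGroup B] [Module k B] {S : AlgStr k A} {T : AlgStr k B}
    (e : A ≃ₗ[k] B) (he : IsAlgIso S T e) : AlgMod S ⥤ AlgMod T where
  obj X :=
    { M := X.M
      ρ := X.ρ ∘ₗ LinearMap.lTensor X.M e.symm.toLinearMap
      isModule := by
        refine ⟨fun m a b => ?_, fun m => ?_⟩
        · have h : e.symm (T.mul (a ⊗ₜ b)) = S.mul (e.symm a ⊗ₜ e.symm b) := by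
            rw [LinearEquiv.symm_apply_eq, he.map_mul]; simp
          simp [h, X.isModule.assoc]
        · have h : e.symm T.one = S.one := by
            rw [LinearEquiv.symm_apply_eq, he.map_one]
          simp [h, X.isModule.unit] }
  map {X Y} f := ⟨f.map, by
    have h := f.comm
    rw [← LinearMap.comp_assoc, h, LinearMap.comp_assoc, LinearMap.comp_assoc,
      LinearMap.rTensor_comp_lTensor, LinearMap.lTensor_comp_rTensor]⟩

end AlgMod

/-! ### Braided systems of algebras, their permutations, and braided tensor products -/

/-- The data of a braided system all of whose components carry a multiplication, with
associativity braidings `σ_{i,i} = ν_i ⊗ μ_i` on the diagonal. -/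
structure AlgSystem (k : Type u) [Field k] (r : ℕ) extends BraidedData k r where
  mul : ∀ i, V i ⊗[k] V i →ₗ[k] V i
  σ_diag : ∀ i, σ i i le_rfl = AlgStr.sigmaAss ⟨mul i, unit i⟩

namespace AlgSystem

variable {k : Type u} [Field k] {r : ℕ}

/-- The `i`-th component as an algebra. -/
def alg (S : AlgSystem k r) (i : Fin r) : AlgStr k (S.V i) := ⟨S.mul i, S.unit i⟩

/-- Bipointed braided systems of UAAs: the components are UAAs, the `σ_{i,j}` with `i < j` are
natural with respect to the units, and the axioms of a bipointed braided system hold. -/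
structure IsSystemOfUAAs (S : AlgSystem k r) : Prop where
  isUAA : ∀ i, (S.alg i).IsUAA
  natural_left : ∀ (i j : Fin r) (h : i < j) (w : S.V j),
    S.σ i j h.le (S.unit i ⊗ₜ w) = w ⊗ₜ S.unit i
  natural_right : ∀ (i j : Fin r) (h : i < j) (v : S.V i),
    S.σ i j h.le (v ⊗ₜ S.unit j) = S.unit j ⊗ₜ v
  isBraided : S.toBraidedData.IsBipointedBraided

/-- The component permutation `θ S = (V_{θ⁻¹(1)}, …, V_{θ⁻¹(r)})`: the old braiding is kept on
pairs whose order is preserved by `θ`, and `σ⁻¹` is used on pairs whose order is reversed. -/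
def perm (θ : Equiv.Perm (Fin r)) (S : AlgSystem k r) : AlgSystem k r where
  V i := S.V (θ⁻¹ i)
  σ i j _ :=
    if h' : θ⁻¹ i ≤ θ⁻¹ j then S.σ (θ⁻¹ i) (θ⁻¹ j) h'
    else linInv (S.σ (θ⁻¹ j) (θ⁻¹ i) (le_of_not_ge h'))
  unit i := S.unit (θ⁻¹ i)
  counit i := S.counit (θ⁻¹ i)
  mul i := S.mul (θ⁻¹ i)
  σ_diag i := by
    rw [dif_pos le_rfl]
    exact S.σ_diag (θ⁻¹ i)

/-- The space `V₄ ⊗ V₃ ⊗ V₂ ⊗ V₁` underlying the braided tensor product (indices of `Fin 4`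
start at `0`). -/
abbrev BTP (S : AlgSystem k 4) : Type u :=
  S.V 3 ⊗[k] (S.V 2 ⊗[k] (S.V 1 ⊗[k] S.V 0))

/-- The braided tensor product of the four algebras, on `V₄ ⊗ V₃ ⊗ V₂ ⊗ V₁`. The multiplication is
`(μ₄ ⊗ μ₃ ⊗ μ₂ ⊗ μ₁) ∘ ξ₁₂⁶ ∘ (ξ₂₃⁴ ∘ ξ₁₃⁵) ∘ (ξ₃₄² ∘ ξ₂₄³ ∘ ξ₁₄⁴)`, the superscript being the
position at which `ξ_{i,j} = σ_{i,j}` is applied: the second `V₄` is moved to the left through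
`V₁`, `V₂`, `V₃`, then the second `V₃` through `V₁`, `V₂`, and then the second `V₂` through
`V₁`. -/
def btp (S : AlgSystem k 4) : AlgStr k S.BTP :=
  (S.alg 3).twisted
    ((S.alg 2).twisted
      ((S.alg 1).twisted (S.alg 0) (S.σ 0 1 (by decide)))
      (passLeft (S.σ 1 2 (by decide)) (S.σ 0 2 (by decide))))
    (passLeft (S.σ 2 3 (by decide)) (passLeft (S.σ 1 3 (by decide)) (S.σ 0 3 (by decide))))

/-- `Id ⊗ Id ⊗ ξ₁₂⁻¹`. -/
def step0 (S : AlgSystem k 4) :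
    S.BTP →ₗ[k] S.V 3 ⊗[k] (S.V 2 ⊗[k] (S.V 0 ⊗[k] S.V 1)) :=
  LinearMap.lTensor _ (LinearMap.lTensor _ (linInv (S.σ 0 1 (by decide))))

/-- `Id ⊗ ξ₂₃⁻¹ ⊗ Id`. -/
def step1 (S : AlgSystem k 4) :
    S.BTP →ₗ[k] S.V 3 ⊗[k] (S.V 1 ⊗[k] (S.V 2 ⊗[k] S.V 0)) :=
  LinearMap.lTensor _
    ((TensorProduct.assoc k (S.V 1) (S.V 2) (S.V 0)).toLinearMap ∘ₗ
      LinearMap.rTensor _ (linInv (S.σ 1 2 (by decide))) ∘ₗ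
      (TensorProduct.assoc k (S.V 2) (S.V 1) (S.V 0)).symm.toLinearMap)

/-- `ξ₃₄⁻¹ ⊗ Id ⊗ Id`. -/
def step2 (S : AlgSystem k 4) :
    S.BTP →ₗ[k] S.V 2 ⊗[k] (S.V 3 ⊗[k] (S.V 1 ⊗[k] S.V 0)) :=
  (TensorProduct.assoc k (S.V 2) (S.V 3) (S.V 1 ⊗[k] S.V 0)).toLinearMap ∘ₗ
    LinearMap.rTensor _ (linInv (S.σ 2 3 (by decide))) ∘ₗ
    (TensorProduct.assoc k (S.V 3) (S.V 2) (S.V 1 ⊗[k] S.V 0)).symm.toLinearMap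

/-- A family of linear isomorphisms `Φ θ` from the braided tensor product of `S` to that of `θ S`
such that `Φ θ` is the composite `s_{i₁} ∘ ⋯ ∘ s_{iₘ}` for every minimal decomposition
`θ = s_{i₁} ⋯ s_{iₘ}` into adjacent transpositions, where an adjacent transposition `s_p` acts by
`Id ⊗ ξ_{p,p+1}⁻¹ ⊗ Id`. (The decomposition obtained from one of `θ` by adding `s_p` on the left
is minimal exactly if `θ⁻¹(p) < θ⁻¹(p+1)`.) -/
structure IsPermFamily (S : AlgSystem k 4)
    (Φ : ∀ θ : Equiv.Perm (Fin 4), S.BTP ≃ₗ[k] (S.perm θ).BTP) : Prop where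
  one : ∀ x : S.BTP, Φ 1 x = x
  swap01 : ∀ θ : Equiv.Perm (Fin 4), θ⁻¹ 0 < θ⁻¹ 1 →
    ∀ x : S.BTP, Φ (Equiv.swap 0 1 * θ) x = (S.perm θ).step0 (Φ θ x)
  swap12 : ∀ θ : Equiv.Perm (Fin 4), θ⁻¹ 1 < θ⁻¹ 2 →
    ∀ x : S.BTP, Φ (Equiv.swap 1 2 * θ) x = (S.perm θ).step1 (Φ θ x)
  swap23 : ∀ θ : Equiv.Perm (Fin 4), θ⁻¹ 2 < θ⁻¹ 3 →
    ∀ x : S.BTP, Φ (Equiv.swap 2 3 * θ) x = (S.perm θ).step2 (Φ θ x)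

end AlgSystem

namespace BrMod

variable {k : Type u} [Field k]

/-- `ρ₁ ∘ (ρ₂ ⊗ Id) ∘ (ρ₃ ⊗ Id) ∘ (ρ₄ ⊗ Id)`, i.e.
`m ⊗ (v₄ ⊗ v₃ ⊗ v₂ ⊗ v₁) ↦ (((m · v₄) · v₃) · v₂) · v₁`. -/
def iterAct {S : AlgSystem k 4} (X : BrMod S.toBraidedData) : X.M ⊗[k] S.BTP →ₗ[k] X.M :=
  X.ρ 0 ∘ₗ LinearMap.rTensor _ (X.ρ 1) ∘ₗ
    (TensorProduct.assoc k X.M (S.V 1) (S.V 0)).symm.toLinearMap ∘ₗ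
    LinearMap.rTensor _ (X.ρ 2) ∘ₗ
    (TensorProduct.assoc k X.M (S.V 2) (S.V 1 ⊗[k] S.V 0)).symm.toLinearMap ∘ₗ
    LinearMap.rTensor _ (X.ρ 3) ∘ₗ
    (TensorProduct.assoc k X.M (S.V 3) (S.V 2 ⊗[k] (S.V 1 ⊗[k] S.V 0))).symm.toLinearMap

theorem iterAct_tmul {S : AlgSystem k 4} (X : BrMod S.toBraidedData) (m : X.M) (v₄ : S.V 3)
    (v₃ : S.V 2) (v₂ : S.V 1) (v₁ : S.V 0) :
    X.iterAct (m ⊗ₜ (v₄ ⊗ₜ (v₃ ⊗ₜ (v₂ ⊗ₜ v₁)))) =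
      X.ρ 0 (X.ρ 1 (X.ρ 2 (X.ρ 3 (m ⊗ₜ v₄) ⊗ₜ v₃) ⊗ₜ v₂) ⊗ₜ v₁) := by
  simp [iterAct]

theorem Hom.comm_apply {r : ℕ} {S : BraidedData k r} {X Y : BrMod S} (f : Hom X Y) (i : Fin r)
    (m : X.M) (v : S.V i) : f.map (X.ρ i (m ⊗ₜ v)) = Y.ρ i (f.map m ⊗ₜ v) := by
  have h := LinearMap.congr_fun (f.comm i) (m ⊗ₜ v)
  simpa using h

/-- The functor from braided modules to modules over the braided tensor product,
`(M, (ρ i)) ↦ (M, iterAct)`, identical on morphisms. -/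
def toAlgMod (S : AlgSystem k 4)
    (h : ∀ X : BrMod S.toBraidedData, S.btp.IsModule X.M X.iterAct) :
    BrMod S.toBraidedData ⥤ AlgMod S.btp where
  obj X := ⟨X.M, X.iterAct, h X⟩
  map {X Y} f := ⟨f.map, by
    refine TensorProduct.ext' fun m w => ?_
    simp only [LinearMap.comp_apply, LinearMap.rTensor_tmul]
    induction w using TensorProduct.induction_on with
    | zero => simp
    | add x y hx hy => simp only [TensorProduct.tmul_add, map_add, hx, hy]
    | tmul v₄ w =>
      induction w using TensorProduct.induction_on with
      | zero => simp
      | add x y hx hy => simp only [TensorProduct.tmul_add, map_add, hx, hy]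
      | tmul v₃ w =>
        induction w using TensorProduct.induction_on with
        | zero => simp
        | add x y hx hy => simp only [TensorProduct.tmul_add, map_add, hx, hy]
        | tmul v₂ v₁ => simp only [iterAct_tmul, Hom.comm_apply]⟩

/-- The functor `(M, (ρ i)) ↦ (M, (ρ (θ⁻¹ i)))`, identical on morphisms. -/
def permFunctor {r : ℕ} (S : AlgSystem k r) (θ : Equiv.Perm (Fin r))
    (h : ∀ X : BrMod S.toBraidedData,
      (S.perm θ).toBraidedData.IsModule X.M (fun i => X.ρ (θ⁻¹ i))) :
    BrMod S.toBraidedData ⥤ BrMod (S.perm θ).toBraidedData where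
  obj X := ⟨X.M, fun i => X.ρ (θ⁻¹ i), h X⟩
  map {_ _} f := ⟨f.map, fun i => f.comm (θ⁻¹ i)⟩

end BrMod

/-! ### The rank four system of a bialgebra -/

section Bprime

variable (k : Type u) [Field k] (H : Type u) [Ring H] [Bialgebra k H] [Module.Finite k H]

/-- The components `H, H^op, H^*, (H^cop)^*` (underlying spaces). -/
def BprimeV : Fin 4 → Type u
  | 0 => H
  | 1 => H
  | 2 => Module.Dual k H
  | 3 => Module.Dual k H

instance : ∀ i, AddCommGroup (BprimeV k H i)
  | 0 => inferInstanceAs (AddCommGroup H)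
  | 1 => inferInstanceAs (AddCommGroup H)
  | 2 => inferInstanceAs (AddCommGroup (Module.Dual k H))
  | 3 => inferInstanceAs (AddCommGroup (Module.Dual k H))

instance : ∀ i, Module k (BprimeV k H i)
  | 0 => inferInstanceAs (Module k H)
  | 1 => inferInstanceAs (Module k H)
  | 2 => inferInstanceAs (Module k (Module.Dual k H))
  | 3 => inferInstanceAs (Module k (Module.Dual k H))

instance : ∀ i, Module.Finite k (BprimeV k H i)
  | 0 => inferInstanceAs (Module.Finite k H)
  | 1 => inferInstanceAs (Module.Finite k H)
  | 2 => inferInstanceAs (Module.Finite k (Module.Dual k H))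
  | 3 => inferInstanceAs (Module.Finite k (Module.Dual k H))

/-- The algebra structures of the components `H, H^op, H^*, (H^cop)^*`. -/
def BprimeAlg : ∀ i : Fin 4, AlgStr k (BprimeV k H i)
  | 0 => (BialgStr.of k H).toAlgStr
  | 1 => (BialgStr.of k H).op.toAlgStr
  | 2 => (BialgStr.of k H).dual.toAlgStr
  | 3 => (BialgStr.of k H).cop.dual.toAlgStr

/-- The counits `ε, ε, ν^*, ν^*`. -/
def BprimeCounit : ∀ i : Fin 4, BprimeV k H i →ₗ[k] k
  | 0 => (BialgStr.of k H).counit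
  | 1 => (BialgStr.of k H).op.counit
  | 2 => (BialgStr.of k H).dual.counit
  | 3 => (BialgStr.of k H).cop.dual.counit

/-- The braiding components. -/
def BprimeSigma : ∀ i j : Fin 4, i ≤ j →
    (BprimeV k H i ⊗[k] BprimeV k H j →ₗ[k] BprimeV k H j ⊗[k] BprimeV k H i)
  | 0, 0, _ => (BprimeAlg k H 0).sigmaAss
  | 1, 1, _ => (BprimeAlg k H 1).sigmaAss
  | 2, 2, _ => (BprimeAlg k H 2).sigmaAss
  | 3, 3, _ => (BprimeAlg k H 3).sigmaAss
  | 0, 1, _ => (TensorProduct.comm k H H).toLinearMap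
  | 2, 3, _ => (TensorProduct.comm k (Module.Dual k H) (Module.Dual k H)).toLinearMap
  | 0, 2, _ => (BialgStr.of k H).sigmaBi
  | 1, 2, _ => (BialgStr.of k H).op.sigmaBi
  | 0, 3, _ => (BialgStr.of k H).cop.sigmaBi
  | 1, 3, _ => (BialgStr.of k H).op.cop.sigmaBi
  | 1, 0, h => absurd h (by decide)
  | 2, 0, h => absurd h (by decide)
  | 2, 1, h => absurd h (by decide)
  | 3, 0, h => absurd h (by decide)
  | 3, 1, h => absurd h (by decide)
  | 3, 2, h => absurd h (by decide)

/-- The system `B'(H) = (H, H^op, H^*, (H^cop)^*)`, with units `ν, ν, ε^*, ε^*` and counits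
`ε, ε, ν^*, ν^*`. -/
def Bprime : AlgSystem k 4 where
  V := BprimeV k H
  σ := BprimeSigma k H
  unit i := (BprimeAlg k H i).one
  counit := BprimeCounit k H
  mul i := (BprimeAlg k H i).mul
  σ_diag i := by fin_cases i <;> rfl

/-- The algebra `W(H)`, the braided tensor product of `(H^cop)^*`, `H^*`, `H^op` and `H`. -/
def W : AlgStr k (Bprime k H).BTP := (Bprime k H).btp

/-- The algebra `θ · W(H)`. -/
def thetaW (θ : Equiv.Perm (Fin 4)) : AlgStr k ((Bprime k H).perm θ).BTP :=
  ((Bprime k H).perm θ).btp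

variable {k H} {K : Type u} [Ring K] [Bialgebra k K] [Module.Finite k K]

/-- The family `(f, f, g^*, g^*)` for `f : H → K` and `g : K → H` (to be used for `g = f⁻¹`). -/
def BprimeMap (f : H →ₗ[k] K) (g : K →ₗ[k] H) :
    ∀ i : Fin 4, (Bprime k H).V i →ₗ[k] (Bprime k K).V i
  | 0 => f
  | 1 => f
  | 2 => g.dualMap
  | 3 => g.dualMap

theorem BprimeMap_id : BprimeMap (LinearMap.id : H →ₗ[k] H) LinearMap.id =
    fun _ => LinearMap.id := by
  funext i
  fin_cases i <;> rfl

theorem BprimeMap_comp {L : Type u} [Ring L] [Bialgebra k L] [Module.Finite k L]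
    (f : H →ₗ[k] K) (g : K →ₗ[k] H) (f' : K →ₗ[k] L) (g' : L →ₗ[k] K) :
    BprimeMap (f' ∘ₗ f) (g ∘ₗ g') = fun i => BprimeMap f' g' i ∘ₗ BprimeMap f g i := by
  funext i
  fin_cases i <;> rfl

end Bprime

/-- Finite-dimensional bialgebras over `k`, with bialgebra morphisms. -/
abbrev FdBialg (k : Type u) [Field k] : Type (u + 1) :=
  ObjectProperty.FullSubcategory (fun H : BialgCat.{u} k => Module.Finite k H)

instance (k : Type u) [Field k] (H : FdBialg k) : Module.Finite k H.obj := H.property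

section Functor

variable (k : Type u) [Field k]

/-- The linear map underlying a morphism of bialgebras. -/
def FdBialg.lin {k : Type u} [Field k] {H K : FdBialg k} (f : H ⟶ K) : H.obj →ₗ[k] K.obj :=
  (f.hom.toBialgHom : H.obj →ₗ[k] K.obj)

/-- The functor from the groupoid of finite-dimensional bialgebras and bialgebra isomorphisms to
the groupoid of bipointed braided systems of rank `4` and their isomorphisms, given by
`H ↦ B'(H)` and `f ↦ (f, f, (f⁻¹)^*, (f⁻¹)^*)`. -/
def BprimeFunctor
    (hobj : ∀ H : FdBialg k, (Bprime k H.obj).toBraidedData.IsBipointedBraided)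
    (hmap : ∀ (H K : FdBialg k) (f : H ≅ K),
      BraidedData.IsMorphism (Bprime k H.obj).toBraidedData (Bprime k K.obj).toBraidedData
        (BprimeMap (FdBialg.lin f.hom) (FdBialg.lin f.inv))) :
    Core (FdBialg k) ⥤ Core (BrSyst k 4) :=
  Core.functorToCore
    { obj := fun H => ⟨(Bprime k H.of.obj).toBraidedData, hobj H.of⟩
      map := fun {_ _} f =>
        ⟨BprimeMap (FdBialg.lin f.iso.hom) (FdBialg.lin f.iso.inv), hmap _ _ f.iso⟩
      map_id := fun _ => BrSyst.Hom.ext BprimeMap_id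
      map_comp := fun _ _ => BrSyst.Hom.ext (BprimeMap_comp _ _ _ _) }

end Functor

/-! ### Hopf bimodules -/

section HopfBimodules

variable (k : Type u) [Field k] (H : Type u) [Ring H] [Bialgebra k H] [Module.Finite k H]

/-- Finite-dimensional Hopf bimodules over the bialgebra `H`. -/
structure HopfBimod where
  M : Type u
  [addCommGroup : AddCommGroup M]
  [module : Module k M]
  [finite : Module.Finite k M]
  /-- right action -/
  ρ : M ⊗[k] H →ₗ[k] M
  /-- left action -/
  lam : H ⊗[k] M →ₗ[k] M
  /-- right coaction -/
  δ : M →ₗ[k] M ⊗[k] H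
  /-- left coaction -/
  γ : M →ₗ[k] H ⊗[k] M
  right_assoc : ∀ (m : M) (g h : H), ρ (ρ (m ⊗ₜ g) ⊗ₜ h) = ρ (m ⊗ₜ (g * h))
  right_unit : ∀ m : M, ρ (m ⊗ₜ (1 : H)) = m
  left_assoc : ∀ (g h : H) (m : M), lam (g ⊗ₜ lam (h ⊗ₜ m)) = lam ((g * h) ⊗ₜ m)
  left_unit : ∀ m : M, lam ((1 : H) ⊗ₜ m) = m
  left_right : ∀ (g : H) (m : M) (h : H),
    ρ (lam (g ⊗ₜ m) ⊗ₜ h) = lam (g ⊗ₜ ρ (m ⊗ₜ h))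
  right_coassoc : (TensorProduct.assoc k M H H).toLinearMap ∘ₗ LinearMap.rTensor H δ ∘ₗ δ =
    LinearMap.lTensor M Coalgebra.comul ∘ₗ δ
  right_counit : (TensorProduct.rid k M).toLinearMap ∘ₗ
    LinearMap.lTensor M (Coalgebra.counit : H →ₗ[k] k) ∘ₗ δ = LinearMap.id
  left_coassoc : (TensorProduct.assoc k H H M).toLinearMap ∘ₗ
    LinearMap.rTensor M Coalgebra.comul ∘ₗ γ = LinearMap.lTensor H γ ∘ₗ γ
  left_counit : (TensorProduct.lid k M).toLinearMap ∘ₗ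
    LinearMap.rTensor M (Coalgebra.counit : H →ₗ[k] k) ∘ₗ γ = LinearMap.id
  left_right_co : (TensorProduct.assoc k H M H).toLinearMap ∘ₗ LinearMap.rTensor H γ ∘ₗ δ =
    LinearMap.lTensor H δ ∘ₗ γ
  hopf_right_right : δ ∘ₗ ρ = TensorProduct.map ρ (LinearMap.mul' k H) ∘ₗ
    (TensorProduct.tensorTensorTensorComm k M H H H).toLinearMap ∘ₗ
    TensorProduct.map δ Coalgebra.comul
  hopf_left_right : δ ∘ₗ lam = TensorProduct.map lam (LinearMap.mul' k H) ∘ₗ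
    (TensorProduct.tensorTensorTensorComm k H H M H).toLinearMap ∘ₗ
    TensorProduct.map Coalgebra.comul δ
  hopf_right_left : γ ∘ₗ ρ = TensorProduct.map (LinearMap.mul' k H) ρ ∘ₗ
    (TensorProduct.tensorTensorTensorComm k H M H H).toLinearMap ∘ₗ
    TensorProduct.map γ Coalgebra.comul
  hopf_left_left : γ ∘ₗ lam = TensorProduct.map (LinearMap.mul' k H) lam ∘ₗ
    (TensorProduct.tensorTensorTensorComm k H H H M).toLinearMap ∘ₗ
    TensorProduct.map Coalgebra.comul γ

attribute [instance] HopfBimod.addCommGroup HopfBimod.module HopfBimod.finite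

namespace HopfBimod

variable {k H}

/-- Morphisms of Hopf bimodules: linear maps respecting both actions and both coactions. -/
@[ext]
structure Hom (X Y : HopfBimod k H) where
  map : X.M →ₗ[k] Y.M
  comm_ρ : map ∘ₗ X.ρ = Y.ρ ∘ₗ LinearMap.rTensor H map
  comm_lam : map ∘ₗ X.lam = Y.lam ∘ₗ LinearMap.lTensor H map
  comm_δ : LinearMap.rTensor H map ∘ₗ X.δ = Y.δ ∘ₗ map
  comm_γ : LinearMap.lTensor H map ∘ₗ X.γ = Y.γ ∘ₗ map

instance : Category (HopfBimod k H) where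
  Hom X Y := Hom X Y
  id X := ⟨LinearMap.id, by simp, by simp, by simp, by simp⟩
  comp f g := ⟨g.map ∘ₗ f.map, by
      rw [LinearMap.rTensor_comp, LinearMap.comp_assoc, f.comm_ρ, ← LinearMap.comp_assoc, g.comm_ρ,
        LinearMap.comp_assoc], by
      rw [LinearMap.lTensor_comp, LinearMap.comp_assoc, f.comm_lam, ← LinearMap.comp_assoc,
        g.comm_lam, LinearMap.comp_assoc], by
      rw [LinearMap.rTensor_comp, LinearMap.comp_assoc, f.comm_δ, ← LinearMap.comp_assoc, g.comm_δ,
        LinearMap.comp_assoc], by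
      rw [LinearMap.lTensor_comp, LinearMap.comp_assoc, f.comm_γ, ← LinearMap.comp_assoc, g.comm_γ,
        LinearMap.comp_assoc]⟩

/-- `δ^co = (Id_M ⊗ ev) ∘ (δ ⊗ Id) : M ⊗ H^* → M`. -/
def deltaCo (X : HopfBimod k H) : X.M ⊗[k] Module.Dual k H →ₗ[k] X.M :=
  (TensorProduct.rid k X.M).toLinearMap ∘ₗ LinearMap.lTensor X.M (contractRight k H) ∘ₗ
    (TensorProduct.assoc k X.M H (Module.Dual k H)).toLinearMap ∘ₗ
    LinearMap.rTensor (Module.Dual k H) X.δ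

/-- `γ^co = (ev ⊗ Id_M) ∘ (Id ⊗ γ) : H^* ⊗ M → M`. -/
def gammaCo (X : HopfBimod k H) : Module.Dual k H ⊗[k] X.M →ₗ[k] X.M :=
  (TensorProduct.lid k X.M).toLinearMap ∘ₗ LinearMap.rTensor X.M (contractLeft k H) ∘ₗ
    (TensorProduct.assoc k (Module.Dual k H) H X.M).symm.toLinearMap ∘ₗ
    LinearMap.lTensor (Module.Dual k H) X.γ

/-- The four actions `(ρ, R(λ), δ^co, R(γ^co))`, where `R` is the composition with the
transposition. -/
def act (X : HopfBimod k H) : ∀ i : Fin 4, X.M ⊗[k] (Bprime k H).V i →ₗ[k] X.M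
  | 0 => X.ρ
  | 1 => X.lam ∘ₗ (TensorProduct.comm k X.M H).toLinearMap
  | 2 => X.deltaCo
  | 3 => X.gammaCo ∘ₗ (TensorProduct.comm k X.M (Module.Dual k H)).toLinearMap

theorem Hom.comm_act {X Y : HopfBimod k H} (f : Hom X Y) (i : Fin 4) :
    f.map ∘ₗ X.act i = Y.act i ∘ₗ LinearMap.rTensor ((Bprime k H).V i) f.map := by
  match i with
  | 0 => exact f.comm_ρ
  | 1 =>
    change f.map ∘ₗ X.lam ∘ₗ (TensorProduct.comm k X.M H).toLinearMap =
      (Y.lam ∘ₗ (TensorProduct.comm k Y.M H).toLinearMap) ∘ₗ LinearMap.rTensor H f.map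
    refine TensorProduct.ext' fun m h => ?_
    simpa using LinearMap.congr_fun f.comm_lam (h ⊗ₜ m)
  | 2 =>
    change f.map ∘ₗ X.deltaCo = Y.deltaCo ∘ₗ LinearMap.rTensor (Module.Dual k H) f.map
    refine TensorProduct.ext' fun m l => ?_
    have h := LinearMap.congr_fun f.comm_δ m
    simp only [LinearMap.comp_apply] at h
    simp only [deltaCo, LinearMap.comp_apply, LinearMap.rTensor_tmul, ← h]
    generalize X.δ m = t
    induction t using TensorProduct.induction_on with
    | zero => simp
    | add x y hx hy => simp only [TensorProduct.add_tmul, map_add, hx, hy]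
    | tmul m h => simp
  | 3 =>
    change f.map ∘ₗ X.gammaCo ∘ₗ (TensorProduct.comm k X.M (Module.Dual k H)).toLinearMap =
      (Y.gammaCo ∘ₗ (TensorProduct.comm k Y.M (Module.Dual k H)).toLinearMap) ∘ₗ
        LinearMap.rTensor (Module.Dual k H) f.map
    refine TensorProduct.ext' fun m l => ?_
    have h := LinearMap.congr_fun f.comm_γ m
    simp only [LinearMap.comp_apply] at h
    simp only [gammaCo, LinearMap.comp_apply, LinearMap.rTensor_tmul, LinearEquiv.coe_coe,
      TensorProduct.comm_tmul, LinearMap.lTensor_tmul, ← h]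
    generalize X.γ m = t
    induction t using TensorProduct.induction_on with
    | zero => simp
    | add x y hx hy => simp only [TensorProduct.tmul_add, map_add, hx, hy]
    | tmul h m => simp

/-- The functor `(M, ρ, λ, δ, γ) ↦ (M; ρ, R(λ), δ^co, R(γ^co))`, identical on morphisms. -/
def toBrMod (h : ∀ X : HopfBimod k H, (Bprime k H).toBraidedData.IsModule X.M X.act) :
    HopfBimod k H ⥤ BrMod (Bprime k H).toBraidedData where
  obj X := ⟨X.M, X.act, h X⟩
  map {_ _} f := ⟨f.map, f.comm_act⟩

end HopfBimod

end HopfBimodules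

/-! ### Crossed products over a bialgebra -/

section Crossed

variable {k : Type u} [Field k]
variable {A B C : Type u} [AddCommGroup A] [Module k A] [AddCommGroup B] [Module k B]
  [AddCommGroup C] [Module k C]

/-- The two-sided crossed product `A # B # C` of a bialgebra `B`, a left `B`-module algebra `A`
(with action `b ⊗ a ↦ b ▷ a`) and a right `B`-module algebra `C` (with action `c ⊗ b ↦ c ◁ b`):
`(a # b # c) (a' # b' # c') = a (b₍₁₎ ▷ a') # b₍₂₎ b'₍₁₎ # (c ◁ b'₍₂₎) c'`. -/
def twoSidedCrossed (S : BialgStr k B) (SA : AlgStr k A) (SC : AlgStr k C)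
    (left : B ⊗[k] A →ₗ[k] A) (right : C ⊗[k] B →ₗ[k] C) : AlgStr k (A ⊗[k] (B ⊗[k] C)) :=
  SA.twisted
    (S.toAlgStr.twisted SC
      (LinearMap.lTensor B right ∘ₗ (TensorProduct.leftComm k C B B).toLinearMap ∘ₗ
        LinearMap.lTensor C S.comul))
    (passLeft
      (LinearMap.rTensor B left ∘ₗ (TensorProduct.rightComm k B B A).toLinearMap ∘ₗ
        LinearMap.rTensor A S.comul)
      (TensorProduct.comm k C A).toLinearMap)

/-- For `t (b ⊗ b' ⊗ x) = b ▷ x ◁ b'`, the map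
`b ⊗ x ↦ (b₍₁₎ ▷ x ◁ b₍₃₎) ⊗ b₍₂₎ : B ⊗ A → A ⊗ B`. -/
def diagTwist (S : BialgStr k B) (t : (B ⊗[k] B) ⊗[k] A →ₗ[k] A) :
    B ⊗[k] A →ₗ[k] A ⊗[k] B :=
  LinearMap.rTensor B t ∘ₗ (TensorProduct.rightComm k (B ⊗[k] B) B A).toLinearMap ∘ₗ
    LinearMap.rTensor A ((TensorProduct.rightComm k B B B).toLinearMap ∘ₗ
      LinearMap.rTensor B S.comul ∘ₗ S.comul)

/-- For `left (b ⊗ x) = b ▷ x` and `right (x ⊗ b) = x ◁ b`, the map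
`b ⊗ b' ⊗ x ↦ (f b ▷ x) ◁ f' b'`. -/
def biact (left : B ⊗[k] A →ₗ[k] A) (right : A ⊗[k] B →ₗ[k] A) (f f' : B →ₗ[k] B) :
    (B ⊗[k] B) ⊗[k] A →ₗ[k] A :=
  right ∘ₗ LinearMap.rTensor B left ∘ₗ (TensorProduct.rightComm k B B A).toLinearMap ∘ₗ
    LinearMap.rTensor A (TensorProduct.map f f')

/-- The diagonal crossed product `A ⋈ B` of a Hopf algebra `B` with inverse antipode `sInv` and a
`B`-bimodule algebra `A`:
`(x ⋈ b) (x' ⋈ b') = x (b₍₁₎ ▷ x' ◁ sInv (b₍₃₎)) ⋈ b₍₂₎ b'`. -/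
def diagonalCrossed (S : BialgStr k B) (sInv : B →ₗ[k] B) (SA : AlgStr k A)
    (left : B ⊗[k] A →ₗ[k] A) (right : A ⊗[k] B →ₗ[k] A) : AlgStr k (A ⊗[k] B) :=
  SA.twisted S.toAlgStr (diagTwist S (biact left right LinearMap.id sInv))

/-- The mirror version of the diagonal crossed product, on `B ⊗ A`:
`(b ⊗ x) (b' ⊗ x') = b b'₍₂₎ ⊗ (sInv (b'₍₁₎) ▷ x ◁ b'₍₃₎) x'`. -/
def diagonalCrossedMirror (S : BialgStr k B) (sInv : B →ₗ[k] B) (SA : AlgStr k A)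
    (left : B ⊗[k] A →ₗ[k] A) (right : A ⊗[k] B →ₗ[k] A) : AlgStr k (B ⊗[k] A) :=
  S.toAlgStr.twisted SA
    ((TensorProduct.comm k A B).toLinearMap ∘ₗ
      diagTwist S (biact left right sInv LinearMap.id) ∘ₗ
      (TensorProduct.comm k A B).toLinearMap)

end Crossed

/-! ### The algebras of Cibils-Rosso and Panaite -/

section XYZ

variable (k : Type u) [Field k] (H : Type u) [Ring H] [HopfAlgebra k H] [Module.Finite k H]

/-- The antipode `s`. -/
def antip : H →ₗ[k] H := HopfAlgebra.antipode k

/-- The inverse `s⁻¹` of the antipode. -/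
def antipInv : H →ₗ[k] H := linInv (antip k H)

/-- `(g ⊗ h) ⊗ l ↦ l(g - h)`, the functional `x ↦ l(g x h)`. -/
def translate : (H ⊗[k] H) ⊗[k] Module.Dual k H →ₗ[k] Module.Dual k H :=
  TensorProduct.lift (Module.Dual.transpose ∘ₗ TensorProduct.lift
    (LinearMap.mk₂ k (fun g h => LinearMap.mulLeft k g ∘ₗ LinearMap.mulRight k h)
      (by intros; ext; simp [add_mul]) (by intros; ext; simp)
      (by intros; ext; simp [mul_add]) (by intros; ext; simp)))

/-- `l ⊗ (g ⊗ h) ↦ l(s(g) - s⁻¹(h))`. -/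
def translateInv : Module.Dual k H ⊗[k] (H ⊗[k] H) →ₗ[k] Module.Dual k H :=
  translate k H ∘ₗ (TensorProduct.comm k (Module.Dual k H) (H ⊗[k] H)).toLinearMap ∘ₗ
    LinearMap.lTensor (Module.Dual k H) (TensorProduct.map (antip k H) (antipInv k H))

/-- The two-sided crossed product `Y(H) = H^* # (H^op ⊗ H) # (H^*)^op`, where `H^op ⊗ H` carries the
coopposite comultiplication (this is forced by the rainbow duality), with actions
`(g ⊗ h) ▷ l = l(g - h)` and `l ◁ (g ⊗ h) = l(s(g) - s⁻¹(h))`. -/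
def algY : AlgStr k (Module.Dual k H ⊗[k] ((H ⊗[k] H) ⊗[k] Module.Dual k H)) :=
  twoSidedCrossed ((BialgStr.of k H).op.tensor (BialgStr.of k H)).cop
    (BialgStr.of k H).dual.toAlgStr (BialgStr.of k H).dual.toAlgStr.op
    (translate k H) (translateInv k H)

/-- The left action of `H^op ⊗ H` on the first factor of `H^* ⊗ (H^*)^op`. -/
def leftAct : (H ⊗[k] H) ⊗[k] (Module.Dual k H ⊗[k] Module.Dual k H) →ₗ[k]
    Module.Dual k H ⊗[k] Module.Dual k H :=
  LinearMap.rTensor _ (translate k H) ∘ₗ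
    (TensorProduct.assoc k (H ⊗[k] H) (Module.Dual k H) (Module.Dual k H)).symm.toLinearMap

/-- The right action of `H^op ⊗ H` on the second factor of `H^* ⊗ (H^*)^op`. -/
def rightAct : (Module.Dual k H ⊗[k] Module.Dual k H) ⊗[k] (H ⊗[k] H) →ₗ[k]
    Module.Dual k H ⊗[k] Module.Dual k H :=
  LinearMap.lTensor _ (translateInv k H) ∘ₗ
    (TensorProduct.assoc k (Module.Dual k H) (Module.Dual k H) (H ⊗[k] H)).toLinearMap

/-- The diagonal crossed product `Z(H) = (H^* ⊗ (H^*)^op) ⋈ (H^op ⊗ H)`, with the above actions of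
`H^op ⊗ H` (with coopposite comultiplication, so that the inverse antipode is `s⁻¹ ⊗ s`). -/
def algZ : AlgStr k ((Module.Dual k H ⊗[k] Module.Dual k H) ⊗[k] (H ⊗[k] H)) :=
  diagonalCrossed ((BialgStr.of k H).op.tensor (BialgStr.of k H)).cop
    (TensorProduct.map (antipInv k H) (antip k H))
    ((BialgStr.of k H).dual.toAlgStr.tensor (BialgStr.of k H).dual.toAlgStr.op)
    (leftAct k H) (rightAct k H)

/-- The twisted product `X(H) = (H ⊗ H^op) ⊗ (H^* ⊗ (H^*)^op)`: both brackets are subalgebras, and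
`(l ⊗ l') · (h ⊗ g) =
  (h₍₂₎ ⊗ g₍₂₎) ⊗ (l(s⁻¹(g₍₃₎) - s(h₍₃₎)) ⊗ l'(s(g₍₁₎) - s⁻¹(h₍₁₎)))`. -/
def algX : AlgStr k ((H ⊗[k] H) ⊗[k] (Module.Dual k H ⊗[k] Module.Dual k H)) :=
  diagonalCrossedMirror ((BialgStr.of k H).tensor (BialgStr.of k H).op).cop
    (TensorProduct.map (antip k H) (antipInv k H))
    ((BialgStr.of k H).dual.toAlgStr.tensor (BialgStr.of k H).dual.toAlgStr.op)
    (leftAct k H ∘ₗ LinearMap.rTensor _ (TensorProduct.comm k H H).toLinearMap)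
    (rightAct k H ∘ₗ LinearMap.lTensor _ (TensorProduct.comm k H H).toLinearMap)

/-- The permutation `(1,4)(2,3)`. -/
def permX : Equiv.Perm (Fin 4) := ⟨![3, 2, 1, 0], ![3, 2, 1, 0], by decide, by decide⟩

/-- The permutation `(1,2,3,4)`. -/
def permY : Equiv.Perm (Fin 4) := ⟨![1, 2, 3, 0], ![3, 0, 1, 2], by decide, by decide⟩

/-- The permutation `(3,4)`. -/
def permZ : Equiv.Perm (Fin 4) := ⟨![0, 1, 3, 2], ![0, 1, 3, 2], by decide, by decide⟩

/-- The rebracketing from `X(H)` to `H ⊗ (H^op ⊗ (H^* ⊗ (H^cop)^*))`. -/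
def rebracketX : (H ⊗[k] H) ⊗[k] (Module.Dual k H ⊗[k] Module.Dual k H) ≃ₗ[k]
    ((Bprime k H).perm permX).BTP :=
  TensorProduct.assoc k H H (Module.Dual k H ⊗[k] Module.Dual k H)

/-- The rebracketing from `Y(H)` to `H^* ⊗ (H^op ⊗ (H ⊗ (H^cop)^*))`. -/
def rebracketY : Module.Dual k H ⊗[k] ((H ⊗[k] H) ⊗[k] Module.Dual k H) ≃ₗ[k]
    ((Bprime k H).perm permY).BTP :=
  LinearEquiv.lTensor (Module.Dual k H) (TensorProduct.assoc k H H (Module.Dual k H))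

/-- The rebracketing from `Z(H)` to `H^* ⊗ ((H^cop)^* ⊗ (H^op ⊗ H))`. -/
def rebracketZ : (Module.Dual k H ⊗[k] Module.Dual k H) ⊗[k] (H ⊗[k] H) ≃ₗ[k]
    ((Bprime k H).perm permZ).BTP :=
  TensorProduct.assoc k (Module.Dual k H) (Module.Dual k H) (H ⊗[k] H)

end XYZ

end HopfBraid

end

set_option linter.unusedSimpArgs false
set_option linter.unusedSectionVars false

noncomputable section

namespace HopfBraid

/-! ### Bijectivity of the antipode -/

section Antipode

open WithConv HopfAlgebra

variable {k : Type u} [Field k] {H : Type u} [Ring H] [HopfAlgebra k H]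

/-! Everything rests on a calculus of twists. If `ξ : B ⊗ A → A ⊗ B` respects units and products on
both sides (`IsTwist`), then the twisted product on `A ⊗ B` is a UAA, and its modules are the spaces
which are modules over `A` and over `B` with `(m · b) · a = (m · a') · b'` for `ξ (b ⊗ a) = a' ⊗ b'`
(`ActCompat`). The Yang-Baxter equation on three components is what makes the composite of two
twists a twist again (`IsTwist.passLeft`, `YangBaxter.passLeft`), so the braided tensor product of
four algebras arises by three successive twists. When two of the components coincide, Yang-Baxter is
equivalent to the multiplicativity of `ξ` in one variable. A bipointed braided system of UAAs is
therefore a family of twists with Yang-Baxter on triples of distinct components (`isTwist`,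
`isSystemOfUAAs_of`), and its braided modules are the modules over the braided tensor product
(`isModule_iterProd`, `isModule_restr`).

For a bialgebra, `σ_bi (h ⊗ l) = l(- h₍₂₎) ⊗ h₍₁₎` (`BialgStr.sigmaBi_tmul`). This is a twist by the
bialgebra axioms. Yang-Baxter on distinct components says either that left and right translations
commute or that the comultiplication is coassociative; passing to `op` and `cop` covers all cases.
In finite dimension an action of `H^*` is the same as a map `M → M ⊗ H` (`slice_ext`,
`exists_coAct`). Under this dictionary the module axioms are the comodule axioms, and compatibility
with `σ_bi` is the Hopf condition (`actCompat_sigmaBi_coAct_iff`).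

For a Hopf algebra the antipode is bijective (`antipode_bijective`), hence so are all the braidings.
Inverting one adjacent braiding permutes a Yang-Baxter equation by an adjacent transposition, which
gives the permuted systems. The isomorphism `Φ_θ` is not built from a decomposition of `θ`: it is
the inverse of `fromPerm`, which multiplies the permuted tensor factors inside `W(H)`. An exchange
by an inverse braiding does not change iterated actions, so applying this to the regular module
shows that `Φ_θ` is the composite along any decomposition. The same regular module identifies the
three classical algebras: it suffices that each of them acts on `W(H)` by iterated multiplication
(`AlgSystem.isAlgIso_of_isModule`).

For full faithfulness, evaluating the braiding relation at `1` and applying counits recovers all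
components of an isomorphism of systems from the first one, together with its compatibility with the
comultiplication (`isHom_of_isMorphism`). -/

/-- Algebra maps out of a Hopf algebra are determined by their composites with the antipode. -/
theorem algHom_ext_antipode {A : Type u} [Ring A] [Algebra k A] {f g : H →ₐ[k] A}
    (h : ∀ x, f (antipode k x) = g (antipode k x)) : f = g := by
  -- Composing `id * S = S * id = 1` with the algebra map `f` shows that `f ∘ S` is a two-sided
  -- convolution inverse of `f`. The lemma then follows from the uniqueness of inverses.
  have key (f : H →ₐ[k] A) : toConv f.toLinearMap * toConv (f.toLinearMap ∘ₗ antipode k) = 1 ∧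
      toConv (f.toLinearMap ∘ₗ antipode k) * toConv f.toLinearMap = 1 := by
    have h1 := LinearMap.algHom_comp_convMul_distrib (R := k) f (toConv (LinearMap.id (M := H)))
      (toConv (antipode k))
    have h2 := LinearMap.algHom_comp_convMul_distrib (R := k) f (toConv (antipode k))
      (toConv (LinearMap.id (M := H)))
    rw [LinearMap.id_mul_antipode] at h1
    rw [LinearMap.antipode_mul_id] at h2
    have h3 : f.toLinearMap ∘ₗ (1 : WithConv (H →ₗ[k] H)).ofConv =
        (1 : WithConv (H →ₗ[k] A)).ofConv := by
      ext x; simp [LinearMap.convOne_def]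
    exact ⟨WithConv.ext (h1.symm.trans h3), WithConv.ext (h2.symm.trans h3)⟩
  have e : f.toLinearMap ∘ₗ antipode k = g.toLinearMap ∘ₗ antipode k := LinearMap.ext h
  have h1 := left_inv_eq_right_inv (key f).1 (e ▸ (key g).2)
  ext x
  exact LinearMap.congr_fun (congrArg WithConv.ofConv h1) x

/-- Induction through opposite algebras: `f ∘ S` is an algebra map into `Aᵐᵒᵖ`, so the statement for
`n` applies to it. This is why `A` has to vary in the induction. -/
theorem algHom_ext_antipode_pow {A : Type u} [Ring A] [Algebra k A] (n : ℕ) {f g : H →ₐ[k] A}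
    (h : ∀ x, f (((antipode k : H →ₗ[k] H) ^ n) x) = g (((antipode k : H →ₗ[k] H) ^ n) x)) :
    f = g := by
  induction n generalizing A with
  | zero => ext x; simpa using h x
  | succ n ih =>
    have h1 (f : H →ₐ[k] A) : ∃ f' : H →ₐ[k] Aᵐᵒᵖ, ∀ x, f' x = MulOpposite.op (f (antipode k x)) :=
      ⟨.ofLinearMap ((MulOpposite.opLinearEquiv k).toLinearMap ∘ₗ f.toLinearMap ∘ₗ antipode k)
        (congrArg MulOpposite.op (by simp))
        (fun x y => congrArg MulOpposite.op (by simp [antipode_mul_antidistrib])), fun x => rfl⟩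
    obtain ⟨f', hf⟩ := h1 f
    obtain ⟨g', hg⟩ := h1 g
    have := ih (f := f') (g := g') fun x => by
      rw [hf, hg, ← Module.End.mul_apply, ← pow_succ', h]
    refine algHom_ext_antipode fun x => MulOpposite.op_injective ?_
    rw [← hf, ← hg, this]

/-- A Fitting argument. A high power `φ` of `S²` is an algebra endomorphism with `H = ker φ ⊕ im φ`.
The projection onto `im φ` is an algebra map which agrees with the identity on the image of a power
of `S`, so it is the identity by `algHom_ext_antipode_pow`. Hence `φ`, and with it `S`, is
surjective. -/
theorem antipode_bijective [Module.Finite k H] :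
    Function.Bijective (antipode k : H →ₗ[k] H) := by
  set S : H →ₗ[k] H := antipode k with hS
  -- The exponent `n + 1` makes `φ` a positive power of `S`, so that its range lies in the range of
  -- `S`.
  obtain ⟨n, hn⟩ : ∃ n, IsCompl (LinearMap.ker ((S ^ 2) ^ (n + 1)))
      (LinearMap.range ((S ^ 2) ^ (n + 1))) := by
    obtain ⟨n, hn⟩ := Filter.eventually_atTop.1
      (LinearMap.eventually_isCompl_ker_pow_range_pow (S ^ 2))
    exact ⟨n, hn (n + 1) n.le_succ⟩
  set φ : H →ₗ[k] H := (S ^ 2) ^ (n + 1) with hφ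
  have φmul : ∀ x y, φ (x * y) = φ x * φ y := by
    have h2 : ∀ x y, (S ^ 2) (x * y) = (S ^ 2) x * (S ^ 2) y := fun x y => by
      simp [pow_two, hS, antipode_mul_antidistrib]
    rw [hφ]
    clear_value S
    clear hn hφ φ
    generalize n + 1 = m
    induction m with
    | zero => simp
    | succ n ih => intro x y; rw [pow_succ', Module.End.mul_apply, ih, h2]; rfl
  have φone : φ 1 = 1 := by
    have h2 : (S ^ 2) 1 = 1 := by simp [pow_two, hS]
    rw [hφ]
    clear_value S
    clear hn hφ φmul φ
    generalize n + 1 = m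
    induction m with
    | zero => simp
    | succ n ih => rw [pow_succ', Module.End.mul_apply, ih, h2]
  have inj : ∀ x y, x ∈ LinearMap.range φ → y ∈ LinearMap.range φ → φ x = φ y → x = y := by
    intro x y hx hy hxy
    have : x - y ∈ LinearMap.ker φ ⊓ LinearMap.range φ :=
      ⟨by simp [hxy], Submodule.sub_mem _ hx hy⟩
    rw [hn.inf_eq_bot] at this
    exact sub_eq_zero.1 (by simpa using this)
  have ex : ∀ x, ∃ y ∈ LinearMap.range φ, φ y = φ x := by
    intro x
    obtain ⟨a, ha, b, hb, rfl⟩ := Submodule.mem_sup.1 (hn.sup_eq_top ▸ Submodule.mem_top (x := x))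
    exact ⟨b, hb, by simp [LinearMap.mem_ker.1 ha]⟩
  choose p hp hpφ using ex
  have mem_mul : ∀ x y, x ∈ LinearMap.range φ → y ∈ LinearMap.range φ →
      x * y ∈ LinearMap.range φ := by
    rintro _ _ ⟨x, rfl⟩ ⟨y, rfl⟩; exact ⟨x * y, φmul x y⟩
  -- `p` is the projection onto `im φ` along `ker φ`. Each identity compares two elements of `im φ`
  -- with the same image under `φ`, which is injective there.
  let π : H →ₐ[k] H := .ofLinearMap
    { toFun := p
      map_add' := fun x y => inj _ _ (hp _) (Submodule.add_mem _ (hp _) (hp _)) (by simp [hpφ])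
      map_smul' := fun c x => inj _ _ (hp _) (Submodule.smul_mem _ _ (hp _)) (by simp [hpφ]) }
    (inj _ _ (hp _) ⟨1, φone⟩ (hpφ 1))
    (fun x y => inj _ _ (hp _) (mem_mul _ _ (hp _) (hp _)) (by simp [hpφ, φmul]))
  have hπ : π = AlgHom.id k H := by
    refine algHom_ext_antipode_pow (2 * (n + 1)) fun x => ?_
    rw [pow_mul]
    exact inj _ _ (hp _) ⟨x, rfl⟩ (hpφ _)
  have surj : Function.Surjective S := by
    intro x
    obtain ⟨y, hy⟩ := hp x
    have hx : p x = x := congrArg (fun f : H →ₐ[k] H => f x) hπ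
    refine ⟨(S ^ (2 * n + 1)) y, ?_⟩
    rw [← Module.End.mul_apply, ← pow_succ', ← hx, ← hy, hφ, ← pow_mul]
    rfl
  exact ⟨LinearMap.injective_iff_surjective.2 surj, surj⟩

end Antipode

end HopfBraid

end

noncomputable section

namespace HopfBraid

/-! ### Twists and twisted products -/

section Twists

variable {k : Type u} [Field k]
variable {A B C D : Type u} [AddCommGroup A] [Module k A] [AddCommGroup B] [Module k B]
  [AddCommGroup C] [Module k C] [AddCommGroup D] [Module k D]
  {M : Type u} [AddCommGroup M] [Module k M]

/-- The conditions on `ξ : B ⊗ A → A ⊗ B` which make the twisted product on `A ⊗ B` a UAA. -/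
structure IsTwist (S : AlgStr k A) (T : AlgStr k B) (ξ : B ⊗[k] A →ₗ[k] A ⊗[k] B) : Prop where
  one_left : ∀ a, ξ (T.one ⊗ₜ a) = a ⊗ₜ T.one
  one_right : ∀ b, ξ (b ⊗ₜ S.one) = S.one ⊗ₜ b
  mul_left : ∀ b b' a, ξ (T.mul (b ⊗ₜ b') ⊗ₜ a) =
    LinearMap.lTensor A T.mul (TensorProduct.assoc k A B B (LinearMap.rTensor B ξ
      ((TensorProduct.assoc k B A B).symm (b ⊗ₜ ξ (b' ⊗ₜ a)))))
  mul_right : ∀ b a a', ξ (b ⊗ₜ S.mul (a ⊗ₜ a')) =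
    LinearMap.rTensor B S.mul ((TensorProduct.assoc k A A B).symm (LinearMap.lTensor A ξ
      (TensorProduct.assoc k A B A (ξ (b ⊗ₜ a) ⊗ₜ a'))))

/-- The coloured Yang-Baxter equation on `A ⊗ B ⊗ C`. -/
def YangBaxter (s₁₂ : A ⊗[k] B →ₗ[k] B ⊗[k] A) (s₁₃ : A ⊗[k] C →ₗ[k] C ⊗[k] A)
    (s₂₃ : B ⊗[k] C →ₗ[k] C ⊗[k] B) : Prop :=
  LinearMap.rTensor A s₂₃ ∘ₗ (TensorProduct.assoc k B C A).symm.toLinearMap ∘ₗ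
      LinearMap.lTensor B s₁₃ ∘ₗ (TensorProduct.assoc k B A C).toLinearMap ∘ₗ
      LinearMap.rTensor C s₁₂ =
    (TensorProduct.assoc k C B A).symm.toLinearMap ∘ₗ LinearMap.lTensor C s₁₂ ∘ₗ
      (TensorProduct.assoc k C A B).toLinearMap ∘ₗ LinearMap.rTensor B s₁₃ ∘ₗ
      (TensorProduct.assoc k A C B).symm.toLinearMap ∘ₗ LinearMap.lTensor A s₂₃ ∘ₗ
      (TensorProduct.assoc k A B C).toLinearMap

theorem yangBaxter_iff {s₁₂ : A ⊗[k] B →ₗ[k] B ⊗[k] A} {s₁₃ : A ⊗[k] C →ₗ[k] C ⊗[k] A}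
    {s₂₃ : B ⊗[k] C →ₗ[k] C ⊗[k] B} : YangBaxter s₁₂ s₁₃ s₂₃ ↔
      ∀ a b c, LinearMap.rTensor A s₂₃ ((TensorProduct.assoc k B C A).symm
        (LinearMap.lTensor B s₁₃ (TensorProduct.assoc k B A C (s₁₂ (a ⊗ₜ b) ⊗ₜ c)))) =
      (TensorProduct.assoc k C B A).symm (LinearMap.lTensor C s₁₂
        (TensorProduct.assoc k C A B (LinearMap.rTensor B s₁₃
          ((TensorProduct.assoc k A C B).symm (a ⊗ₜ s₂₃ (b ⊗ₜ c)))))) := by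
  constructor
  · intro h a b c
    simpa using LinearMap.congr_fun h ((a ⊗ₜ b) ⊗ₜ c)
  · intro h
    refine TensorProduct.ext_threefold fun a b c => ?_
    simpa using h a b c

theorem AlgStr.twisted_mul_tmul (S : AlgStr k A) (T : AlgStr k B)
    (ξ : B ⊗[k] A →ₗ[k] A ⊗[k] B) (a a' : A) (b b' : B) :
    (S.twisted T ξ).mul ((a ⊗ₜ b) ⊗ₜ (a' ⊗ₜ b')) =
      TensorProduct.map (S.mul ∘ₗ TensorProduct.mk k A A a)
        (T.mul ∘ₗ (TensorProduct.mk k B B).flip b') (ξ (b ⊗ₜ a')) := by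
  simp only [AlgStr.twisted, LinearMap.comp_apply, LinearEquiv.coe_coe, TensorProduct.assoc_tmul,
    LinearMap.lTensor_tmul, TensorProduct.assoc_symm_tmul, LinearMap.rTensor_tmul]
  generalize ξ (b ⊗ₜ a') = t
  induction t using TensorProduct.induction_on with
  | zero => simp
  | add x y hx hy => simp only [TensorProduct.tmul_add, TensorProduct.add_tmul, map_add, hx, hy]
  | tmul p q => simp

/-- For associativity, both bracketings of `(a ⊗ b) (a' ⊗ b') (a'' ⊗ b'')` are equal to the product
of `ξ (b ⊗ a')` and `ξ (b' ⊗ a'')`, multiplied by `a` on the left and by `b''` on the right.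
Multiplicativity of `ξ` in `B` gives this for one bracketing, multiplicativity in `A` for the other.
-/
theorem IsTwist.isUAA {S : AlgStr k A} {T : AlgStr k B} {ξ : B ⊗[k] A →ₗ[k] A ⊗[k] B}
    (h : IsTwist S T ξ) (hS : S.IsUAA) (hT : T.IsUAA) : (S.twisted T ξ).IsUAA where
  one_mul x := by
    induction x using TensorProduct.induction_on with
    | zero => simp
    | add x y hx hy => simp only [TensorProduct.tmul_add, map_add, hx, hy]
    | tmul a b =>
      change (S.twisted T ξ).mul ((S.one ⊗ₜ T.one) ⊗ₜ (a ⊗ₜ b)) = _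
      simp [AlgStr.twisted_mul_tmul, h.one_left, hS.one_mul, hT.one_mul]
  mul_one x := by
    induction x using TensorProduct.induction_on with
    | zero => simp
    | add x y hx hy => simp only [TensorProduct.add_tmul, map_add, hx, hy]
    | tmul a b =>
      change (S.twisted T ξ).mul ((a ⊗ₜ b) ⊗ₜ (S.one ⊗ₜ T.one)) = _
      simp [AlgStr.twisted_mul_tmul, h.one_right, hS.mul_one, hT.mul_one]
  mul_assoc x y z := by
    induction x using TensorProduct.induction_on with
    | zero => simp
    | add x y hx hy => simp only [TensorProduct.add_tmul, map_add, hx, hy]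
    | tmul a b =>
    induction y using TensorProduct.induction_on with
    | zero => simp
    | add x y hx hy =>
      simp only [TensorProduct.tmul_add, TensorProduct.add_tmul, map_add, hx, hy]
    | tmul a' b' =>
    induction z using TensorProduct.induction_on with
    | zero => simp
    | add x y hx hy => simp only [TensorProduct.tmul_add, map_add, hx, hy]
    | tmul a'' b'' =>
    have h1 : ∀ t : A ⊗[k] B, (S.twisted T ξ).mul
        (TensorProduct.map (S.mul ∘ₗ TensorProduct.mk k A A a)
          (T.mul ∘ₗ (TensorProduct.mk k B B).flip b') t ⊗ₜ[k] (a'' ⊗ₜ[k] b'')) =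
        TensorProduct.map (S.mul ∘ₗ TensorProduct.mk k A A a)
          (T.mul ∘ₗ (TensorProduct.mk k B B).flip b'')
          ((S.twisted T ξ).mul (t ⊗ₜ ξ (b' ⊗ₜ a''))) := by
      intro t
      induction t using TensorProduct.induction_on with
      | zero => simp
      | add x y hx hy =>
        simp only [TensorProduct.tmul_add, TensorProduct.add_tmul, map_add, hx, hy]
      | tmul p q =>
        simp only [TensorProduct.map_tmul, LinearMap.comp_apply, TensorProduct.mk_apply,
          LinearMap.flip_apply, AlgStr.twisted_mul_tmul, h.mul_left]
        generalize ξ (b' ⊗ₜ a'') = s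
        induction s using TensorProduct.induction_on with
        | zero => simp
        | add x y hx hy =>
          simp only [TensorProduct.tmul_add, TensorProduct.add_tmul, map_add, hx, hy]
        | tmul u v =>
          simp only [TensorProduct.assoc_symm_tmul, LinearMap.rTensor_tmul,
            AlgStr.twisted_mul_tmul]
          generalize ξ (q ⊗ₜ u) = r
          induction r using TensorProduct.induction_on with
          | zero => simp
          | add x y hx hy =>
            simp only [TensorProduct.tmul_add, TensorProduct.add_tmul, map_add, hx, hy]
          | tmul u v => simp [hS.mul_assoc, hT.mul_assoc]
    have h2 : ∀ s : A ⊗[k] B, (S.twisted T ξ).mul ((a ⊗ₜ b) ⊗ₜ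
        (TensorProduct.map (S.mul ∘ₗ TensorProduct.mk k A A a')
          (T.mul ∘ₗ (TensorProduct.mk k B B).flip b'') s)) =
        TensorProduct.map (S.mul ∘ₗ TensorProduct.mk k A A a)
          (T.mul ∘ₗ (TensorProduct.mk k B B).flip b'')
          ((S.twisted T ξ).mul (ξ (b ⊗ₜ a') ⊗ₜ s)) := by
      intro s
      induction s using TensorProduct.induction_on with
      | zero => simp
      | add x y hx hy =>
        simp only [TensorProduct.tmul_add, TensorProduct.add_tmul, map_add, hx, hy]
      | tmul u v =>
        simp only [TensorProduct.map_tmul, LinearMap.comp_apply, TensorProduct.mk_apply,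
          LinearMap.flip_apply, AlgStr.twisted_mul_tmul, h.mul_right]
        generalize ξ (b ⊗ₜ a') = t
        induction t using TensorProduct.induction_on with
        | zero => simp
        | add x y hx hy =>
          simp only [TensorProduct.tmul_add, TensorProduct.add_tmul, map_add, hx, hy]
        | tmul p q =>
          simp only [TensorProduct.assoc_symm_tmul, TensorProduct.assoc_tmul,
            LinearMap.lTensor_tmul, LinearMap.rTensor_tmul, AlgStr.twisted_mul_tmul]
          generalize ξ (q ⊗ₜ u) = r
          induction r using TensorProduct.induction_on with
          | zero => simp
          | add x y hx hy =>
            simp only [TensorProduct.tmul_add, TensorProduct.add_tmul, map_add, hx, hy]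
          | tmul u v => simp [hS.mul_assoc, hT.mul_assoc]
    rw [AlgStr.twisted_mul_tmul, AlgStr.twisted_mul_tmul, h1, h2]

end Twists

/-! ### Composite twists and the Yang-Baxter equation. -/

section PassLeft

variable {k : Type u} [Field k]
variable {A B C D : Type u} [AddCommGroup A] [Module k A] [AddCommGroup B] [Module k B]
  [AddCommGroup C] [Module k C] [AddCommGroup D] [Module k D]
  {M : Type u} [AddCommGroup M] [Module k M]

theorem passLeft_tmul (ξ : A ⊗[k] C →ₗ[k] C ⊗[k] A) (ζ : B ⊗[k] C →ₗ[k] C ⊗[k] B)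
    (a : A) (b : B) (c : C) : passLeft ξ ζ ((a ⊗ₜ b) ⊗ₜ c) =
      TensorProduct.assoc k C A B (LinearMap.rTensor B ξ
        ((TensorProduct.assoc k A C B).symm (a ⊗ₜ ζ (b ⊗ₜ c)))) := by
  simp [passLeft]

/-- Multiplicativity in `C` follows from that of `ξ` and `ζ` alone. In the variable `A ⊗ B` the
product involves `η`, and Yang-Baxter says that applying `η` before or after `c` passes gives the
same result. -/
theorem IsTwist.passLeft {SA : AlgStr k A} {SB : AlgStr k B} {SC : AlgStr k C}
    {η : B ⊗[k] A →ₗ[k] A ⊗[k] B} {ξ : A ⊗[k] C →ₗ[k] C ⊗[k] A} {ζ : B ⊗[k] C →ₗ[k] C ⊗[k] B}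
    (hξ : IsTwist SC SA ξ) (hζ : IsTwist SC SB ζ) (hyb : YangBaxter η ζ ξ) :
    IsTwist SC (SA.twisted SB η) (passLeft ξ ζ) where
  one_left c := by
    change HopfBraid.passLeft ξ ζ ((SA.one ⊗ₜ SB.one) ⊗ₜ c) = c ⊗ₜ (SA.one ⊗ₜ SB.one)
    simp [passLeft_tmul, hξ.one_left, hζ.one_left]
  one_right x := by
    induction x using TensorProduct.induction_on with
    | zero => simp
    | add x y hx hy => simp only [TensorProduct.tmul_add, TensorProduct.add_tmul, map_add, hx, hy]
    | tmul a b => simp [passLeft_tmul, hξ.one_right, hζ.one_right]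
  mul_left x y c := by
    induction x using TensorProduct.induction_on with
    | zero => simp
    | add x y hx hy => simp only [TensorProduct.tmul_add, TensorProduct.add_tmul, map_add, hx, hy]
    | tmul a b =>
    induction y using TensorProduct.induction_on with
    | zero => simp
    | add x y hx hy => simp only [TensorProduct.tmul_add, TensorProduct.add_tmul, map_add, hx, hy]
    | tmul a' b' =>
    have hyb := yangBaxter_iff.1 hyb b a'
    rw [AlgStr.twisted_mul_tmul]
    -- The element `c` passes `b'`, then `t`, then `a`. Keeping `t` arbitrary isolates the middle
    -- stage, to which Yang-Baxter applies for `t = η (b ⊗ a')`.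
    have h1 : ∀ t : A ⊗[k] B, HopfBraid.passLeft ξ ζ
        (TensorProduct.map (SA.mul ∘ₗ TensorProduct.mk k A A a)
          (SB.mul ∘ₗ (TensorProduct.mk k B B).flip b') t ⊗ₜ c) =
        TensorProduct.assoc k C A B (LinearMap.rTensor B
          (LinearMap.lTensor C SA.mul ∘ₗ (TensorProduct.assoc k C A A).toLinearMap ∘ₗ
            LinearMap.rTensor A (ξ ∘ₗ TensorProduct.mk k A C a))
          (LinearMap.lTensor (C ⊗[k] A) SB.mul (TensorProduct.assoc k (C ⊗[k] A) B B
            (LinearMap.rTensor B (LinearMap.rTensor B ξ ∘ₗ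
                (TensorProduct.assoc k A C B).symm.toLinearMap ∘ₗ LinearMap.lTensor A ζ ∘ₗ
                (TensorProduct.assoc k A B C).toLinearMap ∘ₗ TensorProduct.mk k (A ⊗[k] B) C t)
              (ζ (b' ⊗ₜ c)))))) := by
      intro t
      induction t using TensorProduct.induction_on with
      | zero =>
        simp only [map_zero, TensorProduct.zero_tmul, LinearMap.comp_zero, LinearMap.rTensor_zero,
          LinearMap.zero_apply]
      | add x y hx hy =>
        simp only [TensorProduct.tmul_add, TensorProduct.add_tmul, map_add, hx, hy,
          LinearMap.comp_add, LinearMap.rTensor_add, LinearMap.add_apply]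
      | tmul p q =>
        simp only [TensorProduct.map_tmul, LinearMap.comp_apply, TensorProduct.mk_apply,
          LinearMap.flip_apply, passLeft_tmul, hζ.mul_left]
        generalize ζ (b' ⊗ₜ c) = s
        induction s using TensorProduct.induction_on with
        | zero => simp
        | add x y hx hy =>
          simp only [TensorProduct.tmul_add, TensorProduct.add_tmul, map_add, hx, hy]
        | tmul u v =>
          simp only [TensorProduct.assoc_symm_tmul, LinearMap.rTensor_tmul, LinearMap.comp_apply,
            LinearEquiv.coe_coe, TensorProduct.mk_apply, TensorProduct.assoc_tmul,
            LinearMap.lTensor_tmul]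
          generalize ζ (q ⊗ₜ u) = r
          induction r using TensorProduct.induction_on with
          | zero => simp
          | add x y hx hy =>
            simp only [TensorProduct.tmul_add, TensorProduct.add_tmul, map_add, hx, hy]
          | tmul u w =>
            simp only [TensorProduct.assoc_symm_tmul, LinearMap.rTensor_tmul,
              TensorProduct.assoc_tmul, LinearMap.lTensor_tmul, hξ.mul_left]
            generalize ξ (p ⊗ₜ u) = r
            induction r using TensorProduct.induction_on with
            | zero => simp
            | add x y hx hy =>
              simp only [TensorProduct.tmul_add, TensorProduct.add_tmul, map_add, hx, hy]
            | tmul u w =>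
              simp only [TensorProduct.assoc_symm_tmul, LinearMap.rTensor_tmul,
                TensorProduct.assoc_tmul, LinearMap.lTensor_tmul, LinearMap.comp_apply,
                LinearEquiv.coe_coe, TensorProduct.mk_apply]
    rw [h1, passLeft_tmul]
    generalize ζ (b' ⊗ₜ c) = s
    induction s using TensorProduct.induction_on with
    | zero => simp
    | add x y hx hy =>
      simp only [TensorProduct.tmul_add, TensorProduct.add_tmul, map_add, hx, hy]
    | tmul p q =>
      -- With `hyb`, the factor `p` now moves through `a'` and `b` first, and `η` is applied
      -- afterwards.
      simp only [LinearMap.rTensor_tmul, LinearMap.comp_apply, TensorProduct.mk_apply,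
        LinearEquiv.coe_coe, hyb, TensorProduct.assoc_symm_tmul]
      generalize ξ (a' ⊗ₜ p) = t
      induction t using TensorProduct.induction_on with
      | zero => simp
      | add x y hx hy =>
        simp only [TensorProduct.tmul_add, TensorProduct.add_tmul, map_add, hx, hy]
      | tmul p a₂ =>
        simp only [LinearMap.rTensor_tmul, TensorProduct.assoc_tmul, TensorProduct.assoc_symm_tmul,
          passLeft_tmul]
        generalize ζ (b ⊗ₜ p) = t
        induction t using TensorProduct.induction_on with
        | zero => simp
        | add x y hx hy =>
          simp only [TensorProduct.tmul_add, TensorProduct.add_tmul, map_add, hx, hy]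
        | tmul p b =>
          simp only [LinearMap.rTensor_tmul, TensorProduct.assoc_tmul, LinearMap.lTensor_tmul,
            TensorProduct.assoc_symm_tmul]
          have h2 : ∀ t : C ⊗[k] A, LinearMap.lTensor C (SA.twisted SB η).mul
              (TensorProduct.assoc k C (A ⊗[k] B) (A ⊗[k] B)
                (TensorProduct.assoc k C A B (t ⊗ₜ b) ⊗ₜ (a₂ ⊗ₜ q))) =
              LinearMap.lTensor C (TensorProduct.map SA.mul SB.mul)
                (LinearMap.lTensor C (TensorProduct.assoc k A A (B ⊗[k] B)).symm.toLinearMap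
                  (TensorProduct.assoc k C A (A ⊗[k] (B ⊗[k] B))
                    (t ⊗ₜ TensorProduct.assoc k A B B (η (b ⊗ₜ a₂) ⊗ₜ q)))) := by
            intro t
            induction t using TensorProduct.induction_on with
            | zero => simp
            | add x y hx hy =>
              simp only [TensorProduct.tmul_add, TensorProduct.add_tmul, map_add, hx, hy]
            | tmul x y =>
              simp only [TensorProduct.assoc_tmul, LinearMap.lTensor_tmul,
                AlgStr.twisted_mul_tmul]
              generalize η (b ⊗ₜ a₂) = t
              induction t using TensorProduct.induction_on with
              | zero => simp
              | add x y hx hy =>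
                simp only [TensorProduct.tmul_add, TensorProduct.add_tmul, map_add, hx, hy]
              | tmul x y => simp
          rw [h2]
          generalize η (b ⊗ₜ a₂) = t
          induction t using TensorProduct.induction_on with
          | zero => simp
          | add x y hx hy =>
            simp only [TensorProduct.tmul_add, TensorProduct.add_tmul, map_add, hx, hy]
          | tmul x y =>
            simp only [LinearMap.rTensor_tmul, TensorProduct.assoc_tmul, LinearMap.lTensor_tmul,
              TensorProduct.assoc_symm_tmul, LinearMap.comp_apply, TensorProduct.mk_apply,
              LinearEquiv.coe_coe]
            generalize ξ (a ⊗ₜ p) = t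
            induction t using TensorProduct.induction_on with
            | zero => simp
            | add x y hx hy =>
              simp only [TensorProduct.tmul_add, TensorProduct.add_tmul, map_add, hx, hy]
            | tmul x y => simp
  mul_right x c c' := by
    induction x using TensorProduct.induction_on with
    | zero => simp
    | add x y hx hy => simp only [TensorProduct.tmul_add, TensorProduct.add_tmul, map_add, hx, hy]
    | tmul a b =>
    rw [passLeft_tmul, passLeft_tmul, hζ.mul_right]
    generalize ζ (b ⊗ₜ c) = t
    induction t using TensorProduct.induction_on with
    | zero => simp
    | add x y hx hy => simp only [TensorProduct.tmul_add, TensorProduct.add_tmul, map_add, hx, hy]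
    | tmul p q =>
      simp only [TensorProduct.assoc_symm_tmul, LinearMap.rTensor_tmul, TensorProduct.assoc_tmul,
        LinearMap.lTensor_tmul]
      have h2 : ∀ (s : C ⊗[k] A), LinearMap.lTensor C (HopfBraid.passLeft ξ ζ)
            (TensorProduct.assoc k C (A ⊗[k] B) C
              (TensorProduct.assoc k C A B (s ⊗ₜ q) ⊗ₜ c')) =
          LinearMap.lTensor C (TensorProduct.assoc k C A B).toLinearMap
            (LinearMap.lTensor C (LinearMap.rTensor B ξ)
              (LinearMap.lTensor C (TensorProduct.assoc k A C B).symm.toLinearMap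
                (TensorProduct.assoc k C A (C ⊗[k] B) (s ⊗ₜ ζ (q ⊗ₜ c'))))) := by
        intro s
        induction s using TensorProduct.induction_on with
        | zero => simp
        | add x y hx hy =>
          simp only [TensorProduct.tmul_add, TensorProduct.add_tmul, map_add, hx, hy]
        | tmul u v => simp [passLeft_tmul]
      rw [h2]
      generalize ζ (q ⊗ₜ c') = t
      induction t using TensorProduct.induction_on with
      | zero => simp
      | add x y hx hy =>
        simp only [TensorProduct.tmul_add, TensorProduct.add_tmul, map_add, hx, hy]
      | tmul u v =>
        simp only [TensorProduct.assoc_symm_tmul, LinearMap.rTensor_tmul, TensorProduct.assoc_tmul,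
          LinearMap.lTensor_tmul, hξ.mul_right]
        generalize ξ (a ⊗ₜ p) = t
        induction t using TensorProduct.induction_on with
        | zero => simp
        | add x y hx hy =>
          simp only [TensorProduct.tmul_add, TensorProduct.add_tmul, map_add, hx, hy]
        | tmul x y =>
          simp only [TensorProduct.assoc_symm_tmul, LinearMap.rTensor_tmul,
            TensorProduct.assoc_tmul, LinearMap.lTensor_tmul, LinearEquiv.coe_coe]
          generalize ξ (y ⊗ₜ u) = t
          induction t using TensorProduct.induction_on with
          | zero => simp
          | add x y hx hy =>
            simp only [TensorProduct.tmul_add, TensorProduct.add_tmul, map_add, hx, hy]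
          | tmul x y => simp

/-- Yang-Baxter is used once for `b` and once for `a`: the exchange of `c` and `d` is pulled first
through `b` and then through `a`. -/
theorem YangBaxter.passLeft {sAC : A ⊗[k] C →ₗ[k] C ⊗[k] A} {sBC : B ⊗[k] C →ₗ[k] C ⊗[k] B}
    {sAD : A ⊗[k] D →ₗ[k] D ⊗[k] A} {sBD : B ⊗[k] D →ₗ[k] D ⊗[k] B}
    {sCD : C ⊗[k] D →ₗ[k] D ⊗[k] C}
    (hA : YangBaxter sAC sAD sCD) (hB : YangBaxter sBC sBD sCD) :
    YangBaxter (HopfBraid.passLeft sAC sBC) (HopfBraid.passLeft sAD sBD) sCD := by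
  rw [yangBaxter_iff] at hA hB ⊢
  intro x c d
  induction x using TensorProduct.induction_on with
  | zero => simp
  | add x y hx hy => simp only [TensorProduct.tmul_add, TensorProduct.add_tmul, map_add, hx, hy]
  | tmul a b =>
  -- `G` inserts `a` on the left and moves it through `D` and then `C`. Both sides become `G` of one
  -- of the two sides of the equation for `b`.
  let G : (D ⊗[k] C) ⊗[k] B →ₗ[k] (D ⊗[k] C) ⊗[k] (A ⊗[k] B) :=
    (TensorProduct.assoc k (D ⊗[k] C) A B).toLinearMap ∘ₗ
      LinearMap.rTensor B ((TensorProduct.assoc k D C A).symm.toLinearMap ∘ₗ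
        LinearMap.lTensor D sAC ∘ₗ (TensorProduct.assoc k D A C).toLinearMap ∘ₗ
        LinearMap.rTensor C sAD ∘ₗ (TensorProduct.assoc k A D C).symm.toLinearMap ∘ₗ
        TensorProduct.mk k A (D ⊗[k] C) a)
  trans G (LinearMap.rTensor B sCD ((TensorProduct.assoc k C D B).symm
        (LinearMap.lTensor C sBD (TensorProduct.assoc k C B D (sBC (b ⊗ₜ c) ⊗ₜ d)))))
  · rw [passLeft_tmul]
    generalize sBC (b ⊗ₜ c) = t
    induction t using TensorProduct.induction_on with
    | zero => simp
    | add x y hx hy => simp only [TensorProduct.tmul_add, TensorProduct.add_tmul, map_add, hx, hy]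
    | tmul c b =>
      simp only [TensorProduct.assoc_symm_tmul, LinearMap.rTensor_tmul, TensorProduct.assoc_tmul,
        LinearMap.lTensor_tmul]
      have h1 : ∀ t : C ⊗[k] A, LinearMap.lTensor C (HopfBraid.passLeft sAD sBD)
            (TensorProduct.assoc k C (A ⊗[k] B) D
              (TensorProduct.assoc k C A B (t ⊗ₜ b) ⊗ₜ d)) =
          LinearMap.lTensor C (TensorProduct.assoc k D A B).toLinearMap
            (LinearMap.lTensor C (LinearMap.rTensor B sAD)
              (LinearMap.lTensor C (TensorProduct.assoc k A D B).symm.toLinearMap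
                (TensorProduct.assoc k C A (D ⊗[k] B) (t ⊗ₜ sBD (b ⊗ₜ d))))) := by
        intro s
        induction s using TensorProduct.induction_on with
        | zero => simp
        | add x y hx hy =>
          simp only [TensorProduct.tmul_add, TensorProduct.add_tmul, map_add, hx, hy]
        | tmul u v => simp [passLeft_tmul]
      rw [h1]
      generalize sBD (b ⊗ₜ d) = t
      induction t using TensorProduct.induction_on with
      | zero => simp
      | add x y hx hy =>
        simp only [TensorProduct.tmul_add, TensorProduct.add_tmul, map_add, hx, hy]
      | tmul d b =>
        have h2 := congrArg (fun z => TensorProduct.assoc k (D ⊗[k] C) A B (z ⊗ₜ b)) (hA a c d)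
        simp only [G, LinearMap.comp_apply, LinearEquiv.coe_coe, TensorProduct.assoc_symm_tmul,
          LinearMap.rTensor_tmul, TensorProduct.mk_apply] at h2 ⊢
        rw [← h2]
        generalize sAC (a ⊗ₜ c) = t
        induction t using TensorProduct.induction_on with
        | zero => simp
        | add x y hx hy =>
          simp only [TensorProduct.tmul_add, TensorProduct.add_tmul, map_add, hx, hy]
        | tmul p q =>
          simp only [LinearMap.rTensor_tmul, TensorProduct.assoc_tmul, LinearMap.lTensor_tmul,
            TensorProduct.assoc_symm_tmul, LinearEquiv.coe_coe]
          generalize sAD (q ⊗ₜ d) = t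
          induction t using TensorProduct.induction_on with
          | zero => simp
          | add x y hx hy =>
            simp only [TensorProduct.tmul_add, TensorProduct.add_tmul, map_add, hx, hy]
          | tmul p q => simp
  · rw [hB]
    generalize sCD (c ⊗ₜ d) = t
    induction t using TensorProduct.induction_on with
    | zero => simp
    | add x y hx hy => simp only [TensorProduct.tmul_add, TensorProduct.add_tmul, map_add, hx, hy]
    | tmul d c =>
      simp only [TensorProduct.assoc_symm_tmul, LinearMap.rTensor_tmul, passLeft_tmul]
      generalize sBD (b ⊗ₜ d) = t
      induction t using TensorProduct.induction_on with
      | zero => simp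
      | add x y hx hy =>
        simp only [TensorProduct.tmul_add, TensorProduct.add_tmul, map_add, hx, hy]
      | tmul d b =>
        simp only [TensorProduct.assoc_symm_tmul, LinearMap.rTensor_tmul, TensorProduct.assoc_tmul,
          LinearMap.lTensor_tmul]
        have h1 : ∀ t : D ⊗[k] A, LinearMap.lTensor D (HopfBraid.passLeft sAC sBC)
              (TensorProduct.assoc k D (A ⊗[k] B) C
                (TensorProduct.assoc k D A B (t ⊗ₜ b) ⊗ₜ c)) =
            LinearMap.lTensor D (TensorProduct.assoc k C A B).toLinearMap
              (LinearMap.lTensor D (LinearMap.rTensor B sAC)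
                (LinearMap.lTensor D (TensorProduct.assoc k A C B).symm.toLinearMap
                  (TensorProduct.assoc k D A (C ⊗[k] B) (t ⊗ₜ sBC (b ⊗ₜ c))))) := by
          intro s
          induction s using TensorProduct.induction_on with
          | zero => simp
          | add x y hx hy =>
            simp only [TensorProduct.tmul_add, TensorProduct.add_tmul, map_add, hx, hy]
          | tmul u v => simp [passLeft_tmul]
        rw [h1]
        generalize sBC (b ⊗ₜ c) = t
        induction t using TensorProduct.induction_on with
        | zero => simp
        | add x y hx hy =>
          simp only [TensorProduct.tmul_add, TensorProduct.add_tmul, map_add, hx, hy]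
        | tmul c b =>
          simp only [G, LinearMap.comp_apply, LinearEquiv.coe_coe, TensorProduct.assoc_symm_tmul,
            LinearMap.rTensor_tmul, TensorProduct.mk_apply]
          generalize sAD (a ⊗ₜ d) = t
          induction t using TensorProduct.induction_on with
          | zero => simp
          | add x y hx hy =>
            simp only [TensorProduct.tmul_add, TensorProduct.add_tmul, map_add, hx, hy]
          | tmul d a =>
            simp only [LinearMap.rTensor_tmul, TensorProduct.assoc_tmul, LinearMap.lTensor_tmul,
              TensorProduct.assoc_symm_tmul, LinearEquiv.coe_coe]
            generalize sAC (a ⊗ₜ c) = t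
            induction t using TensorProduct.induction_on with
            | zero => simp
            | add x y hx hy =>
              simp only [TensorProduct.tmul_add, TensorProduct.add_tmul, map_add, hx, hy]
            | tmul d a => simp

end PassLeft

/-! ### Inverses of twists and of braidings. -/

section Inverses

variable {k : Type u} [Field k]
variable {A B C D : Type u} [AddCommGroup A] [Module k A] [AddCommGroup B] [Module k B]
  [AddCommGroup C] [Module k C] [AddCommGroup D] [Module k D]
  {M : Type u} [AddCommGroup M] [Module k M]

theorem linInv_eq (e : A ≃ₗ[k] B) : linInv e.toLinearMap = e.symm.toLinearMap := by
  have h : Function.Bijective e.toLinearMap := e.bijective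
  rw [linInv, dif_pos h]
  ext x
  refine e.injective ?_
  have := (LinearEquiv.ofBijective e.toLinearMap h).apply_symm_apply x
  rw [LinearEquiv.coe_coe, LinearEquiv.coe_coe, e.apply_symm_apply]
  exact this

theorem exists_equiv_of_bijective {f : A →ₗ[k] B} (hf : Function.Bijective f) :
    ∃ e : A ≃ₗ[k] B, f = e.toLinearMap ∧ linInv f = e.symm.toLinearMap := by
  refine ⟨LinearEquiv.ofBijective f hf, rfl, ?_⟩
  rw [linInv, dif_pos hf]

/-- Applying `e` to an identity for `e⁻¹` gives the mirror identity for `e`: the two unit conditions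
are interchanged, and so are the two multiplicativity conditions. -/
theorem IsTwist.symm {S : AlgStr k A} {T : AlgStr k B} {e : B ⊗[k] A ≃ₗ[k] A ⊗[k] B}
    (h : IsTwist S T e.toLinearMap) : IsTwist T S e.symm.toLinearMap where
  one_left b := by
    rw [LinearEquiv.coe_coe, LinearEquiv.symm_apply_eq]; exact (h.one_right b).symm
  one_right a := by
    rw [LinearEquiv.coe_coe, LinearEquiv.symm_apply_eq]; exact (h.one_left a).symm
  mul_left a a' b := by
    have key : ∀ w : (B ⊗[k] A) ⊗[k] A,
        e (LinearMap.lTensor B S.mul (TensorProduct.assoc k B A A w)) =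
        LinearMap.rTensor B S.mul ((TensorProduct.assoc k A A B).symm
          (LinearMap.lTensor A e.toLinearMap (TensorProduct.assoc k A B A
            (LinearMap.rTensor A e.toLinearMap w)))) := by
      intro w
      induction w using TensorProduct.induction_on with
      | zero => simp
      | add x y hx hy =>
        simp only [TensorProduct.tmul_add, TensorProduct.add_tmul, map_add, hx, hy]
      | tmul t a =>
      induction t using TensorProduct.induction_on with
      | zero => simp
      | add x y hx hy =>
        simp only [TensorProduct.tmul_add, TensorProduct.add_tmul, map_add, hx, hy]
      | tmul b a' => simpa using h.mul_right b a' a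
    rw [LinearEquiv.coe_coe, LinearEquiv.symm_apply_eq, key, ← LinearMap.comp_apply,
      ← LinearMap.rTensor_comp]
    simp
  mul_right a b b' := by
    have key : ∀ w : B ⊗[k] (B ⊗[k] A),
        e (LinearMap.rTensor A T.mul ((TensorProduct.assoc k B B A).symm w)) =
        LinearMap.lTensor A T.mul (TensorProduct.assoc k A B B
          (LinearMap.rTensor B e.toLinearMap ((TensorProduct.assoc k B A B).symm
            (LinearMap.lTensor B e.toLinearMap w)))) := by
      intro w
      induction w using TensorProduct.induction_on with
      | zero => simp
      | add x y hx hy =>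
        simp only [TensorProduct.tmul_add, TensorProduct.add_tmul, map_add, hx, hy]
      | tmul b t =>
      induction t using TensorProduct.induction_on with
      | zero => simp
      | add x y hx hy =>
        simp only [TensorProduct.tmul_add, TensorProduct.add_tmul, map_add, hx, hy]
      | tmul b' a => simpa using h.mul_left b b' a
    rw [LinearEquiv.coe_coe, LinearEquiv.symm_apply_eq, key, ← LinearMap.comp_apply
      (LinearMap.lTensor B e.toLinearMap), ← LinearMap.lTensor_comp]
    simp

/-- Precomposing and postcomposing with the inverse of the first braiding reorders the triple to
`(B, A, C)`. Together with `YangBaxter.symm_right`, which gives `(A, C, B)`, this reaches all orders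
of a triple. -/
theorem YangBaxter.symm_left {e : A ⊗[k] B ≃ₗ[k] B ⊗[k] A} {s₁₃ : A ⊗[k] C →ₗ[k] C ⊗[k] A}
    {s₂₃ : B ⊗[k] C →ₗ[k] C ⊗[k] B} (h : YangBaxter e.toLinearMap s₁₃ s₂₃) :
    YangBaxter e.symm.toLinearMap s₂₃ s₁₃ := by
  refine LinearMap.ext fun x => ?_
  obtain ⟨y, rfl⟩ : ∃ y, LinearMap.rTensor C e.toLinearMap y = x :=
    ⟨LinearMap.rTensor C e.symm.toLinearMap x, by
      rw [← LinearMap.comp_apply, ← LinearMap.rTensor_comp]; simp⟩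
  have hy := LinearMap.congr_fun h y
  simp only [LinearMap.comp_apply, LinearEquiv.coe_coe] at hy ⊢
  rw [hy, (TensorProduct.assoc k C B A).apply_symm_apply, ← LinearMap.comp_apply
    (LinearMap.lTensor C e.symm.toLinearMap), ← LinearMap.lTensor_comp,
    ← LinearMap.comp_apply (LinearMap.rTensor C e.symm.toLinearMap), ← LinearMap.rTensor_comp]
  simp

theorem YangBaxter.symm_right {s₁₂ : A ⊗[k] B →ₗ[k] B ⊗[k] A} {s₁₃ : A ⊗[k] C →ₗ[k] C ⊗[k] A}
    {e : B ⊗[k] C ≃ₗ[k] C ⊗[k] B} (h : YangBaxter s₁₂ s₁₃ e.toLinearMap) :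
    YangBaxter s₁₃ s₁₂ e.symm.toLinearMap := by
  refine LinearMap.ext fun x => ?_
  obtain ⟨y, rfl⟩ : ∃ y, (TensorProduct.assoc k A C B).symm
      (LinearMap.lTensor A e.toLinearMap (TensorProduct.assoc k A B C y)) = x :=
    ⟨(TensorProduct.assoc k A B C).symm
      (LinearMap.lTensor A e.symm.toLinearMap (TensorProduct.assoc k A C B x)), by
      rw [LinearEquiv.apply_symm_apply, ← LinearMap.comp_apply (LinearMap.lTensor A e.toLinearMap),
        ← LinearMap.lTensor_comp]; simp⟩
  have hy := LinearMap.congr_fun h y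
  simp only [LinearMap.comp_apply, LinearEquiv.coe_coe, LinearEquiv.apply_symm_apply] at hy ⊢
  rw [← LinearMap.comp_apply (LinearMap.lTensor A e.symm.toLinearMap), ← LinearMap.lTensor_comp,
    LinearEquiv.comp_coe, LinearEquiv.self_trans_symm, LinearEquiv.refl_toLinearMap,
    LinearMap.lTensor_id, LinearMap.id_apply, LinearEquiv.symm_apply_apply]
  have h2 := congrArg (fun z => TensorProduct.assoc k B C A
    (LinearMap.rTensor A e.symm.toLinearMap z)) hy
  beta_reduce at h2
  rw [← LinearMap.comp_apply (LinearMap.rTensor A e.symm.toLinearMap)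
    (LinearMap.rTensor A e.toLinearMap), ← LinearMap.rTensor_comp,
    LinearEquiv.comp_coe, LinearEquiv.self_trans_symm, LinearEquiv.refl_toLinearMap,
    LinearMap.rTensor_id, LinearMap.id_apply, LinearEquiv.apply_symm_apply] at h2
  rw [h2, LinearEquiv.symm_apply_apply]

end Inverses

/-! ### Modules over twisted products -/

section Modules

variable {k : Type u} [Field k]
variable {A B C D : Type u} [AddCommGroup A] [Module k A] [AddCommGroup B] [Module k B]
  [AddCommGroup C] [Module k C] [AddCommGroup D] [Module k D]
  {M : Type u} [AddCommGroup M] [Module k M]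

/-- `m ⊗ (a ⊗ b) ↦ (m · a) · b`. -/
def prodAct (ρA : M ⊗[k] A →ₗ[k] M) (ρB : M ⊗[k] B →ₗ[k] M) : M ⊗[k] (A ⊗[k] B) →ₗ[k] M :=
  ρB ∘ₗ LinearMap.rTensor B ρA ∘ₗ (TensorProduct.assoc k M A B).symm.toLinearMap

@[simp]
theorem prodAct_tmul (ρA : M ⊗[k] A →ₗ[k] M) (ρB : M ⊗[k] B →ₗ[k] M) (m : M) (a : A) (b : B) :
    prodAct ρA ρB (m ⊗ₜ (a ⊗ₜ b)) = ρB (ρA (m ⊗ₜ a) ⊗ₜ b) := by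
  simp [prodAct]

/-- Two actions commute up to `ξ`: `(m · b) · a = (m · a') · b'` for `ξ (b ⊗ a) = a' ⊗ b'`. -/
def ActCompat (ξ : B ⊗[k] A →ₗ[k] A ⊗[k] B) (ρA : M ⊗[k] A →ₗ[k] M) (ρB : M ⊗[k] B →ₗ[k] M) :
    Prop :=
  ∀ m t, prodAct ρB ρA (m ⊗ₜ t) = prodAct ρA ρB (m ⊗ₜ ξ t)

theorem ActCompat.of_tmul {ξ : B ⊗[k] A →ₗ[k] A ⊗[k] B} {ρA : M ⊗[k] A →ₗ[k] M}
    {ρB : M ⊗[k] B →ₗ[k] M}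
    (h : ∀ m b a, ρA (ρB (m ⊗ₜ b) ⊗ₜ a) = prodAct ρA ρB (m ⊗ₜ ξ (b ⊗ₜ a))) :
    ActCompat ξ ρA ρB := by
  intro m t
  induction t using TensorProduct.induction_on with
  | zero => simp
  | add x y hx hy => simp only [TensorProduct.tmul_add, map_add, hx, hy]
  | tmul b a => rw [prodAct_tmul, h]

theorem ActCompat.tmul {ξ : B ⊗[k] A →ₗ[k] A ⊗[k] B} {ρA : M ⊗[k] A →ₗ[k] M}
    {ρB : M ⊗[k] B →ₗ[k] M} (h : ActCompat ξ ρA ρB) (m : M) (b : B) (a : A) :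
    ρA (ρB (m ⊗ₜ b) ⊗ₜ a) = prodAct ρA ρB (m ⊗ₜ ξ (b ⊗ₜ a)) := by
  rw [← h, prodAct_tmul]

theorem actCompat_iff {ξ : B ⊗[k] A →ₗ[k] A ⊗[k] B} {ρA : M ⊗[k] A →ₗ[k] M}
    {ρB : M ⊗[k] B →ₗ[k] M} : ActCompat ξ ρA ρB ↔
      ρA ∘ₗ LinearMap.rTensor A ρB = ρB ∘ₗ LinearMap.rTensor B ρA ∘ₗ
        (TensorProduct.assoc k M A B).symm.toLinearMap ∘ₗ LinearMap.lTensor M ξ ∘ₗ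
        (TensorProduct.assoc k M B A).toLinearMap := by
  constructor
  · intro h
    refine TensorProduct.ext_threefold fun m b a => ?_
    simpa [prodAct] using h.tmul m b a
  · intro h
    refine ActCompat.of_tmul fun m b a => ?_
    simpa [prodAct] using LinearMap.congr_fun h ((m ⊗ₜ b) ⊗ₜ a)

theorem ActCompat.symm {e : B ⊗[k] A ≃ₗ[k] A ⊗[k] B} {ρA : M ⊗[k] A →ₗ[k] M}
    {ρB : M ⊗[k] B →ₗ[k] M} (h : ActCompat e.toLinearMap ρA ρB) :
    ActCompat e.symm.toLinearMap ρB ρA := by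
  intro m t
  rw [h]
  simp

/-- The condition reads `(m · b) · a = (m · 1) · (b a)`, which is associativity as soon as `1` acts
trivially. -/
theorem actCompat_sigmaAss {S : AlgStr k A} {ρ : M ⊗[k] A →ₗ[k] M}
    (h1 : ∀ m, ρ (m ⊗ₜ S.one) = m) : ActCompat S.sigmaAss ρ ρ ↔ S.IsModule M ρ := by
  constructor
  · intro h
    exact ⟨fun m a b => by simp [h.tmul, AlgStr.sigmaAss, h1], h1⟩
  · intro h
    refine ActCompat.of_tmul fun m b a => ?_
    simp [AlgStr.sigmaAss, h1, h.assoc]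

theorem AlgStr.IsModule.twisted {S : AlgStr k A} {T : AlgStr k B}
    {ξ : B ⊗[k] A →ₗ[k] A ⊗[k] B} {ρA : M ⊗[k] A →ₗ[k] M} {ρB : M ⊗[k] B →ₗ[k] M}
    (hA : S.IsModule M ρA) (hB : T.IsModule M ρB) (h : ActCompat ξ ρA ρB) :
    (S.twisted T ξ).IsModule M (prodAct ρA ρB) where
  unit m := by
    change prodAct ρA ρB (m ⊗ₜ (S.one ⊗ₜ T.one)) = m
    simp [hA.unit, hB.unit]
  assoc m x y := by
    induction x using TensorProduct.induction_on with
    | zero => simp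
    | add x y hx hy => simp only [TensorProduct.tmul_add, TensorProduct.add_tmul, map_add, hx, hy]
    | tmul a b =>
    induction y using TensorProduct.induction_on with
    | zero => simp
    | add x y hx hy => simp only [TensorProduct.tmul_add, TensorProduct.add_tmul, map_add, hx, hy]
    | tmul a' b' =>
    rw [prodAct_tmul, prodAct_tmul, h.tmul, AlgStr.twisted_mul_tmul]
    generalize ξ (b ⊗ₜ a') = t
    induction t using TensorProduct.induction_on with
    | zero => simp
    | add x y hx hy => simp only [TensorProduct.tmul_add, TensorProduct.add_tmul, map_add, hx, hy]
    | tmul p q => simp [hA.assoc, hB.assoc]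

/-- The restriction of an action of `A ⊗ B` to `A`. -/
def restrLeft (T : AlgStr k B) (ρ : M ⊗[k] (A ⊗[k] B) →ₗ[k] M) : M ⊗[k] A →ₗ[k] M :=
  ρ ∘ₗ LinearMap.lTensor M ((TensorProduct.mk k A B).flip T.one)

/-- The restriction of an action of `A ⊗ B` to `B`. -/
def restrRight (S : AlgStr k A) (ρ : M ⊗[k] (A ⊗[k] B) →ₗ[k] M) : M ⊗[k] B →ₗ[k] M :=
  ρ ∘ₗ LinearMap.lTensor M (TensorProduct.mk k A B S.one)

@[simp]
theorem restrLeft_tmul (T : AlgStr k B) (ρ : M ⊗[k] (A ⊗[k] B) →ₗ[k] M) (m : M) (a : A) :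
    restrLeft T ρ (m ⊗ₜ a) = ρ (m ⊗ₜ (a ⊗ₜ T.one)) := by simp [restrLeft]

@[simp]
theorem restrRight_tmul (S : AlgStr k A) (ρ : M ⊗[k] (A ⊗[k] B) →ₗ[k] M) (m : M) (b : B) :
    restrRight S ρ (m ⊗ₜ b) = ρ (m ⊗ₜ (S.one ⊗ₜ b)) := by simp [restrRight]

section Restrict

variable {S : AlgStr k A} {T : AlgStr k B} {ξ : B ⊗[k] A →ₗ[k] A ⊗[k] B}
  {ρ : M ⊗[k] (A ⊗[k] B) →ₗ[k] M}

/-- Because `ξ (1 ⊗ 1) = 1 ⊗ 1`, one has `a ⊗ b = (a ⊗ 1) (1 ⊗ b)` in the twisted product. -/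
theorem prodAct_restr (hξ : IsTwist S T ξ) (hS : S.IsUAA) (hT : T.IsUAA)
    (h : (S.twisted T ξ).IsModule M ρ) : prodAct (restrLeft T ρ) (restrRight S ρ) = ρ := by
  refine TensorProduct.ext (LinearMap.ext fun m => TensorProduct.ext' fun a b => ?_)
  simp [h.assoc, AlgStr.twisted_mul_tmul, hξ.one_left, hS.mul_one, hT.one_mul]

theorem AlgStr.IsModule.restrLeft (hξ : IsTwist S T ξ) (hT : T.IsUAA)
    (h : (S.twisted T ξ).IsModule M ρ) : S.IsModule M (restrLeft T ρ) where
  assoc m a b := by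
    simp [h.assoc, AlgStr.twisted_mul_tmul, hξ.one_left, hT.mul_one]
  unit m := by simpa [AlgStr.twisted] using h.unit m

theorem AlgStr.IsModule.restrRight (hξ : IsTwist S T ξ) (hS : S.IsUAA)
    (h : (S.twisted T ξ).IsModule M ρ) : T.IsModule M (restrRight S ρ) where
  assoc m a b := by
    simp [h.assoc, AlgStr.twisted_mul_tmul, hξ.one_right, hS.mul_one]
  unit m := by simpa [AlgStr.twisted] using h.unit m

/-- In the twisted product `(1 ⊗ b) (a ⊗ 1) = ξ (b ⊗ a)`. -/
theorem actCompat_restr (hξ : IsTwist S T ξ) (hS : S.IsUAA) (hT : T.IsUAA)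
    (h : (S.twisted T ξ).IsModule M ρ) : ActCompat ξ (restrLeft T ρ) (restrRight S ρ) := by
  refine ActCompat.of_tmul fun m b a => ?_
  rw [prodAct_restr hξ hS hT h, restrLeft_tmul, restrRight_tmul, h.assoc,
    AlgStr.twisted_mul_tmul]
  congr 2
  generalize ξ (b ⊗ₜ a) = t
  induction t using TensorProduct.induction_on with
  | zero => simp
  | add x y hx hy => simp only [map_add, hx, hy]
  | tmul p q => simp [hS.one_mul, hT.mul_one]

end Restrict

theorem ActCompat.passLeft {ξ : A ⊗[k] C →ₗ[k] C ⊗[k] A} {ζ : B ⊗[k] C →ₗ[k] C ⊗[k] B}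
    {ρA : M ⊗[k] A →ₗ[k] M} {ρB : M ⊗[k] B →ₗ[k] M} {ρC : M ⊗[k] C →ₗ[k] M}
    (hA : ActCompat ξ ρC ρA) (hB : ActCompat ζ ρC ρB) :
    ActCompat (passLeft ξ ζ) ρC (prodAct ρA ρB) := by
  refine ActCompat.of_tmul fun m x c => ?_
  induction x using TensorProduct.induction_on with
  | zero => simp
  | add x y hx hy => simp only [TensorProduct.tmul_add, TensorProduct.add_tmul, map_add, hx, hy]
  | tmul a b =>
  rw [prodAct_tmul, hB.tmul, passLeft_tmul]
  generalize ζ (b ⊗ₜ c) = t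
  induction t using TensorProduct.induction_on with
  | zero => simp
  | add x y hx hy => simp only [TensorProduct.tmul_add, TensorProduct.add_tmul, map_add, hx, hy]
  | tmul c b =>
    rw [prodAct_tmul, hA.tmul, TensorProduct.assoc_symm_tmul, LinearMap.rTensor_tmul]
    generalize ξ (a ⊗ₜ c) = t
    induction t using TensorProduct.induction_on with
    | zero => simp
    | add x y hx hy => simp only [TensorProduct.tmul_add, TensorProduct.add_tmul, map_add, hx, hy]
    | tmul c b => simp

/-- Taking `1` for the element of `B` makes the second factor invisible, both for the twist and for
the action. This converse of `ActCompat.passLeft` recovers the pairwise compatibilities from a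
composite one. -/
theorem ActCompat.of_passLeft_left {SB : AlgStr k B}
    {ξ : A ⊗[k] C →ₗ[k] C ⊗[k] A} {ζ : B ⊗[k] C →ₗ[k] C ⊗[k] B}
    {ρA : M ⊗[k] A →ₗ[k] M} {ρB : M ⊗[k] B →ₗ[k] M} {ρC : M ⊗[k] C →ₗ[k] M}
    (hζ : ∀ c, ζ (SB.one ⊗ₜ c) = c ⊗ₜ SB.one) (hB : ∀ m, ρB (m ⊗ₜ SB.one) = m)
    (h : ActCompat (HopfBraid.passLeft ξ ζ) ρC (prodAct ρA ρB)) : ActCompat ξ ρC ρA := by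
  refine ActCompat.of_tmul fun m a c => ?_
  have := h.tmul m (a ⊗ₜ SB.one) c
  rw [passLeft_tmul, hζ, prodAct_tmul, hB, TensorProduct.assoc_symm_tmul,
    LinearMap.rTensor_tmul] at this
  rw [this]
  generalize ξ (a ⊗ₜ c) = t
  induction t using TensorProduct.induction_on with
  | zero => simp
  | add x y hx hy => simp only [TensorProduct.tmul_add, TensorProduct.add_tmul, map_add, hx, hy]
  | tmul c b => simp [hB]

theorem ActCompat.of_passLeft_right {SA : AlgStr k A}
    {ξ : A ⊗[k] C →ₗ[k] C ⊗[k] A} {ζ : B ⊗[k] C →ₗ[k] C ⊗[k] B}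
    {ρA : M ⊗[k] A →ₗ[k] M} {ρB : M ⊗[k] B →ₗ[k] M} {ρC : M ⊗[k] C →ₗ[k] M}
    (hξ : ∀ c, ξ (SA.one ⊗ₜ c) = c ⊗ₜ SA.one) (hA : ∀ m, ρA (m ⊗ₜ SA.one) = m)
    (h : ActCompat (HopfBraid.passLeft ξ ζ) ρC (prodAct ρA ρB)) : ActCompat ζ ρC ρB := by
  refine ActCompat.of_tmul fun m b c => ?_
  have := h.tmul m (SA.one ⊗ₜ b) c
  rw [passLeft_tmul, prodAct_tmul, hA] at this
  rw [this]
  generalize ζ (b ⊗ₜ c) = t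
  induction t using TensorProduct.induction_on with
  | zero => simp
  | add x y hx hy => simp only [TensorProduct.tmul_add, TensorProduct.add_tmul, map_add, hx, hy]
  | tmul c b => simp [hA, hξ]

end Modules

/-! ### The Yang-Baxter equation with repeated components. -/

section AssociativityBraiding

variable {k : Type u} [Field k]
variable {A B : Type u} [AddCommGroup A] [Module k A] [AddCommGroup B] [Module k B]
  {S : AlgStr k A} {T : AlgStr k B} {ξ : B ⊗[k] A →ₗ[k] A ⊗[k] B}

theorem AlgStr.sigmaAss_tmul (S : AlgStr k A) (a b : A) :
    S.sigmaAss (a ⊗ₜ b) = S.one ⊗ₜ S.mul (a ⊗ₜ b) := rfl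

/-- Both sides send `a ⊗ b ⊗ c` to `1 ⊗ 1 ⊗ a b c`. -/
theorem AlgStr.IsUAA.yangBaxter (h : S.IsUAA) : YangBaxter S.sigmaAss S.sigmaAss S.sigmaAss := by
  refine yangBaxter_iff.2 fun a b c => ?_
  simp [AlgStr.sigmaAss_tmul, h.one_mul, h.mul_assoc]

/-- Both sides of the Yang-Baxter equation are the two sides of the multiplicativity condition with
an additional factor `1` inserted. The functional `φ`, which will be a counit of the system, allows
this factor to be removed. -/
theorem yangBaxter_sigmaAss_left_iff {φ : B →ₗ[k] k} (hφ : φ T.one = 1)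
    (h1 : ∀ a, ξ (T.one ⊗ₜ a) = a ⊗ₜ T.one) : YangBaxter T.sigmaAss ξ ξ ↔
      ∀ b b' a, ξ (T.mul (b ⊗ₜ b') ⊗ₜ a) =
        LinearMap.lTensor A T.mul (TensorProduct.assoc k A B B (LinearMap.rTensor B ξ
          ((TensorProduct.assoc k B A B).symm (b ⊗ₜ ξ (b' ⊗ₜ a))))) := by
  rw [yangBaxter_iff]
  refine forall_congr' fun b => forall_congr' fun b' => forall_congr' fun a => ?_
  generalize hr : LinearMap.rTensor B ξ
    ((TensorProduct.assoc k B A B).symm (b ⊗ₜ ξ (b' ⊗ₜ a))) = r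
  have h2 : ∀ t, LinearMap.rTensor B ξ ((TensorProduct.assoc k B A B).symm (T.one ⊗ₜ t)) =
      (TensorProduct.assoc k A B B).symm
        (LinearMap.lTensor A (TensorProduct.mk k B B T.one) t) := by
    intro t
    induction t using TensorProduct.induction_on with
    | zero => simp
    | add x y hx hy => simp only [TensorProduct.tmul_add, TensorProduct.add_tmul, map_add, hx, hy]
    | tmul p q => simp [h1]
  -- Inserting `1` is split injective: applying `φ` to the inserted factor undoes it.
  have h3 : Function.Injective (LinearMap.lTensor A (TensorProduct.mk k B B T.one)) := by
    refine Function.LeftInverse.injective (g := LinearMap.lTensor A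
      ((TensorProduct.lid k B).toLinearMap ∘ₗ LinearMap.rTensor B φ)) fun t => ?_
    rw [← LinearMap.comp_apply, ← LinearMap.lTensor_comp]
    have : ((TensorProduct.lid k B).toLinearMap ∘ₗ LinearMap.rTensor B φ) ∘ₗ
        TensorProduct.mk k B B T.one = LinearMap.id := by ext; simp [hφ]
    rw [this, LinearMap.lTensor_id, LinearMap.id_apply]
  rw [AlgStr.sigmaAss_tmul, TensorProduct.assoc_tmul, LinearMap.lTensor_tmul, h2,
    AlgStr.sigmaAss, LinearMap.lTensor_comp, LinearMap.comp_apply]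
  exact ⟨fun h => h3 ((TensorProduct.assoc k A B B).symm.injective h), fun h => by rw [h]⟩

theorem yangBaxter_sigmaAss_right_iff {φ : A →ₗ[k] k} (hφ : φ S.one = 1)
    (h1 : ∀ b, ξ (b ⊗ₜ S.one) = S.one ⊗ₜ b) : YangBaxter ξ ξ S.sigmaAss ↔
      ∀ b a a', ξ (b ⊗ₜ S.mul (a ⊗ₜ a')) =
        LinearMap.rTensor B S.mul ((TensorProduct.assoc k A A B).symm (LinearMap.lTensor A ξ
          (TensorProduct.assoc k A B A (ξ (b ⊗ₜ a) ⊗ₜ a')))) := by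
  rw [yangBaxter_iff]
  refine forall_congr' fun b => forall_congr' fun a => forall_congr' fun a' => ?_
  generalize hr : LinearMap.lTensor A ξ (TensorProduct.assoc k A B A (ξ (b ⊗ₜ a) ⊗ₜ a')) = r
  have h3 : Function.Injective (TensorProduct.mk k A (A ⊗[k] B) S.one) := by
    refine Function.LeftInverse.injective (g :=
      ((TensorProduct.lid k _).toLinearMap ∘ₗ LinearMap.rTensor _ φ)) fun t => ?_
    simp [hφ]
  have h4 : LinearMap.rTensor B S.sigmaAss ((TensorProduct.assoc k A A B).symm r) =
      (TensorProduct.assoc k A A B).symm (S.one ⊗ₜ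
        LinearMap.rTensor B S.mul ((TensorProduct.assoc k A A B).symm r)) := by
    generalize (TensorProduct.assoc k A A B).symm r = t
    induction t using TensorProduct.induction_on with
    | zero => simp
    | add x y hx hy => simp only [TensorProduct.tmul_add, TensorProduct.add_tmul, map_add, hx, hy]
    | tmul p q => simp [AlgStr.sigmaAss]
  rw [AlgStr.sigmaAss_tmul, TensorProduct.assoc_symm_tmul, LinearMap.rTensor_tmul, h1, h4,
    TensorProduct.assoc_tmul, LinearMap.lTensor_tmul]
  exact ⟨fun h => (h3 ((TensorProduct.assoc k A A B).symm.injective h)).symm, fun h => by rw [h]⟩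

end AssociativityBraiding

/-! ### Systems of algebras as families of twists. -/

namespace AlgSystem

variable {k : Type u} [Field k]

section General

variable {r : ℕ} {S : AlgSystem k r}

theorem IsSystemOfUAAs.isTwist (hS : S.IsSystemOfUAAs) {i j : Fin r} (h : i < j) :
    IsTwist (S.alg j) (S.alg i) (S.σ i j h.le) where
  one_left := hS.natural_left i j h
  one_right := hS.natural_right i j h
  mul_left := by
    refine (yangBaxter_sigmaAss_left_iff (T := S.alg i) (φ := S.counit i)
      (hS.isBraided.normalized i) (hS.natural_left i j h)).1 ?_
    have := hS.isBraided.yang_baxter i i j le_rfl h.le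
    rwa [S.σ_diag] at this
  mul_right := by
    refine (yangBaxter_sigmaAss_right_iff (S := S.alg j) (φ := S.counit j)
      (hS.isBraided.normalized j) (hS.natural_right i j h)).1 ?_
    have := hS.isBraided.yang_baxter i j j h.le le_rfl
    rwa [S.σ_diag] at this

/-- Yang-Baxter is only required for three distinct components. Three equal ones amount to
associativity, and two equal ones to the multiplicativity of a twist. -/
theorem isSystemOfUAAs_of (isUAA : ∀ i, (S.alg i).IsUAA)
    (twist : ∀ i j (h : i < j), IsTwist (S.alg j) (S.alg i) (S.σ i j h.le))
    (yb : ∀ i j l (hij : i < j) (hjl : j < l),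
      YangBaxter (S.σ i j hij.le) (S.σ i l (hij.trans hjl).le) (S.σ j l hjl.le))
    (normalized : ∀ i, S.counit i (S.unit i) = 1) : S.IsSystemOfUAAs where
  isUAA := isUAA
  natural_left i j h := (twist i j h).one_left
  natural_right i j h := (twist i j h).one_right
  isBraided :=
    { normalized := normalized
      yang_baxter := by
        intro i j l hij hjl
        change YangBaxter _ _ _
        rcases hij.eq_or_lt with rfl | hij'
        · rcases hjl.eq_or_lt with rfl | hjl'
          · rw [S.σ_diag]
            exact (isUAA i).yangBaxter
          · rw [S.σ_diag]
            exact (yangBaxter_sigmaAss_left_iff (T := S.alg i) (φ := S.counit i)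
              (normalized i) (twist i l hjl').one_left).2 (twist i l hjl').mul_left
        · rcases hjl.eq_or_lt with rfl | hjl'
          · rw [S.σ_diag]
            exact (yangBaxter_sigmaAss_right_iff (S := S.alg j) (φ := S.counit j)
              (normalized j) (twist i j hij').one_right).2 (twist i j hij').mul_right
          · exact yb i j l hij' hjl' }

theorem IsSystemOfUAAs.yangBaxter (hS : S.IsSystemOfUAAs) (i j l : Fin r) (hij : i ≤ j)
    (hjl : j ≤ l) : YangBaxter (S.σ i j hij) (S.σ i l (hij.trans hjl)) (S.σ j l hjl) :=
  hS.isBraided.yang_baxter i j l hij hjl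

/-- Braided modules over a system of algebras, in terms of modules over the components. -/
theorem isModule_iff {M : Type u} [AddCommGroup M] [Module k M]
    {ρ : ∀ i, M ⊗[k] S.V i →ₗ[k] M} : S.toBraidedData.IsModule M ρ ↔
      (∀ i, (S.alg i).IsModule M (ρ i)) ∧
        ∀ i j (h : i < j), ActCompat (S.σ i j h.le) (ρ j) (ρ i) := by
  constructor
  · intro h
    refine ⟨fun i => ?_, fun i j hij => actCompat_iff.2 (h.compat i j hij.le)⟩
    refine (actCompat_sigmaAss (S := S.alg i) (h.unit i)).1 (actCompat_iff.2 ?_)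
    have := h.compat i i le_rfl
    rwa [S.σ_diag] at this
  · rintro ⟨h1, h2⟩
    refine ⟨fun i j hij => ?_, fun i m => (h1 i).unit m⟩
    rcases hij.eq_or_lt with rfl | hij'
    · rw [S.σ_diag]
      exact actCompat_iff.1 ((actCompat_sigmaAss (S := S.alg i) (h1 i).unit).2 (h1 i))
    · exact actCompat_iff.1 (h2 i j hij')

/-! ### Component permutations -/

theorem perm_σ_of_lt (θ : Equiv.Perm (Fin r)) (S : AlgSystem k r) {i j : Fin r} (h : i ≤ j)
    (h' : θ⁻¹ i < θ⁻¹ j) : (S.perm θ).σ i j h = S.σ (θ⁻¹ i) (θ⁻¹ j) h'.le := dif_pos h'.le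

theorem perm_σ_of_gt (θ : Equiv.Perm (Fin r)) (S : AlgSystem k r) {i j : Fin r} (h : i ≤ j)
    (h' : θ⁻¹ j < θ⁻¹ i) : (S.perm θ).σ i j h = linInv (S.σ (θ⁻¹ j) (θ⁻¹ i) h'.le) :=
  dif_neg h'.not_ge

/-- The `σ_{i,j}` with `i < j` are bijective. -/
def BijectiveBraiding (S : AlgSystem k r) : Prop :=
  ∀ (i j : Fin r) (h : i < j), Function.Bijective (S.σ i j h.le)

theorem BijectiveBraiding.perm (hb : S.BijectiveBraiding) (θ : Equiv.Perm (Fin r)) :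
    (S.perm θ).BijectiveBraiding := by
  intro i j h
  rcases lt_or_gt_of_ne (θ⁻¹.injective.ne h.ne) with h' | h'
  · rw [perm_σ_of_lt θ S h.le h']
    exact hb _ _ h'
  · rw [perm_σ_of_gt θ S h.le h']
    obtain ⟨e, -, he⟩ := exists_equiv_of_bijective (hb _ _ h')
    rw [he]
    exact e.symm.bijective

/-- The twist conditions are stable under inversion. For a triple `i < j < l`, eight patterns of
preserved and reversed pairs are conceivable. Two of them contradict transitivity; the other six are
the orders of a triple, reached from the original one by successive adjacent inversions. -/
theorem IsSystemOfUAAs.perm (hS : S.IsSystemOfUAAs) (hb : S.BijectiveBraiding)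
    (θ : Equiv.Perm (Fin r)) : (S.perm θ).IsSystemOfUAAs := by
  refine isSystemOfUAAs_of (fun i => hS.isUAA (θ⁻¹ i)) (fun i j h => ?_) ?_
    (fun i => hS.isBraided.normalized (θ⁻¹ i))
  · rcases lt_or_gt_of_ne (θ⁻¹.injective.ne h.ne) with h' | h'
    · rw [perm_σ_of_lt θ S h.le h']
      exact hS.isTwist h'
    · rw [perm_σ_of_gt θ S h.le h']
      obtain ⟨e, he, he'⟩ := exists_equiv_of_bijective (hb _ _ h')
      rw [he']
      have := hS.isTwist h'
      rw [he] at this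
      exact this.symm
  · intro i j l hij hjl
    have yb := hS.yangBaxter
    have hil := hij.trans hjl
    rcases lt_or_gt_of_ne (θ⁻¹.injective.ne hij.ne) with h1 | h1 <;>
    rcases lt_or_gt_of_ne (θ⁻¹.injective.ne hjl.ne) with h2 | h2 <;>
    rcases lt_or_gt_of_ne (θ⁻¹.injective.ne hil.ne) with h3 | h3
    · rw [perm_σ_of_lt θ S hij.le h1, perm_σ_of_lt θ S hjl.le h2, perm_σ_of_lt θ S hil.le h3]
      exact yb _ _ _ h1.le h2.le
    · exact absurd (h1.trans h2) h3.not_gt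
    · rw [perm_σ_of_lt θ S hij.le h1, perm_σ_of_gt θ S hjl.le h2, perm_σ_of_lt θ S hil.le h3]
      obtain ⟨e, he, he'⟩ := exists_equiv_of_bijective (hb _ _ h2)
      have := yb _ _ _ h3.le h2.le
      rw [he] at this
      rw [he']
      exact this.symm_right
    · rw [perm_σ_of_lt θ S hij.le h1, perm_σ_of_gt θ S hjl.le h2, perm_σ_of_gt θ S hil.le h3]
      obtain ⟨e, he, he'⟩ := exists_equiv_of_bijective (hb _ _ h2)
      obtain ⟨f, hf, hf'⟩ := exists_equiv_of_bijective (hb _ _ h3)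
      have := yb _ _ _ h3.le h1.le
      rw [he, hf] at this
      rw [he', hf']
      exact this.symm_left.symm_right
    · rw [perm_σ_of_gt θ S hij.le h1, perm_σ_of_lt θ S hjl.le h2, perm_σ_of_lt θ S hil.le h3]
      obtain ⟨e, he, he'⟩ := exists_equiv_of_bijective (hb _ _ h1)
      have := yb _ _ _ h1.le h3.le
      rw [he] at this
      rw [he']
      exact this.symm_left
    · rw [perm_σ_of_gt θ S hij.le h1, perm_σ_of_lt θ S hjl.le h2, perm_σ_of_gt θ S hil.le h3]
      obtain ⟨e, he, he'⟩ := exists_equiv_of_bijective (hb _ _ h1)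
      obtain ⟨f, hf, hf'⟩ := exists_equiv_of_bijective (hb _ _ h3)
      have := yb _ _ _ h2.le h3.le
      rw [he, hf] at this
      rw [he', hf']
      exact this.symm_right.symm_left
    · exact absurd (h2.trans h1) h3.not_gt
    · rw [perm_σ_of_gt θ S hij.le h1, perm_σ_of_gt θ S hjl.le h2, perm_σ_of_gt θ S hil.le h3]
      obtain ⟨e, he, he'⟩ := exists_equiv_of_bijective (hb _ _ h1)
      obtain ⟨f, hf, hf'⟩ := exists_equiv_of_bijective (hb _ _ h3)
      obtain ⟨g, hg, hg'⟩ := exists_equiv_of_bijective (hb _ _ h2)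
      have := yb _ _ _ h2.le h1.le
      rw [he, hf, hg] at this
      rw [he', hf', hg']
      -- Complete reversal, through `(A, C, B)`, `(C, A, B)` and `(C, B, A)`.
      exact this.symm_right.symm_left.symm_right

/-- Modules over a component permutation. -/
theorem isModule_perm_iff (hb : S.BijectiveBraiding) (θ : Equiv.Perm (Fin r))
    {M : Type u} [AddCommGroup M] [Module k M] {ρ : ∀ i, M ⊗[k] S.V i →ₗ[k] M} :
    (S.perm θ).toBraidedData.IsModule M (fun i => ρ (θ⁻¹ i)) ↔ S.toBraidedData.IsModule M ρ := by
  refine (isModule_iff (S := S.perm θ)).trans (Iff.trans ?_ isModule_iff.symm)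
  refine and_congr ⟨fun h i => ?_, fun h i => h _⟩ ⟨fun h i j hij => ?_, fun h i j hij => ?_⟩
  · obtain ⟨j, rfl⟩ := θ⁻¹.surjective i
    exact h j
  · obtain ⟨i, rfl⟩ := θ⁻¹.surjective i
    obtain ⟨j, rfl⟩ := θ⁻¹.surjective j
    have hne : i ≠ j := fun e => hij.ne (congrArg _ e)
    rcases lt_or_gt_of_ne hne with h' | h'
    · have := h i j h'
      rwa [perm_σ_of_lt θ S h'.le hij] at this
    · have := h j i h'
      rw [perm_σ_of_gt θ S h'.le hij] at this
      obtain ⟨e, he, he'⟩ := exists_equiv_of_bijective (hb _ _ hij)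
      rw [he'] at this
      rw [he]
      exact this.symm
  · rcases lt_or_gt_of_ne (θ⁻¹.injective.ne hij.ne) with h' | h'
    · rw [perm_σ_of_lt θ S hij.le h']
      exact h _ _ h'
    · rw [perm_σ_of_gt θ S hij.le h']
      obtain ⟨e, he, he'⟩ := exists_equiv_of_bijective (hb _ _ h')
      have := h _ _ h'
      rw [he] at this
      rw [he']
      exact this.symm

end General

end AlgSystem

theorem forall_fin_four_lt {P : ∀ i j : Fin 4, i < j → Prop} (h01 : P 0 1 (by decide))
    (h02 : P 0 2 (by decide)) (h03 : P 0 3 (by decide)) (h12 : P 1 2 (by decide))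
    (h13 : P 1 3 (by decide)) (h23 : P 2 3 (by decide)) : ∀ i j h, P i j h
  | 0, 1, _ => h01
  | 0, 2, _ => h02
  | 0, 3, _ => h03
  | 1, 2, _ => h12
  | 1, 3, _ => h13
  | 2, 3, _ => h23
  | 0, 0, h => absurd h (by decide)
  | 1, 0, h => absurd h (by decide)
  | 1, 1, h => absurd h (by decide)
  | 2, 0, h => absurd h (by decide)
  | 2, 1, h => absurd h (by decide)
  | 2, 2, h => absurd h (by decide)
  | 3, 0, h => absurd h (by decide)
  | 3, 1, h => absurd h (by decide)
  | 3, 2, h => absurd h (by decide)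
  | 3, 3, h => absurd h (by decide)

theorem forall_fin_four {P : Fin 4 → Prop} (h0 : P 0) (h1 : P 1) (h2 : P 2) (h3 : P 3) : ∀ i, P i
  | 0 => h0
  | 1 => h1
  | 2 => h2
  | 3 => h3

/-- Essential surjectivity is always proved on the same underlying space, with actions that are
equal but not by definition. Substituting the equality makes the isomorphism the identity. -/
theorem AlgMod.nonempty_iso {k : Type u} [Field k] {A : Type u} [AddCommGroup A] [Module k A]
    {S : AlgStr k A} {M : Type u} [AddCommGroup M] [Module k M] [Module.Finite k M]
    {ρ ρ' : M ⊗[k] A →ₗ[k] M} (e : ρ = ρ') (h : S.IsModule M ρ) (h' : S.IsModule M ρ') :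
    Nonempty ((⟨M, ρ, h⟩ : AlgMod S) ≅ ⟨M, ρ', h'⟩) := by
  subst e
  exact ⟨Iso.refl _⟩

theorem BrMod.nonempty_iso {k : Type u} [Field k] {r : ℕ} {S : BraidedData k r}
    {M : Type u} [AddCommGroup M] [Module k M] [Module.Finite k M]
    {ρ ρ' : ∀ i, M ⊗[k] S.V i →ₗ[k] M} (e : ∀ i, ρ i = ρ' i) (h : S.IsModule M ρ)
    (h' : S.IsModule M ρ') : Nonempty ((⟨M, ρ, h⟩ : BrMod S) ≅ ⟨M, ρ', h'⟩) := by
  obtain rfl : ρ = ρ' := funext e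
  exact ⟨Iso.refl _⟩

namespace AlgSystem

variable {k : Type u} [Field k] {S : AlgSystem k 4}

/-- The braided tensor product of the first two components. -/
abbrev btpTwo (S : AlgSystem k 4) : AlgStr k (S.V 1 ⊗[k] S.V 0) :=
  (S.alg 1).twisted (S.alg 0) (S.σ 0 1 (by decide))

/-- The braided tensor product of the first three components. -/
abbrev btpThree (S : AlgSystem k 4) : AlgStr k (S.V 2 ⊗[k] (S.V 1 ⊗[k] S.V 0)) :=
  (S.alg 2).twisted S.btpTwo (passLeft (S.σ 1 2 (by decide)) (S.σ 0 2 (by decide)))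

theorem IsSystemOfUAAs.isTwist_two (hS : S.IsSystemOfUAAs) : IsTwist (S.alg 2) S.btpTwo
    (passLeft (S.σ 1 2 (by decide)) (S.σ 0 2 (by decide))) :=
  (hS.isTwist (i := 1) (j := 2) (by decide)).passLeft (hS.isTwist (i := 0) (j := 2) (by decide))
    (hS.yangBaxter 0 1 2 (by decide) (by decide))

/-- Moving `V₄` through the product of the other three needs Yang-Baxter on the triples containing
index `3`: `(0, 1, 3)` to pass the product of the last two factors, and `(1, 2, 3)`, `(0, 2, 3)` for
the twist between `V₃` and that product. The remaining triple `(0, 1, 2)` enters in `isTwist_two`.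
-/
theorem IsSystemOfUAAs.isTwist_three (hS : S.IsSystemOfUAAs) : IsTwist (S.alg 3) S.btpThree
    (passLeft (S.σ 2 3 (by decide))
      (passLeft (S.σ 1 3 (by decide)) (S.σ 0 3 (by decide)))) :=
  (hS.isTwist (i := 2) (j := 3) (by decide)).passLeft
    ((hS.isTwist (i := 1) (j := 3) (by decide)).passLeft (hS.isTwist (i := 0) (j := 3) (by decide))
      (hS.yangBaxter 0 1 3 (by decide) (by decide)))
    ((hS.yangBaxter 1 2 3 (by decide) (by decide)).passLeft
      (hS.yangBaxter 0 2 3 (by decide) (by decide)))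

theorem IsSystemOfUAAs.isUAA_btpTwo (hS : S.IsSystemOfUAAs) : S.btpTwo.IsUAA :=
  (hS.isTwist (i := 0) (j := 1) (by decide)).isUAA (hS.isUAA 1) (hS.isUAA 0)

theorem IsSystemOfUAAs.isUAA_btpThree (hS : S.IsSystemOfUAAs) : S.btpThree.IsUAA :=
  hS.isTwist_two.isUAA (hS.isUAA 2) hS.isUAA_btpTwo

theorem IsSystemOfUAAs.isUAA_btp (hS : S.IsSystemOfUAAs) : S.btp.IsUAA :=
  hS.isTwist_three.isUAA (hS.isUAA 3) hS.isUAA_btpThree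

/-- The inclusions of the components into the braided tensor product. -/
def incl (S : AlgSystem k 4) : ∀ i, S.V i →ₗ[k] S.BTP
  | 0 => TensorProduct.mk k _ _ (S.unit 3) ∘ₗ TensorProduct.mk k _ _ (S.unit 2) ∘ₗ
      TensorProduct.mk k _ _ (S.unit 1)
  | 1 => TensorProduct.mk k _ _ (S.unit 3) ∘ₗ TensorProduct.mk k _ _ (S.unit 2) ∘ₗ
      (TensorProduct.mk k _ _).flip (S.unit 0)
  | 2 => TensorProduct.mk k _ _ (S.unit 3) ∘ₗ (TensorProduct.mk k _ _).flip (S.unit 1 ⊗ₜ S.unit 0)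
  | 3 => (TensorProduct.mk k _ _).flip (S.unit 2 ⊗ₜ (S.unit 1 ⊗ₜ S.unit 0))

section Act

variable {M : Type u} [AddCommGroup M] [Module k M]

/-- The iterated action. -/
def iterProd (ρ : ∀ i, M ⊗[k] S.V i →ₗ[k] M) : M ⊗[k] S.BTP →ₗ[k] M :=
  prodAct (ρ 3) (prodAct (ρ 2) (prodAct (ρ 1) (ρ 0)))

theorem iterProd_tmul (ρ : ∀ i, M ⊗[k] S.V i →ₗ[k] M) (m : M) (v₃ : S.V 3) (v₂ : S.V 2)
    (v₁ : S.V 1) (v₀ : S.V 0) : iterProd ρ (m ⊗ₜ (v₃ ⊗ₜ (v₂ ⊗ₜ (v₁ ⊗ₜ v₀)))) =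
      ρ 0 (ρ 1 (ρ 2 (ρ 3 (m ⊗ₜ v₃) ⊗ₜ v₂) ⊗ₜ v₁) ⊗ₜ v₀) := by
  simp [iterProd]

/-- The actions of the components obtained from an action of the braided tensor product. -/
def restr (ρ : M ⊗[k] S.BTP →ₗ[k] M) (i : Fin 4) : M ⊗[k] S.V i →ₗ[k] M :=
  ρ ∘ₗ LinearMap.lTensor M (S.incl i)

@[simp]
theorem restr_tmul (ρ : M ⊗[k] S.BTP →ₗ[k] M) (i : Fin 4) (m : M) (v : S.V i) :
    restr ρ i (m ⊗ₜ v) = ρ (m ⊗ₜ S.incl i v) := by simp [restr]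

theorem isModule_iterProd {ρ : ∀ i, M ⊗[k] S.V i →ₗ[k] M}
    (h : S.toBraidedData.IsModule M ρ) : S.btp.IsModule M (iterProd ρ) := by
  obtain ⟨h1, h2⟩ := isModule_iff.1 h
  exact (h1 3).twisted ((h1 2).twisted ((h1 1).twisted (h1 0) (h2 0 1 (by decide)))
    ((h2 1 2 (by decide)).passLeft (h2 0 2 (by decide))))
    ((h2 2 3 (by decide)).passLeft ((h2 1 3 (by decide)).passLeft (h2 0 3 (by decide))))

theorem restr_iterProd {ρ : ∀ i, M ⊗[k] S.V i →ₗ[k] M}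
    (h : ∀ i m, ρ i (m ⊗ₜ S.unit i) = m) (i : Fin 4) : restr (iterProd ρ) i = ρ i := by
  refine TensorProduct.ext' fun m v => ?_
  rw [restr_tmul]
  revert v
  match i with
  | 0 => intro v; simp [incl, iterProd_tmul, h]
  | 1 => intro v; simp [incl, iterProd_tmul, h]
  | 2 => intro v; simp [incl, iterProd_tmul, h]
  | 3 => intro v; simp [incl, iterProd_tmul, h]

/-- The factors are split off one at a time, from left to right. This yields compatibility with
composite twists, and inserting units reduces these to the six pairwise conditions. -/
theorem isModule_restr (hS : S.IsSystemOfUAAs) {ρ : M ⊗[k] S.BTP →ₗ[k] M}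
    (h : S.btp.IsModule M ρ) :
    S.toBraidedData.IsModule M (restr ρ) ∧ iterProd (restr ρ) = ρ := by
  have t3 := hS.isTwist_three
  have t2 := hS.isTwist_two
  have t1 := hS.isTwist (i := 0) (j := 1) (by decide)
  have u3 := hS.isUAA_btpThree
  have u2 := hS.isUAA_btpTwo
  have m3 := h.restrLeft t3 u3
  have mP := h.restrRight t3 (hS.isUAA 3)
  have c3 := actCompat_restr t3 (hS.isUAA 3) u3 h
  have e3 := prodAct_restr t3 (hS.isUAA 3) u3 h
  have m2 := mP.restrLeft t2 u2
  have mQ := mP.restrRight t2 (hS.isUAA 2)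
  have c2 := actCompat_restr t2 (hS.isUAA 2) u2 mP
  have e2 := prodAct_restr t2 (hS.isUAA 2) u2 mP
  have m1 := mQ.restrLeft t1 (hS.isUAA 0)
  have m0 := mQ.restrRight t1 (hS.isUAA 1)
  have c1 := actCompat_restr t1 (hS.isUAA 1) (hS.isUAA 0) mQ
  have e1 := prodAct_restr t1 (hS.isUAA 1) (hS.isUAA 0) mQ
  -- Successive restriction inserts the units one after the other, so it agrees with restriction
  -- along `incl`.
  have r3 : restrLeft S.btpThree ρ = restr ρ 3 := TensorProduct.ext' fun m v => by
    rw [restrLeft_tmul, restr_tmul]; rfl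
  have r2 : restrLeft S.btpTwo (restrRight (S.alg 3) ρ) = restr ρ 2 :=
    TensorProduct.ext' fun m v => by
      rw [restrLeft_tmul, restrRight_tmul, restr_tmul]; rfl
  have r1 : restrLeft (S.alg 0) (restrRight (S.alg 2) (restrRight (S.alg 3) ρ)) = restr ρ 1 :=
    TensorProduct.ext' fun m v => by
      rw [restrLeft_tmul, restrRight_tmul, restrRight_tmul, restr_tmul]; rfl
  have r0 : restrRight (S.alg 1) (restrRight (S.alg 2) (restrRight (S.alg 3) ρ)) = restr ρ 0 :=
    TensorProduct.ext' fun m v => by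
      rw [restrRight_tmul, restrRight_tmul, restrRight_tmul, restr_tmul]; rfl
  rw [r1, r0] at e1 c1
  rw [r1] at m1
  rw [r0] at m0
  rw [r2, ← e1] at e2 c2
  rw [r2] at m2
  rw [r3, ← e2] at e3 c3
  rw [r3] at m3
  -- `c3` compares the last component with all three others. Its part `c3'`, for the components `1`
  -- and `0`, yields the pairs `(1, 3)` and `(0, 3)`.
  have c3' := ActCompat.of_passLeft_right (SA := S.alg 2)
    (hS.natural_left 2 3 (by decide)) m2.unit c3
  refine ⟨isModule_iff.2 ⟨forall_fin_four m0 m1 m2 m3, forall_fin_four_lt c1 ?_ ?_ ?_ ?_ ?_⟩, e3⟩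
  · exact ActCompat.of_passLeft_right (SA := S.alg 1)
      (hS.natural_left 1 2 (by decide)) m1.unit c2
  · exact ActCompat.of_passLeft_right (SA := S.alg 1)
      (hS.natural_left 1 3 (by decide)) m1.unit c3'
  · exact ActCompat.of_passLeft_left (SB := S.alg 0)
      (hS.natural_left 0 2 (by decide)) m0.unit c2
  · exact ActCompat.of_passLeft_left (SB := S.alg 0)
      (hS.natural_left 0 3 (by decide)) m0.unit c3'
  -- For the pair `(2, 3)`, the unit inserted is that of the product of the components `1` and `0`.
  · refine ActCompat.of_passLeft_left (SB := S.btpTwo) (fun c => ?_) (fun m => ?_) c3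
    · change passLeft _ _ ((S.unit 1 ⊗ₜ S.unit 0) ⊗ₜ c) = c ⊗ₜ (S.unit 1 ⊗ₜ S.unit 0)
      rw [passLeft_tmul, hS.natural_left 0 3 (by decide), TensorProduct.assoc_symm_tmul,
        LinearMap.rTensor_tmul, hS.natural_left 1 3 (by decide), TensorProduct.assoc_tmul]
    · change prodAct _ _ (m ⊗ₜ (S.unit 1 ⊗ₜ S.unit 0)) = m
      rw [prodAct_tmul]
      exact (congrArg (fun x => restr ρ 0 (x ⊗ₜ S.unit 0)) (m1.unit m)).trans (m0.unit m)

end Act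

theorem iterAct_eq (X : BrMod S.toBraidedData) : X.iterAct = iterProd X.ρ := by
  refine TensorProduct.ext (LinearMap.ext fun m => ?_)
  refine TensorProduct.ext (LinearMap.ext fun v₃ => TensorProduct.ext (LinearMap.ext fun v₂ =>
    TensorProduct.ext' fun v₁ v₀ => ?_))
  exact (BrMod.iterAct_tmul X m v₃ v₂ v₁ v₀).trans (iterProd_tmul X.ρ m v₃ v₂ v₁ v₀).symm

theorem isModule_iterAct (X : BrMod S.toBraidedData) : S.btp.IsModule X.M X.iterAct := by
  rw [iterAct_eq]
  exact isModule_iterProd X.isModule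

theorem iterAct_incl (X : BrMod S.toBraidedData) (i : Fin 4) (m : X.M) (v : S.V i) :
    X.iterAct (m ⊗ₜ S.incl i v) = X.ρ i (m ⊗ₜ v) := by
  rw [iterAct_eq, ← restr_tmul, restr_iterProd X.isModule.unit]

/-- A linear map commuting with the iterated action commutes with each component action, by
restriction along `incl`; this is fullness. Essential surjectivity is `isModule_restr`. -/
theorem isEquivalence_toAlgMod (hS : S.IsSystemOfUAAs)
    (h : ∀ X : BrMod S.toBraidedData, S.btp.IsModule X.M X.iterAct) :
    (BrMod.toAlgMod S h).IsEquivalence where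
  faithful := ⟨fun {X Y f g} e => BrMod.Hom.ext (congrArg AlgMod.Hom.map e)⟩
  full := ⟨fun {X Y} f => by
    let f' : X.M →ₗ[k] Y.M := f.map
    have hf : f' ∘ₗ X.iterAct = Y.iterAct ∘ₗ LinearMap.rTensor _ f' := f.comm
    refine ⟨⟨f', fun i => TensorProduct.ext' fun m v => ?_⟩, rfl⟩
    have := LinearMap.congr_fun hf (m ⊗ₜ S.incl i v)
    rw [LinearMap.comp_apply, LinearMap.comp_apply, LinearMap.rTensor_tmul, iterAct_incl,
      iterAct_incl] at this
    rwa [LinearMap.comp_apply, LinearMap.comp_apply, LinearMap.rTensor_tmul]⟩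
  essSurj := ⟨fun Z => by
    obtain ⟨h1, h2⟩ := isModule_restr hS Z.isModule
    let X : BrMod S.toBraidedData := ⟨Z.M, restr Z.ρ, h1⟩
    exact ⟨X, AlgMod.nonempty_iso ((iterAct_eq X).trans h2) (h X) Z.isModule⟩⟩

end AlgSystem

section Regular

variable {k : Type u} [Field k] {A B : Type u} [AddCommGroup A] [Module k A]
  [AddCommGroup B] [Module k B] {S : AlgStr k A} {T : AlgStr k B}

theorem AlgStr.IsUAA.isModule (h : S.IsUAA) : S.IsModule A S.mul where
  assoc := h.mul_assoc
  unit := h.mul_one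

theorem AlgMod.isEquivalence_transport (e : A ≃ₗ[k] B) (he : IsAlgIso S T e) :
    (AlgMod.transport e he).IsEquivalence where
  faithful := ⟨fun {X Y f g} h => AlgMod.Hom.ext (congrArg (fun q :
    (AlgMod.transport e he).obj X ⟶ (AlgMod.transport e he).obj Y => AlgMod.Hom.map q) h)⟩
  full := ⟨fun {X Y} f => by
    let f' : X.M →ₗ[k] Y.M := f.map
    have hf : f' ∘ₗ X.ρ ∘ₗ LinearMap.lTensor X.M e.symm.toLinearMap =
      (Y.ρ ∘ₗ LinearMap.lTensor Y.M e.symm.toLinearMap) ∘ₗ LinearMap.rTensor _ f' := f.comm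
    refine ⟨⟨f', TensorProduct.ext' fun m v => ?_⟩, rfl⟩
    simpa using LinearMap.congr_fun hf (m ⊗ₜ e v)⟩
  essSurj := ⟨fun Z => by
    have h : S.IsModule Z.M (Z.ρ ∘ₗ LinearMap.lTensor Z.M e.toLinearMap) :=
      ⟨fun m a b => by simp [Z.isModule.assoc, he.map_mul],
        fun m => by simp [he.map_one, Z.isModule.unit]⟩
    let X : AlgMod S := ⟨Z.M, Z.ρ ∘ₗ LinearMap.lTensor Z.M e.toLinearMap, h⟩
    have hX : X.ρ ∘ₗ LinearMap.lTensor X.M e.symm.toLinearMap = Z.ρ :=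
      TensorProduct.ext' fun m v => by simp [X]
    exact ⟨X, AlgMod.nonempty_iso hX ((AlgMod.transport e he).obj X).isModule Z.isModule⟩⟩

end Regular

namespace AlgSystem

variable {k : Type u} [Field k]

theorem isEquivalence_permFunctor {r : ℕ} {S : AlgSystem k r} (hb : S.BijectiveBraiding)
    (θ : Equiv.Perm (Fin r))
    (h : ∀ X : BrMod S.toBraidedData,
      (S.perm θ).toBraidedData.IsModule X.M (fun i => X.ρ (θ⁻¹ i))) :
    (BrMod.permFunctor S θ h).IsEquivalence where
  faithful := ⟨fun {X Y f g} e => BrMod.Hom.ext (congrArg (fun q :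
    (BrMod.permFunctor S θ h).obj X ⟶ (BrMod.permFunctor S θ h).obj Y => BrMod.Hom.map q) e)⟩
  full := ⟨fun {X Y} f => by
    let f' : X.M →ₗ[k] Y.M := f.map
    have hf : ∀ i, f' ∘ₗ X.ρ (θ⁻¹ i) = Y.ρ (θ⁻¹ i) ∘ₗ LinearMap.rTensor _ f' := f.comm
    refine ⟨⟨f', fun i => ?_⟩, rfl⟩
    obtain ⟨j, rfl⟩ := θ⁻¹.surjective i
    exact hf j⟩
  essSurj := ⟨fun Z => by
    let P : Fin r → Type u := fun i => Z.M ⊗[k] S.V i →ₗ[k] Z.M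
    -- The family has to be reindexed along `θ`, but its types depend on the index. The dependent
    -- reindexing equivalence provides exactly the equation `hρ`.
    let ρ : ∀ i, P i := (Equiv.piCongrLeft' P θ).symm Z.ρ
    have hρ : ∀ i, ρ (θ⁻¹ i) = Z.ρ i := fun i =>
      congrFun ((Equiv.piCongrLeft' P θ).apply_symm_apply Z.ρ) i
    have hZ : (S.perm θ).toBraidedData.IsModule Z.M (fun i => ρ (θ⁻¹ i)) := by
      have e : (fun i => ρ (θ⁻¹ i)) = Z.ρ := funext hρ
      exact e ▸ Z.isModule
    let X : BrMod S.toBraidedData := ⟨Z.M, ρ, (isModule_perm_iff hb θ).1 hZ⟩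
    exact ⟨X, BrMod.nonempty_iso (S := (S.perm θ).toBraidedData) hρ (h X) Z.isModule⟩⟩

variable {S : AlgSystem k 4}

section Steps

variable {M : Type u} [AddCommGroup M] [Module k M] {ρ : ∀ i, M ⊗[k] S.V i →ₗ[k] M}

theorem actCompat_linInv (hb : S.BijectiveBraiding) (h : S.toBraidedData.IsModule M ρ)
    {i j : Fin 4} (hij : i < j) : ActCompat (linInv (S.σ i j hij.le)) (ρ i) (ρ j) := by
  obtain ⟨e, he, he'⟩ := exists_equiv_of_bijective (hb i j hij)
  have := (isModule_iff.1 h).2 i j hij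
  rw [he] at this
  rw [he']
  exact this.symm

theorem prodAct_assoc {A B C : Type u} [AddCommGroup A] [Module k A] [AddCommGroup B] [Module k B]
    [AddCommGroup C] [Module k C] (ρA : M ⊗[k] A →ₗ[k] M) (ρB : M ⊗[k] B →ₗ[k] M)
    (ρC : M ⊗[k] C →ₗ[k] M) (m : M) (t : A ⊗[k] B) (c : C) :
    prodAct ρA (prodAct ρB ρC) (m ⊗ₜ TensorProduct.assoc k A B C (t ⊗ₜ c)) =
      ρC (prodAct ρA ρB (m ⊗ₜ t) ⊗ₜ c) := by
  induction t using TensorProduct.induction_on with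
  | zero => simp
  | add x y hx hy => simp only [TensorProduct.tmul_add, TensorProduct.add_tmul, map_add, hx, hy]
  | tmul a b => simp

/-- The two exchanged actions commute up to the inverse braiding, so exchanging adjacent tensor
factors by it does not change the iterated action. -/
theorem prodAct_step0 (hb : S.BijectiveBraiding) (h : S.toBraidedData.IsModule M ρ) (m : M)
    (y : S.BTP) : prodAct (ρ 3) (prodAct (ρ 2) (prodAct (ρ 0) (ρ 1))) (m ⊗ₜ S.step0 y) =
      iterProd ρ (m ⊗ₜ y) := by
  have hc := actCompat_linInv hb h (i := 0) (j := 1) (by decide)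
  induction y using TensorProduct.induction_on with
  | zero => simp
  | add x y hx hy => simp only [TensorProduct.tmul_add, map_add, hx, hy]
  | tmul v₃ y =>
  induction y using TensorProduct.induction_on with
  | zero => simp
  | add x y hx hy => simp only [TensorProduct.tmul_add, map_add, hx, hy]
  | tmul v₂ y => simp [step0, iterProd, hc _ y]

theorem prodAct_step1 (hb : S.BijectiveBraiding) (h : S.toBraidedData.IsModule M ρ) (m : M)
    (y : S.BTP) : prodAct (ρ 3) (prodAct (ρ 1) (prodAct (ρ 2) (ρ 0))) (m ⊗ₜ S.step1 y) =
      iterProd ρ (m ⊗ₜ y) := by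
  have hc := actCompat_linInv hb h (i := 1) (j := 2) (by decide)
  induction y using TensorProduct.induction_on with
  | zero => simp
  | add x y hx hy => simp only [TensorProduct.tmul_add, map_add, hx, hy]
  | tmul v₃ y =>
  -- Rebracketing exposes the adjacent pair to which the inverse braiding is applied.
  obtain ⟨z, rfl⟩ := (TensorProduct.assoc k (S.V 2) (S.V 1) (S.V 0)).surjective y
  induction z using TensorProduct.induction_on with
  | zero => simp
  | add x y hx hy => simp only [TensorProduct.tmul_add, map_add, hx, hy]
  | tmul y v₀ =>
    simp only [step1, LinearMap.lTensor_tmul, LinearMap.comp_apply, LinearEquiv.coe_coe,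
      LinearEquiv.symm_apply_apply, LinearMap.rTensor_tmul, prodAct_tmul, prodAct_assoc, iterProd,
      hc _ y]

theorem prodAct_step2 (hb : S.BijectiveBraiding) (h : S.toBraidedData.IsModule M ρ) (m : M)
    (y : S.BTP) : prodAct (ρ 2) (prodAct (ρ 3) (prodAct (ρ 1) (ρ 0))) (m ⊗ₜ S.step2 y) =
      iterProd ρ (m ⊗ₜ y) := by
  have hc := actCompat_linInv hb h (i := 2) (j := 3) (by decide)
  obtain ⟨z, rfl⟩ := (TensorProduct.assoc k (S.V 3) (S.V 2) (S.V 1 ⊗[k] S.V 0)).surjective y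
  induction z using TensorProduct.induction_on with
  | zero => simp
  | add x y hx hy => simp only [TensorProduct.tmul_add, map_add, hx, hy]
  | tmul y v₀ =>
    simp only [step2, LinearMap.comp_apply, LinearEquiv.coe_coe,
      LinearEquiv.symm_apply_apply, LinearMap.rTensor_tmul, prodAct_assoc, iterProd, hc _ y]

end Steps

/-! ### The comparison of the braided tensor products -/

/-- The iterated action of the braided tensor product of a component permutation. -/
def permIterProd (S : AlgSystem k 4) (θ : Equiv.Perm (Fin 4)) {M : Type u} [AddCommGroup M]
    [Module k M] (ρ : ∀ i, M ⊗[k] S.V i →ₗ[k] M) : M ⊗[k] (S.perm θ).BTP →ₗ[k] M :=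
  iterProd (S := S.perm θ) fun i => ρ (θ⁻¹ i)

/-- The map `v₄ ⊗ v₃ ⊗ v₂ ⊗ v₁ ↦ v₄ v₃ v₂ v₁` from the braided tensor product of a component
permutation. -/
def fromPerm (S : AlgSystem k 4) (θ : Equiv.Perm (Fin 4)) : (S.perm θ).BTP →ₗ[k] S.BTP :=
  S.permIterProd θ (restr S.btp.mul) ∘ₗ TensorProduct.mk k S.BTP (S.perm θ).BTP S.btp.one

theorem iterProd_incl {M : Type u} [AddCommGroup M] [Module k M]
    {ρ : ∀ i, M ⊗[k] S.V i →ₗ[k] M} (h : S.toBraidedData.IsModule M ρ) (i : Fin 4) (m : M)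
    (v : S.V i) : iterProd ρ (m ⊗ₜ S.incl i v) = ρ i (m ⊗ₜ v) := by
  rw [← restr_tmul, restr_iterProd h.unit]

/-- Acting by the letters of a permuted word one after the other is acting by their product in the
braided tensor product, because `M` is a module over that algebra. -/
theorem permIterProd_eq (θ : Equiv.Perm (Fin 4)) {M : Type u}
    [AddCommGroup M] [Module k M] {ρ : ∀ i, M ⊗[k] S.V i →ₗ[k] M}
    (h : S.toBraidedData.IsModule M ρ) (m : M) (y : (S.perm θ).BTP) :
    S.permIterProd θ ρ (m ⊗ₜ y) = iterProd ρ (m ⊗ₜ S.fromPerm θ y) := by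
  have hm := isModule_iterProd h
  have key : S.permIterProd θ ρ = iterProd ρ ∘ₗ LinearMap.lTensor M (S.fromPerm θ) := by
    have h1 : ∀ (m : M) (x : S.BTP) (i : Fin 4) (v : S.V i),
        iterProd ρ (m ⊗ₜ restr S.btp.mul i (x ⊗ₜ v)) = ρ i (iterProd ρ (m ⊗ₜ x) ⊗ₜ v) := by
      intro m x i v
      rw [restr_tmul, ← hm.assoc, iterProd_incl h]
    have h2 : ∀ (m : M) (v₃ : S.V (θ⁻¹ 3)) (v₂ : S.V (θ⁻¹ 2)) (v₁ : S.V (θ⁻¹ 1))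
        (v₀ : S.V (θ⁻¹ 0)), iterProd ρ (m ⊗ₜ restr S.btp.mul (θ⁻¹ 0) (restr S.btp.mul (θ⁻¹ 1)
          (restr S.btp.mul (θ⁻¹ 2) (restr S.btp.mul (θ⁻¹ 3) (S.btp.one ⊗ₜ v₃) ⊗ₜ v₂) ⊗ₜ v₁) ⊗ₜ
            v₀)) =
        ρ (θ⁻¹ 0) (ρ (θ⁻¹ 1) (ρ (θ⁻¹ 2) (ρ (θ⁻¹ 3) (m ⊗ₜ v₃) ⊗ₜ v₂) ⊗ₜ v₁) ⊗ₜ v₀) := by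
      intro m v₃ v₂ v₁ v₀
      rw [h1, h1, h1, h1, hm.unit]
    refine TensorProduct.ext (LinearMap.ext fun m => ?_)
    refine TensorProduct.ext (LinearMap.ext fun v₃ => TensorProduct.ext (LinearMap.ext fun v₂ =>
      TensorProduct.ext' fun v₁ v₀ => ?_))
    refine (iterProd_tmul (S := S.perm θ) (fun i => ρ (θ⁻¹ i)) m v₃ v₂ v₁ v₀).trans
      ((h2 m v₃ v₂ v₁ v₀).symm.trans (congrArg (fun x => iterProd ρ (m ⊗ₜ x)) ?_))
    exact (iterProd_tmul (S := S.perm θ) (fun i => restr S.btp.mul (θ⁻¹ i)) S.btp.one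
      v₃ v₂ v₁ v₀).symm
  rw [key, LinearMap.comp_apply, LinearMap.lTensor_tmul]

section Comparison

theorem isModule_restr_mul (hS : S.IsSystemOfUAAs) :
    S.toBraidedData.IsModule S.BTP (restr S.btp.mul) ∧ iterProd (restr S.btp.mul) = S.btp.mul :=
  isModule_restr hS hS.isUAA_btp.isModule

theorem permIterProd_mul (hS : S.IsSystemOfUAAs) (θ : Equiv.Perm (Fin 4))
    (x : S.BTP) (y : (S.perm θ).BTP) :
    S.permIterProd θ (restr S.btp.mul) (x ⊗ₜ y) = S.btp.mul (x ⊗ₜ S.fromPerm θ y) := by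
  obtain ⟨h1, h2⟩ := isModule_restr_mul hS
  rw [permIterProd_eq θ h1, h2]

theorem fromPerm_incl (hS : S.IsSystemOfUAAs) (θ : Equiv.Perm (Fin 4)) (i : Fin 4)
    (v : S.V (θ⁻¹ i)) :
    S.fromPerm θ ((S.perm θ).incl i v) = S.incl (θ⁻¹ i) v := by
  obtain ⟨h1, h2⟩ := isModule_restr_mul hS
  have h := restr_iterProd (S := S.perm θ) (ρ := fun i => restr S.btp.mul (θ⁻¹ i))
    (fun i m => h1.unit (θ⁻¹ i) m) i
  refine (LinearMap.congr_fun h (S.btp.one ⊗ₜ v)).trans ?_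
  exact (restr_tmul _ _ _ _).trans (hS.isUAA_btp.one_mul _)

theorem fromPerm_one (hS : S.IsSystemOfUAAs) (θ : Equiv.Perm (Fin 4)) :
    S.fromPerm θ (S.perm θ).btp.one = S.btp.one := by
  have h := fromPerm_incl hS θ 0 (S.unit (θ⁻¹ 0))
  have h1 : ∀ i, S.incl i (S.unit i) = S.btp.one := forall_fin_four rfl rfl rfl rfl
  exact h.trans (h1 _)

theorem isModule_permIterProd (hb : S.BijectiveBraiding) (θ : Equiv.Perm (Fin 4))
    {M : Type u} [AddCommGroup M] [Module k M]
    {ρ : ∀ i, M ⊗[k] S.V i →ₗ[k] M} (h : S.toBraidedData.IsModule M ρ) :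
    (S.perm θ).btp.IsModule M (S.permIterProd θ ρ) :=
  isModule_iterProd (S := S.perm θ) ((isModule_perm_iff hb θ).2 h)

/-- The regular module of the braided tensor product is also a module over the permuted product.
Associativity of this action at the element `1` is the claim. -/
theorem fromPerm_mul (hS : S.IsSystemOfUAAs) (hb : S.BijectiveBraiding)
    (θ : Equiv.Perm (Fin 4)) (x y : (S.perm θ).BTP) :
    S.fromPerm θ ((S.perm θ).btp.mul (x ⊗ₜ y)) =
      S.btp.mul (S.fromPerm θ x ⊗ₜ S.fromPerm θ y) := by
  have h := isModule_permIterProd hb θ (isModule_restr_mul hS).1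
  rw [← permIterProd_mul hS]
  exact (h.assoc S.btp.one x y).symm

/-- The range is closed under multiplication and contains the images of all four components, whose
ordered products span the target. Surjectivity and equality of dimensions then give bijectivity. -/
theorem fromPerm_bijective (hS : S.IsSystemOfUAAs) (hb : S.BijectiveBraiding)
    (θ : Equiv.Perm (Fin 4)) : Function.Bijective (S.fromPerm θ) := by
  obtain ⟨-, h2⟩ := isModule_restr_mul hS
  have hincl : ∀ i (v : S.V i), S.incl i v ∈ LinearMap.range (S.fromPerm θ) := by
    intro i v
    obtain ⟨j, rfl⟩ := θ⁻¹.surjective i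
    exact ⟨_, fromPerm_incl hS θ j v⟩
  have hmul : ∀ x y, x ∈ LinearMap.range (S.fromPerm θ) → y ∈ LinearMap.range (S.fromPerm θ) →
      S.btp.mul (x ⊗ₜ y) ∈ LinearMap.range (S.fromPerm θ) := by
    rintro _ _ ⟨x, rfl⟩ ⟨y, rfl⟩
    exact ⟨_, fromPerm_mul hS hb θ x y⟩
  have hsurj : Function.Surjective (S.fromPerm θ) := by
    intro x
    change x ∈ LinearMap.range (S.fromPerm θ)
    induction x using TensorProduct.induction_on with
    | zero => exact zero_mem _
    | add x y hx hy => exact add_mem hx hy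
    | tmul v₃ x =>
    induction x using TensorProduct.induction_on with
    | zero => rw [TensorProduct.tmul_zero]; exact zero_mem _
    | add x y hx hy => rw [TensorProduct.tmul_add]; exact add_mem hx hy
    | tmul v₂ x =>
    induction x using TensorProduct.induction_on with
    | zero => rw [TensorProduct.tmul_zero, TensorProduct.tmul_zero]; exact zero_mem _
    | add x y hx hy => rw [TensorProduct.tmul_add, TensorProduct.tmul_add]; exact add_mem hx hy
    | tmul v₁ v₀ =>
      rw [← hS.isUAA_btp.one_mul (v₃ ⊗ₜ (v₂ ⊗ₜ (v₁ ⊗ₜ v₀))), ← h2, iterProd_tmul]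
      simp only [restr_tmul, hS.isUAA_btp.one_mul]
      exact hmul _ _ (hmul _ _ (hmul _ _ (hincl _ _) (hincl _ _)) (hincl _ _)) (hincl _ _)
  -- The dimension of either side is the product of the four component dimensions, up to the order
  -- of the factors.
  have hrank : Module.finrank k (S.perm θ).BTP = Module.finrank k S.BTP := by
    have h := Equiv.prod_comp θ⁻¹ fun i => Module.finrank k (S.V i)
    rw [Fin.prod_univ_four, Fin.prod_univ_four] at h
    have e : ∀ T : AlgSystem k 4, Module.finrank k T.BTP = Module.finrank k (T.V 0) *
        Module.finrank k (T.V 1) * Module.finrank k (T.V 2) * Module.finrank k (T.V 3) := by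
      intro T
      rw [Module.finrank_tensorProduct, Module.finrank_tensorProduct, Module.finrank_tensorProduct]
      ring
    rw [e, e, ← h]
    rfl
  exact ⟨(LinearMap.injective_iff_surjective_of_finrank_eq_finrank hrank).2 hsurj, hsurj⟩

/-- The isomorphism from the braided tensor product of `S` to that of `θ S`. -/
def toPerm (hS : S.IsSystemOfUAAs) (hb : S.BijectiveBraiding) (θ : Equiv.Perm (Fin 4)) :
    S.BTP ≃ₗ[k] (S.perm θ).BTP :=
  (LinearEquiv.ofBijective (S.fromPerm θ) (fromPerm_bijective hS hb θ)).symm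

theorem toPerm_symm_apply (hS : S.IsSystemOfUAAs) (hb : S.BijectiveBraiding)
    (θ : Equiv.Perm (Fin 4)) (y : (S.perm θ).BTP) : (toPerm hS hb θ).symm y = S.fromPerm θ y := rfl

theorem toPerm_eq_iff (hS : S.IsSystemOfUAAs) (hb : S.BijectiveBraiding)
    (θ : Equiv.Perm (Fin 4)) (x : S.BTP) (y : (S.perm θ).BTP) :
    toPerm hS hb θ x = y ↔ x = S.fromPerm θ y := by
  rw [← toPerm_symm_apply hS hb, LinearEquiv.eq_symm_apply]

theorem fromPerm_toPerm (hS : S.IsSystemOfUAAs) (hb : S.BijectiveBraiding)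
    (θ : Equiv.Perm (Fin 4)) (x : S.BTP) : S.fromPerm θ (toPerm hS hb θ x) = x :=
  ((toPerm_eq_iff hS hb θ x _).1 rfl).symm

theorem isAlgIso_toPerm (hS : S.IsSystemOfUAAs) (hb : S.BijectiveBraiding)
    (θ : Equiv.Perm (Fin 4)) : IsAlgIso S.btp (S.perm θ).btp (toPerm hS hb θ) where
  map_mul x y := by
    rw [toPerm_eq_iff, fromPerm_mul hS hb, fromPerm_toPerm, fromPerm_toPerm]
  map_one := by
    rw [toPerm_eq_iff, fromPerm_one hS]

/-- As `toPerm` is defined without choosing a decomposition, no braid relations have to be checked.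
It only remains to see that each adjacent exchange is compatible with multiplication into the
original algebra. -/
theorem isPermFamily_toPerm (hS : S.IsSystemOfUAAs) (hb : S.BijectiveBraiding) :
    S.IsPermFamily (toPerm hS hb) where
  one x := by
    refine (toPerm_eq_iff hS hb 1 x x).2 ?_
    obtain ⟨-, h2⟩ := isModule_restr_mul hS
    have : S.fromPerm 1 x = iterProd (restr S.btp.mul) (S.btp.one ⊗ₜ x) := rfl
    rw [this, h2, hS.isUAA_btp.one_mul]
  swap01 θ _ x := by
    refine (toPerm_eq_iff hS hb _ x _).2 ?_
    -- On the regular module at `1`, invariance of the iterated action says that `fromPerm` for `s_p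
    -- θ` after the exchange is `fromPerm` for `θ`. The reordered actions match because `(s_p θ)⁻¹`
    -- computes on the four indices.
    have h := prodAct_step0 (hb.perm θ) ((isModule_perm_iff hb θ).2 (isModule_restr_mul hS).1)
      S.btp.one (toPerm hS hb θ x)
    exact (fromPerm_toPerm hS hb θ x).symm.trans h.symm
  swap12 θ _ x := by
    refine (toPerm_eq_iff hS hb _ x _).2 ?_
    have h := prodAct_step1 (hb.perm θ) ((isModule_perm_iff hb θ).2 (isModule_restr_mul hS).1)
      S.btp.one (toPerm hS hb θ x)
    exact (fromPerm_toPerm hS hb θ x).symm.trans h.symm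
  swap23 θ _ x := by
    refine (toPerm_eq_iff hS hb _ x _).2 ?_
    have h := prodAct_step2 (hb.perm θ) ((isModule_perm_iff hb θ).2 (isModule_restr_mul hS).1)
      S.btp.one (toPerm hS hb θ x)
    exact (fromPerm_toPerm hS hb θ x).symm.trans h.symm

theorem iterAct_perm (hS : S.IsSystemOfUAAs) (hb : S.BijectiveBraiding)
    (θ : Equiv.Perm (Fin 4)) (X : BrMod S.toBraidedData)
    (h' : (S.perm θ).toBraidedData.IsModule X.M (fun i => X.ρ (θ⁻¹ i))) :
    BrMod.iterAct (S := S.perm θ) { M := X.M, ρ := fun i => X.ρ (θ⁻¹ i), isModule := h' } =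
      X.iterAct ∘ₗ LinearMap.lTensor X.M (toPerm hS hb θ).symm.toLinearMap := by
  refine (iterAct_eq (S := S.perm θ) ⟨X.M, fun i => X.ρ (θ⁻¹ i), h'⟩).trans ?_
  refine TensorProduct.ext' fun m y => ?_
  refine (permIterProd_eq θ X.isModule m y).trans ?_
  rw [LinearMap.comp_apply, LinearMap.lTensor_tmul, iterAct_eq]
  rfl

end Comparison

end AlgSystem

/-! ### The braidings of a bialgebra and its dual -/

section Bialg

variable {k : Type u} [Field k] {A B : Type u} [AddCommGroup A] [Module k A]
  [AddCommGroup B] [Module k B]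

/-- The axioms of a bialgebra. -/
structure BialgStr.IsBialgebra (S : BialgStr k A) : Prop where
  isUAA : S.toAlgStr.IsUAA
  coassoc : ∀ a, TensorProduct.assoc k A A A (LinearMap.rTensor A S.comul (S.comul a)) =
    LinearMap.lTensor A S.comul (S.comul a)
  counit_left : ∀ a, TensorProduct.lid k A (LinearMap.rTensor A S.counit (S.comul a)) = a
  counit_right : ∀ a, TensorProduct.rid k A (LinearMap.lTensor A S.counit (S.comul a)) = a
  comul_mul : ∀ a b, S.comul (S.mul (a ⊗ₜ b)) =
    (S.toAlgStr.tensor S.toAlgStr).mul (S.comul a ⊗ₜ S.comul b)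
  comul_one : S.comul S.one = S.one ⊗ₜ S.one
  counit_mul : ∀ a b, S.counit (S.mul (a ⊗ₜ b)) = S.counit a * S.counit b
  counit_one : S.counit S.one = 1

theorem AlgStr.op_mul_tmul (S : AlgStr k A) (a b : A) : S.op.mul (a ⊗ₜ b) = S.mul (b ⊗ₜ a) := rfl

theorem AlgStr.tensor_mul_tmul (S : AlgStr k A) (T : AlgStr k B) (a a' : A) (b b' : B) :
    (S.tensor T).mul ((a ⊗ₜ b) ⊗ₜ (a' ⊗ₜ b')) = S.mul (a ⊗ₜ a') ⊗ₜ T.mul (b ⊗ₜ b') := rfl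

theorem AlgStr.IsUAA.op {S : AlgStr k A} (h : S.IsUAA) : S.op.IsUAA where
  mul_assoc x y z := (h.mul_assoc z y x).symm
  one_mul := h.mul_one
  mul_one := h.one_mul

/-- Stating the axioms for structure maps keeps `H`, `H^op`, `H^cop` and `H^{op,cop}` on one space,
so that every result on `σ_bi` yields four. -/
theorem BialgStr.isBialgebra_of (H : Type u) [Ring H] [Bialgebra k H] :
    (BialgStr.of k H).IsBialgebra where
  isUAA := ⟨fun x y z => by simp [BialgStr.of, mul_assoc], fun x => by simp [BialgStr.of],
    fun x => by simp [BialgStr.of]⟩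
  coassoc := Coalgebra.coassoc_apply
  counit_left a := by simp [BialgStr.of]
  counit_right a := by simp [BialgStr.of]
  comul_mul a b := by
    change Coalgebra.comul (a * b) = _
    rw [Bialgebra.comul_mul]
    change _ = ((BialgStr.of k H).toAlgStr.tensor (BialgStr.of k H).toAlgStr).mul
      ((Coalgebra.comul a : H ⊗[k] H) ⊗ₜ (Coalgebra.comul b : H ⊗[k] H))
    generalize (Coalgebra.comul a : H ⊗[k] H) = s
    generalize (Coalgebra.comul b : H ⊗[k] H) = t
    induction s using TensorProduct.induction_on with
    | zero => simp
    | add x y hx hy => simp only [TensorProduct.add_tmul, map_add, add_mul, hx, hy]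
    | tmul p q =>
    induction t using TensorProduct.induction_on with
    | zero => simp
    | add x y hx hy => simp only [TensorProduct.tmul_add, map_add, mul_add, hx, hy]
    | tmul u v => simp [AlgStr.tensor_mul_tmul, BialgStr.of]
  comul_one := by simp [BialgStr.of, Algebra.TensorProduct.one_def]
  counit_mul a b := by simp [BialgStr.of]
  counit_one := by simp [BialgStr.of]

theorem BialgStr.IsBialgebra.op {S : BialgStr k A} (h : S.IsBialgebra) : S.op.IsBialgebra where
  isUAA := h.isUAA.op
  coassoc := h.coassoc
  counit_left := h.counit_left
  counit_right := h.counit_right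
  comul_mul a b := by
    refine (h.comul_mul b a).trans ?_
    change _ = (S.toAlgStr.op.tensor S.toAlgStr.op).mul (S.comul a ⊗ₜ S.comul b)
    generalize S.comul a = s
    generalize S.comul b = t
    induction s using TensorProduct.induction_on with
    | zero => simp
    | add x y hx hy => simp only [TensorProduct.add_tmul, TensorProduct.tmul_add, map_add, hx, hy]
    | tmul p q =>
    induction t using TensorProduct.induction_on with
    | zero => simp
    | add x y hx hy => simp only [TensorProduct.add_tmul, TensorProduct.tmul_add, map_add, hx, hy]
    | tmul u v => simp [AlgStr.tensor_mul_tmul, AlgStr.op_mul_tmul]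
  comul_one := h.comul_one
  counit_mul a b := (h.counit_mul b a).trans (mul_comm _ _)
  counit_one := h.counit_one

theorem BialgStr.IsBialgebra.cop {S : BialgStr k A} (h : S.IsBialgebra) : S.cop.IsBialgebra where
  isUAA := h.isUAA
  coassoc a := by
    -- `R` reverses the three tensor factors and thereby interchanges the two sides of
    -- coassociativity.
    let R : A ⊗[k] (A ⊗[k] A) →ₗ[k] A ⊗[k] (A ⊗[k] A) :=
      (TensorProduct.assoc k A A A).toLinearMap ∘ₗ
        LinearMap.rTensor A (TensorProduct.comm k A A).toLinearMap ∘ₗ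
        (TensorProduct.comm k A (A ⊗[k] A)).toLinearMap
    have h1 : ∀ t : A ⊗[k] A, TensorProduct.assoc k A A A (LinearMap.rTensor A S.cop.comul
        (TensorProduct.comm k A A t)) = R (LinearMap.lTensor A S.comul t) := by
      intro t
      induction t using TensorProduct.induction_on with
      | zero => simp
      | add x y hx hy => simp only [map_add, hx, hy]
      | tmul p q => simp [R, BialgStr.cop]
    have h2 : ∀ t : A ⊗[k] A, LinearMap.lTensor A S.cop.comul (TensorProduct.comm k A A t) =
        R (TensorProduct.assoc k A A A (LinearMap.rTensor A S.comul t)) := by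
      intro t
      induction t using TensorProduct.induction_on with
      | zero => simp
      | add x y hx hy => simp only [map_add, hx, hy]
      | tmul p q =>
        simp only [TensorProduct.comm_tmul, LinearMap.lTensor_tmul, LinearMap.rTensor_tmul,
          BialgStr.cop, LinearMap.comp_apply, LinearEquiv.coe_coe]
        generalize S.comul p = t
        induction t using TensorProduct.induction_on with
        | zero => simp
        | add x y hx hy =>
          simp only [TensorProduct.tmul_add, TensorProduct.add_tmul, map_add, hx, hy]
        | tmul u v => simp [R]
    exact (h1 _).trans ((congrArg R (h.coassoc a).symm).trans (h2 _).symm)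
  counit_left a := by
    refine Eq.trans ?_ (h.counit_right a)
    change TensorProduct.lid k A (LinearMap.rTensor A S.counit
      (TensorProduct.comm k A A (S.comul a))) = _
    generalize S.comul a = t
    induction t using TensorProduct.induction_on with
    | zero => simp
    | add x y hx hy => simp only [map_add, hx, hy]
    | tmul p q => simp
  counit_right a := by
    refine Eq.trans ?_ (h.counit_left a)
    change TensorProduct.rid k A (LinearMap.lTensor A S.counit
      (TensorProduct.comm k A A (S.comul a))) = _
    generalize S.comul a = t
    induction t using TensorProduct.induction_on with
    | zero => simp
    | add x y hx hy => simp only [map_add, hx, hy]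
    | tmul p q => simp
  comul_mul a b := by
    change TensorProduct.comm k A A (S.comul (S.mul (a ⊗ₜ b))) =
      (S.toAlgStr.tensor S.toAlgStr).mul
        (TensorProduct.comm k A A (S.comul a) ⊗ₜ TensorProduct.comm k A A (S.comul b))
    rw [h.comul_mul]
    generalize S.comul a = s
    generalize S.comul b = t
    induction s using TensorProduct.induction_on with
    | zero => simp
    | add x y hx hy => simp only [TensorProduct.add_tmul, TensorProduct.tmul_add, map_add, hx, hy]
    | tmul p q =>
    induction t using TensorProduct.induction_on with
    | zero => simp
    | add x y hx hy => simp only [TensorProduct.add_tmul, TensorProduct.tmul_add, map_add, hx, hy]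
    | tmul u v => simp [AlgStr.tensor_mul_tmul, AlgStr.op_mul_tmul]
  comul_one := by
    change TensorProduct.comm k A A (S.comul S.one) = _
    rw [h.comul_one]; rfl
  counit_mul := h.counit_mul
  counit_one := h.counit_one

/-- `l ↦ y ↦ l(- y)`. -/
def AlgStr.shift (S : AlgStr k A) : Module.Dual k A →ₗ[k] A →ₗ[k] Module.Dual k A :=
  LinearMap.mk₂ k (fun l y => l ∘ₗ S.mul ∘ₗ (TensorProduct.mk k A A).flip y)
    (by intros; ext; simp) (by intros; ext; simp) (by intros; ext; simp) (by intros; ext; simp)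

@[simp]
theorem AlgStr.shift_apply (S : AlgStr k A) (l : Module.Dual k A) (y x : A) :
    S.shift l y x = l (S.mul (x ⊗ₜ y)) := rfl

theorem AlgStr.IsUAA.shift_shift {S : AlgStr k A} (h : S.IsUAA) (l : Module.Dual k A) (y z : A) :
    S.shift (S.shift l y) z = S.shift l (S.mul (z ⊗ₜ y)) := by
  ext x; simp [h.mul_assoc]

/-- Left and right translations of functionals commute. This is the source of Yang-Baxter for `H`,
`H^op` and a dual. -/
theorem AlgStr.IsUAA.shift_op_shift {S : AlgStr k A} (h : S.IsUAA) (l : Module.Dual k A)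
    (y z : A) : S.shift (S.op.shift l y) z = S.op.shift (S.shift l z) y := by
  ext x; simp [AlgStr.op_mul_tmul, h.mul_assoc]

theorem AlgStr.IsUAA.shift_one {S : AlgStr k A} (h : S.IsUAA) (l : Module.Dual k A) :
    S.shift l S.one = l := by
  ext x; simp [h.mul_one]

theorem isTwist_comm (S : AlgStr k A) (T : AlgStr k B) :
    IsTwist S T (TensorProduct.comm k B A).toLinearMap where
  one_left _ := rfl
  one_right _ := rfl
  mul_left _ _ _ := rfl
  mul_right _ _ _ := rfl

variable [Module.Finite k A]

/-- By the pairing convention `⟨l, x y⟩ = ⟨l₍₁₎, y⟩ ⟨l₍₂₎, x⟩`, the element `⟨l₍₁₎, a₍₂₎⟩ l₍₂₎` is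
the translate `l(- a₍₂₎)`. The comultiplication of the dual thus disappears from all further
computations. -/
theorem BialgStr.sigmaBi_tmul (S : BialgStr k A) (a : A) (l : Module.Dual k A) :
    S.sigmaBi (a ⊗ₜ l) =
      TensorProduct.comm k A _ (LinearMap.lTensor A (S.shift l) (S.comul a)) := by
  have h1 : ∀ (w : Module.Dual k A ⊗[k] Module.Dual k A) (q x : A),
      TensorProduct.lid k (Module.Dual k A) (LinearMap.rTensor (Module.Dual k A) (contractRight k A)
        ((TensorProduct.assoc k A _ _).symm (q ⊗ₜ TensorProduct.comm k _ _ w))) x =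
      TensorProduct.dualDistrib k A A w (x ⊗ₜ q) := by
    intro w q x
    induction w using TensorProduct.induction_on with
    | zero => simp
    | add x y hx hy => simp only [TensorProduct.tmul_add, map_add, LinearMap.add_apply, hx, hy]
    | tmul l m => simp [mul_comm]
  have h2 : ∀ q, TensorProduct.lid k (Module.Dual k A) (LinearMap.rTensor (Module.Dual k A)
      (contractRight k A) ((TensorProduct.assoc k A _ _).symm (q ⊗ₜ S.dual.comul l))) =
      S.shift l q := by
    intro q
    ext x
    have h3 : TensorProduct.dualDistrib k A A
        ((TensorProduct.dualDistribEquiv k A A).symm (S.mul.dualMap l)) = S.mul.dualMap l :=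
      (TensorProduct.dualDistribEquiv k A A).apply_symm_apply _
    exact (h1 _ q x).trans (LinearMap.congr_fun h3 (x ⊗ₜ q))
  simp only [sigmaBi, LinearMap.comp_apply, TensorProduct.map_tmul, LinearEquiv.coe_coe]
  generalize S.comul a = t
  induction t using TensorProduct.induction_on with
  | zero => simp
  | add x y hx hy => simp only [TensorProduct.add_tmul, map_add, hx, hy]
  | tmul p q => simp [h2]

theorem BialgStr.dual_mul_tmul_apply (S : BialgStr k A) (l m : Module.Dual k A) (a : A) :
    S.dual.mul (l ⊗ₜ m) a = TensorProduct.dualDistrib k A A (m ⊗ₜ l) (S.comul a) := rfl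

theorem BialgStr.IsBialgebra.isUAA_dual {S : BialgStr k A} (h : S.IsBialgebra) :
    S.dual.toAlgStr.IsUAA where
  mul_assoc x y z := by
    ext a
    -- Both sides evaluate at `a` to `z(a₍₁₎) y(a₍₂₎) x(a₍₃₎)`; the order is reversed by the
    -- convention for the dual product.
    let F : A ⊗[k] (A ⊗[k] A) →ₗ[k] k := LinearMap.mul' k k ∘ₗ TensorProduct.map z
      (LinearMap.mul' k k ∘ₗ TensorProduct.map y x)
    trans F (LinearMap.lTensor A S.comul (S.comul a))
    · rw [dual_mul_tmul_apply]
      generalize S.comul a = t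
      induction t using TensorProduct.induction_on with
      | zero => simp
      | add x y hx hy => simp only [map_add, hx, hy]
      | tmul p q =>
        simp only [TensorProduct.dualDistrib_apply, dual_mul_tmul_apply, LinearMap.lTensor_tmul]
        generalize S.comul q = t
        induction t using TensorProduct.induction_on with
        | zero => simp
        | add x y hx hy => simp only [TensorProduct.tmul_add, map_add, mul_add, hx, hy]
        | tmul p q => simp [F]
    · rw [← h.coassoc, dual_mul_tmul_apply]
      generalize S.comul a = t
      induction t using TensorProduct.induction_on with
      | zero => simp
      | add x y hx hy => simp only [map_add, hx, hy]
      | tmul p q =>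
        simp only [TensorProduct.dualDistrib_apply, dual_mul_tmul_apply, LinearMap.rTensor_tmul]
        generalize S.comul p = t
        induction t using TensorProduct.induction_on with
        | zero => simp
        | add x y hx hy => simp only [TensorProduct.add_tmul, map_add, add_mul, hx, hy]
        | tmul p q => simp [F, mul_assoc]
  one_mul x := by
    ext a
    refine Eq.trans ?_ (congrArg x (h.counit_right a))
    change TensorProduct.dualDistrib k A A (x ⊗ₜ S.counit) (S.comul a) = _
    generalize S.comul a = t
    induction t using TensorProduct.induction_on with
    | zero => simp
    | add x y hx hy => simp only [map_add, hx, hy]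
    | tmul p q => simp [mul_comm]
  mul_one x := by
    ext a
    refine Eq.trans ?_ (congrArg x (h.counit_left a))
    change TensorProduct.dualDistrib k A A (S.counit ⊗ₜ x) (S.comul a) = _
    generalize S.comul a = t
    induction t using TensorProduct.induction_on with
    | zero => simp
    | add x y hx hy => simp only [map_add, hx, hy]
    | tmul p q => simp [mul_comm]

/-- Evaluating at `x` and expanding `Δ(x y) = Δ(x) Δ(y)` gives `(l m)(- y) = l(- y₍₂₎) m(- y₍₁₎)`.
-/
theorem BialgStr.IsBialgebra.shift_dual_mul {S : BialgStr k A} (h : S.IsBialgebra)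
    (l m : Module.Dual k A) (y : A) : S.shift (S.dual.mul (l ⊗ₜ m)) y =
      S.dual.mul (TensorProduct.comm k _ _
        (TensorProduct.map (S.shift m) (S.shift l) (S.comul y))) := by
  ext x
  rw [AlgStr.shift_apply, dual_mul_tmul_apply, h.comul_mul]
  generalize S.comul y = t
  induction t using TensorProduct.induction_on with
  | zero => simp
  | add x y hx hy => simp only [TensorProduct.tmul_add, map_add, LinearMap.add_apply, hx, hy]
  | tmul p q =>
    rw [TensorProduct.map_tmul, TensorProduct.comm_tmul, dual_mul_tmul_apply]
    generalize S.comul x = t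
    induction t using TensorProduct.induction_on with
    | zero => simp
    | add x y hx hy => simp only [TensorProduct.add_tmul, map_add, LinearMap.add_apply, hx, hy]
    | tmul u v => simp [AlgStr.tensor_mul_tmul]

/-- The unit conditions express `Δ(1) = 1 ⊗ 1` and the multiplicativity of `ε`. Multiplicativity in
`A` uses that of `Δ`; multiplicativity in the dual uses coassociativity and `shift_dual_mul`. -/
theorem BialgStr.IsBialgebra.isTwist_sigmaBi {S : BialgStr k A} (h : S.IsBialgebra) :
    IsTwist S.dual.toAlgStr S.toAlgStr S.sigmaBi where
  one_left l := by
    simp [sigmaBi_tmul, h.comul_one, h.isUAA.shift_one]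
  one_right a := by
    have e : ∀ y, S.shift S.counit y = S.counit y • S.counit := fun y => by
      ext x; simp [h.counit_mul, mul_comm]
    change S.sigmaBi (a ⊗ₜ S.counit) = S.counit ⊗ₜ a
    rw [sigmaBi_tmul]
    conv_rhs => rw [← h.counit_right a]
    generalize S.comul a = t
    induction t using TensorProduct.induction_on with
    | zero => simp
    | add x y hx hy => simp only [TensorProduct.tmul_add, map_add, hx, hy]
    | tmul p q => simp [e, TensorProduct.smul_tmul]
  mul_left a b l := by
    rw [sigmaBi_tmul, sigmaBi_tmul, h.comul_mul]
    generalize S.comul b = t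
    induction t using TensorProduct.induction_on with
    | zero => simp
    | add x y hx hy => simp only [TensorProduct.tmul_add, map_add, hx, hy]
    | tmul u v =>
      simp only [LinearMap.lTensor_tmul, TensorProduct.comm_tmul, TensorProduct.assoc_symm_tmul,
        LinearMap.rTensor_tmul, sigmaBi_tmul]
      generalize S.comul a = t
      induction t using TensorProduct.induction_on with
      | zero => simp
      | add x y hx hy => simp only [TensorProduct.add_tmul, map_add, hx, hy]
      | tmul p q => simp [AlgStr.tensor_mul_tmul, h.isUAA.shift_shift]
  mul_right a l m := by
    have e : S.shift (S.dual.mul (l ⊗ₜ m)) = S.dual.mul ∘ₗ (TensorProduct.comm k _ _).toLinearMap ∘ₗ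
        TensorProduct.map (S.shift m) (S.shift l) ∘ₗ S.comul :=
      LinearMap.ext fun y => h.shift_dual_mul l m y
    rw [sigmaBi_tmul, sigmaBi_tmul, e, ← LinearMap.comp_assoc, ← LinearMap.comp_assoc,
      LinearMap.lTensor_comp, LinearMap.comp_apply, ← h.coassoc]
    generalize S.comul a = t
    induction t using TensorProduct.induction_on with
    | zero => simp
    | add x y hx hy => simp only [TensorProduct.add_tmul, map_add, hx, hy]
    | tmul p q =>
      simp only [LinearMap.lTensor_tmul, TensorProduct.comm_tmul, TensorProduct.assoc_tmul,
        LinearMap.rTensor_tmul, sigmaBi_tmul]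
      generalize S.comul p = t
      induction t using TensorProduct.induction_on with
      | zero => simp
      | add x y hx hy => simp only [TensorProduct.add_tmul, TensorProduct.tmul_add, map_add, hx, hy]
      | tmul u v => simp

theorem BialgStr.IsBialgebra.yangBaxter_op {S : BialgStr k A} (h : S.IsBialgebra) :
    YangBaxter (TensorProduct.comm k A A).toLinearMap S.sigmaBi S.op.sigmaBi := by
  refine yangBaxter_iff.2 fun a b l => ?_
  -- Both sides are `l(b₍₂₎ - a₍₂₎) ⊗ b₍₁₎ ⊗ a₍₁₎`, as the translations by `a₍₂₎` and `b₍₂₎` act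
  -- from opposite sides.
  let G : (A ⊗[k] A) ⊗[k] (A ⊗[k] A) →ₗ[k] (Module.Dual k A ⊗[k] A) ⊗[k] A :=
    (TensorProduct.assoc k _ A A).symm.toLinearMap ∘ₗ
      (TensorProduct.comm k (A ⊗[k] A) (Module.Dual k A)).toLinearMap ∘ₗ
      TensorProduct.map (TensorProduct.comm k A A).toLinearMap
        (TensorProduct.lift (S.toAlgStr.op.shift ∘ₗ S.shift l)) ∘ₗ
      (TensorProduct.tensorTensorTensorComm k A A A A).toLinearMap
  have h1 : ∀ s, LinearMap.rTensor A S.op.sigmaBi ((TensorProduct.assoc k A _ A).symm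
      (b ⊗ₜ TensorProduct.comm k A _ (LinearMap.lTensor A (S.shift l) s))) =
      G (s ⊗ₜ S.comul b) := by
    intro s
    induction s using TensorProduct.induction_on with
    | zero => simp
    | add x y hx hy => simp only [TensorProduct.tmul_add, TensorProduct.add_tmul, map_add, hx, hy]
    | tmul p q =>
      simp only [LinearMap.lTensor_tmul, TensorProduct.comm_tmul, TensorProduct.assoc_symm_tmul,
        LinearMap.rTensor_tmul, sigmaBi_tmul]
      change TensorProduct.comm k A _ (LinearMap.lTensor A
        (S.toAlgStr.op.shift (S.shift l q)) (S.comul b)) ⊗ₜ p = _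
      generalize S.comul b = t
      induction t using TensorProduct.induction_on with
      | zero => simp
      | add x y hx hy => simp only [TensorProduct.tmul_add, TensorProduct.add_tmul, map_add, hx, hy]
      | tmul u v => simp [G]
  have h2 : ∀ t, (TensorProduct.assoc k _ A A).symm (LinearMap.lTensor _
      (TensorProduct.comm k A A).toLinearMap (TensorProduct.assoc k _ A A
        (LinearMap.rTensor A S.sigmaBi ((TensorProduct.assoc k A _ A).symm
      (a ⊗ₜ TensorProduct.comm k A _ (LinearMap.lTensor A (S.toAlgStr.op.shift l) t)))))) =
      G (S.comul a ⊗ₜ t) := by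
    intro t
    induction t using TensorProduct.induction_on with
    | zero => simp
    | add x y hx hy => simp only [TensorProduct.tmul_add, TensorProduct.add_tmul, map_add, hx, hy]
    | tmul u v =>
      simp only [LinearMap.lTensor_tmul, TensorProduct.comm_tmul, TensorProduct.assoc_symm_tmul,
        LinearMap.rTensor_tmul, sigmaBi_tmul]
      generalize S.comul a = t
      induction t using TensorProduct.induction_on with
      | zero => simp
      | add x y hx hy => simp only [TensorProduct.tmul_add, TensorProduct.add_tmul, map_add, hx, hy]
      | tmul p q => simp [G, h.isUAA.shift_op_shift]
  rw [LinearEquiv.coe_coe, TensorProduct.comm_tmul, TensorProduct.assoc_tmul,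
    LinearMap.lTensor_tmul, sigmaBi_tmul, sigmaBi_tmul, h1]
  exact (h2 _).symm

theorem BialgStr.IsBialgebra.yangBaxter_cop {S : BialgStr k A} (h : S.IsBialgebra) :
    YangBaxter S.sigmaBi S.cop.sigmaBi
      (TensorProduct.comm k (Module.Dual k A) (Module.Dual k A)).toLinearMap := by
  refine yangBaxter_iff.2 fun a l m => ?_
  -- By coassociativity both sides are `m(- a₍₁₎) ⊗ l(- a₍₃₎) ⊗ a₍₂₎`.
  let G : A ⊗[k] (A ⊗[k] A) →ₗ[k] (Module.Dual k A ⊗[k] Module.Dual k A) ⊗[k] A :=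
    LinearMap.rTensor A (TensorProduct.map (S.shift m) (S.shift l)) ∘ₗ
      (TensorProduct.assoc k A A A).symm.toLinearMap ∘ₗ
      LinearMap.lTensor A (TensorProduct.comm k A A).toLinearMap
  have hc : ∀ (b : A) (m : Module.Dual k A), S.cop.sigmaBi (b ⊗ₜ m) = TensorProduct.comm k A _
      (LinearMap.lTensor A (S.shift m) (TensorProduct.comm k A A (S.comul b))) :=
    S.cop.sigmaBi_tmul
  have h1 : LinearMap.rTensor A (TensorProduct.comm k _ _).toLinearMap
      ((TensorProduct.assoc k _ _ A).symm (LinearMap.lTensor _ S.cop.sigmaBi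
        (TensorProduct.assoc k _ A _ (S.sigmaBi (a ⊗ₜ l) ⊗ₜ m)))) =
      G (TensorProduct.assoc k A A A (LinearMap.rTensor A S.comul (S.comul a))) := by
    rw [sigmaBi_tmul]
    generalize S.comul a = s
    induction s using TensorProduct.induction_on with
    | zero => simp
    | add x y hx hy => simp only [TensorProduct.tmul_add, TensorProduct.add_tmul, map_add, hx, hy]
    | tmul p q =>
      simp only [LinearMap.lTensor_tmul, TensorProduct.comm_tmul, TensorProduct.assoc_tmul,
        LinearMap.rTensor_tmul, hc]
      generalize S.comul p = t
      induction t using TensorProduct.induction_on with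
      | zero => simp
      | add x y hx hy => simp only [TensorProduct.tmul_add, TensorProduct.add_tmul, map_add, hx, hy]
      | tmul u v => simp [G]
  rw [h1, h.coassoc, LinearEquiv.coe_coe, TensorProduct.comm_tmul, TensorProduct.assoc_symm_tmul,
    LinearMap.rTensor_tmul, hc]
  generalize S.comul a = s
  induction s using TensorProduct.induction_on with
  | zero => simp
  | add x y hx hy => simp only [TensorProduct.tmul_add, TensorProduct.add_tmul, map_add, hx, hy]
  | tmul p q =>
    simp only [LinearMap.lTensor_tmul, TensorProduct.comm_tmul, TensorProduct.assoc_tmul,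
      sigmaBi_tmul]
    generalize S.comul q = t
    induction t using TensorProduct.induction_on with
    | zero => simp
    | add x y hx hy => simp only [TensorProduct.tmul_add, TensorProduct.add_tmul, map_add, hx, hy]
    | tmul u v => simp [G]

end Bialg

/-! ### The braided system of a bialgebra. -/

section BprimeSystem

variable (k : Type u) [Field k] (H : Type u) [Ring H] [Bialgebra k H] [Module.Finite k H]

theorem isSystemOfUAAs_Bprime : (Bprime k H).IsSystemOfUAAs := by
  have h := BialgStr.isBialgebra_of (k := k) H
  refine AlgSystem.isSystemOfUAAs_of ?_ ?_ ?_ ?_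
  · exact forall_fin_four h.isUAA h.op.isUAA h.isUAA_dual h.cop.isUAA_dual
  · exact forall_fin_four_lt (isTwist_comm _ _) h.isTwist_sigmaBi h.cop.isTwist_sigmaBi
      h.op.isTwist_sigmaBi h.op.cop.isTwist_sigmaBi (isTwist_comm _ _)
  · intro i j l hij hjl
    have : ∀ i j l : Fin 4, i < j → j < l → (i = 0 ∧ j = 1 ∧ l = 2) ∨ (i = 0 ∧ j = 1 ∧ l = 3) ∨
        (i = 0 ∧ j = 2 ∧ l = 3) ∨ (i = 1 ∧ j = 2 ∧ l = 3) := by decide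
    rcases this i j l hij hjl with ⟨rfl, rfl, rfl⟩ | ⟨rfl, rfl, rfl⟩ | ⟨rfl, rfl, rfl⟩ |
      ⟨rfl, rfl, rfl⟩
    -- Two triples contain both `H` and `H^op`, the other two contain both duals. Within each kind
    -- the cases differ by `cop` or by `op`.
    · exact h.yangBaxter_op
    · exact h.cop.yangBaxter_op
    · exact h.yangBaxter_cop
    · exact h.op.yangBaxter_cop
  · exact forall_fin_four h.counit_one h.counit_one h.counit_one h.counit_one

end BprimeSystem

/-! ### Invertibility of the braidings of a Hopf algebra -/

section SigmaInv

variable {k : Type u} [Field k] {A : Type u} [AddCommGroup A] [Module k A]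

/-- `l ⊗ a ↦ a₍₁₎ ⊗ l(- t(a₍₂₎))`. -/
def BialgStr.sigmaBiInv (S : BialgStr k A) (t : A →ₗ[k] A) :
    Module.Dual k A ⊗[k] A →ₗ[k] A ⊗[k] Module.Dual k A :=
  TensorProduct.lift (LinearMap.mk₂ k (fun l a => LinearMap.lTensor A (S.shift l ∘ₗ t) (S.comul a))
    (by intros; simp [LinearMap.add_comp, LinearMap.lTensor_add])
    (by intros; simp [LinearMap.smul_comp, LinearMap.lTensor_smul])
    (by intros; simp) (by intros; simp))

@[simp]
theorem BialgStr.sigmaBiInv_tmul (S : BialgStr k A) (t : A →ₗ[k] A) (l : Module.Dual k A) (a : A) :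
    S.sigmaBiInv t (l ⊗ₜ a) = LinearMap.lTensor A (S.shift l ∘ₗ t) (S.comul a) := rfl

variable [Module.Finite k A]

/-- The braiding `σ_bi` is invertible if `t` is a convolution inverse of the identity. -/
def BialgStr.IsBialgebra.sigmaBiEquiv {S : BialgStr k A} (h : S.IsBialgebra) (t : A →ₗ[k] A)
    (h₁ : ∀ a, S.mul (LinearMap.lTensor A t (S.comul a)) = S.counit a • S.one)
    (h₂ : ∀ a, S.mul (LinearMap.rTensor A t (S.comul a)) = S.counit a • S.one) :
    A ⊗[k] Module.Dual k A ≃ₗ[k] Module.Dual k A ⊗[k] A := by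
  refine LinearEquiv.ofLinearMap S.sigmaBi (S.sigmaBiInv t) ?_ ?_
  · refine TensorProduct.ext' fun l a => ?_
    -- The composite is `l(- a₍₂₎ t(a₍₃₎)) ⊗ a₍₁₎`, contracted by `h₁`. The other composite produces
    -- `l(- t(a₍₂₎) a₍₃₎)` and is contracted by `h₂`.
    trans TensorProduct.comm k A _
        (LinearMap.lTensor A (S.shift l ∘ₗ S.mul ∘ₗ LinearMap.lTensor A t)
      (LinearMap.lTensor A S.comul (S.comul a)))
    · rw [← h.coassoc, LinearMap.comp_apply, sigmaBiInv_tmul]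
      generalize S.comul a = r
      induction r using TensorProduct.induction_on with
      | zero => simp
      | add x y hx hy => simp only [TensorProduct.tmul_add, map_add, hx, hy]
      | tmul p q =>
        rw [LinearMap.lTensor_tmul, sigmaBi_tmul, LinearMap.rTensor_tmul]
        generalize S.comul p = r
        induction r using TensorProduct.induction_on with
        | zero => simp
        | add x y hx hy => simp only [TensorProduct.add_tmul, map_add, hx, hy]
        | tmul u v => simp [h.isUAA.shift_shift]
    · have e : (S.shift l ∘ₗ S.mul ∘ₗ LinearMap.lTensor A t) ∘ₗ S.comul =
          LinearMap.toSpanSingleton k _ l ∘ₗ S.counit :=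
        LinearMap.ext fun b => by simp [h₁, h.isUAA.shift_one]
      rw [← LinearMap.comp_apply (LinearMap.lTensor A _), ← LinearMap.lTensor_comp, e]
      conv_rhs => rw [LinearMap.id_apply, ← h.counit_right a]
      generalize S.comul a = r
      induction r using TensorProduct.induction_on with
      | zero => simp
      | add x y hx hy => simp only [TensorProduct.tmul_add, map_add, hx, hy]
      | tmul p q => simp [TensorProduct.smul_tmul]
  · refine TensorProduct.ext' fun a l => ?_
    trans LinearMap.lTensor A (S.shift l ∘ₗ S.mul ∘ₗ LinearMap.rTensor A t)
      (LinearMap.lTensor A S.comul (S.comul a))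
    · rw [← h.coassoc, LinearMap.comp_apply, sigmaBi_tmul]
      generalize S.comul a = r
      induction r using TensorProduct.induction_on with
      | zero => simp
      | add x y hx hy => simp only [TensorProduct.tmul_add, map_add, hx, hy]
      | tmul p q =>
        rw [LinearMap.lTensor_tmul, TensorProduct.comm_tmul, sigmaBiInv_tmul,
          LinearMap.rTensor_tmul]
        generalize S.comul p = r
        induction r using TensorProduct.induction_on with
        | zero => simp
        | add x y hx hy => simp only [TensorProduct.add_tmul, map_add, hx, hy]
        | tmul u v => simp [h.isUAA.shift_shift]
    · have e : (S.shift l ∘ₗ S.mul ∘ₗ LinearMap.rTensor A t) ∘ₗ S.comul =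
          LinearMap.toSpanSingleton k _ l ∘ₗ S.counit :=
        LinearMap.ext fun b => by simp [h₂, h.isUAA.shift_one]
      rw [← LinearMap.comp_apply (LinearMap.lTensor A _), ← LinearMap.lTensor_comp, e]
      conv_rhs => rw [LinearMap.id_apply, ← h.counit_right a]
      generalize S.comul a = r
      induction r using TensorProduct.induction_on with
      | zero => simp
      | add x y hx hy => simp only [TensorProduct.add_tmul, map_add, hx, hy]
      | tmul p q => simp [TensorProduct.smul_tmul]

theorem BialgStr.IsBialgebra.bijective_sigmaBi {S : BialgStr k A} (h : S.IsBialgebra)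
    {t : A →ₗ[k] A}
    (h₁ : ∀ a, S.mul (LinearMap.lTensor A t (S.comul a)) = S.counit a • S.one)
    (h₂ : ∀ a, S.mul (LinearMap.rTensor A t (S.comul a)) = S.counit a • S.one) :
    Function.Bijective S.sigmaBi ∧ linInv S.sigmaBi = S.sigmaBiInv t :=
  ⟨(h.sigmaBiEquiv t h₁ h₂).bijective, linInv_eq (h.sigmaBiEquiv t h₁ h₂)⟩

end SigmaInv

/-! ### Bijectivity of the braidings of a Hopf algebra. -/

section Hopf

variable (k : Type u) [Field k] (H : Type u) [Ring H] [HopfAlgebra k H]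

theorem mul_lTensor_antip (a : H) : LinearMap.mul' k H (LinearMap.lTensor H (antip k H)
    (Coalgebra.comul a)) = Coalgebra.counit (R := k) a • (1 : H) := by
  rw [antip, HopfAlgebra.mul_antipode_lTensor_comul_apply, Algebra.algebraMap_eq_smul_one]

theorem mul_rTensor_antip (a : H) : LinearMap.mul' k H (LinearMap.rTensor H (antip k H)
    (Coalgebra.comul a)) = Coalgebra.counit (R := k) a • (1 : H) := by
  rw [antip, HopfAlgebra.mul_antipode_rTensor_comul_apply, Algebra.algebraMap_eq_smul_one]

variable [Module.Finite k H]

theorem antip_antipInv (x : H) : antip k H (antipInv k H x) = x := by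
  obtain ⟨e, he, he'⟩ := exists_equiv_of_bijective (antipode_bijective (k := k) (H := H))
  rw [antipInv, antip, he', he]
  simp

theorem antipInv_antip (x : H) : antipInv k H (antip k H x) = x := by
  obtain ⟨e, he, he'⟩ := exists_equiv_of_bijective (antipode_bijective (k := k) (H := H))
  rw [antipInv, antip, he', he]
  simp

/-- Applying the injective, antimultiplicative `s` turns `s⁻¹(a₍₂₎) a₍₁₎` into `s(a₍₁₎) a₍₂₎`. -/
theorem mul_comm_lTensor_antipInv (a : H) : LinearMap.mul' k H (TensorProduct.comm k H H
    (LinearMap.lTensor H (antipInv k H) (Coalgebra.comul a))) =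
      Coalgebra.counit (R := k) a • (1 : H) := by
  have inj : Function.Injective (antip k H) := antipode_bijective.1
  apply inj
  have h1 : antip k H 1 = 1 := by simp [antip]
  rw [map_smul, h1, ← mul_rTensor_antip]
  generalize (Coalgebra.comul a : H ⊗[k] H) = t
  induction t using TensorProduct.induction_on with
  | zero => simp
  | add x y hx hy => simp only [map_add, hx, hy]
  | tmul p q =>
    simp only [LinearMap.lTensor_tmul, TensorProduct.comm_tmul, LinearMap.mul'_apply,
      LinearMap.rTensor_tmul]
    rw [antip, HopfAlgebra.antipode_mul_antidistrib, ← antip, antip_antipInv]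

theorem mul_comm_rTensor_antipInv (a : H) : LinearMap.mul' k H (TensorProduct.comm k H H
    (LinearMap.rTensor H (antipInv k H) (Coalgebra.comul a))) =
      Coalgebra.counit (R := k) a • (1 : H) := by
  have inj : Function.Injective (antip k H) := antipode_bijective.1
  apply inj
  have h1 : antip k H 1 = 1 := by simp [antip]
  rw [map_smul, h1, ← mul_lTensor_antip]
  generalize (Coalgebra.comul a : H ⊗[k] H) = t
  induction t using TensorProduct.induction_on with
  | zero => simp
  | add x y hx hy => simp only [map_add, hx, hy]
  | tmul p q =>
    simp only [LinearMap.lTensor_tmul, TensorProduct.comm_tmul, LinearMap.mul'_apply,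
      LinearMap.rTensor_tmul]
    rw [antip, HopfAlgebra.antipode_mul_antidistrib, ← antip, antip_antipInv]

theorem sigmaBi_of_bijective : Function.Bijective (BialgStr.of k H).sigmaBi ∧
    linInv (BialgStr.of k H).sigmaBi = (BialgStr.of k H).sigmaBiInv (antip k H) :=
  (BialgStr.isBialgebra_of H).bijective_sigmaBi (mul_lTensor_antip k H) (mul_rTensor_antip k H)

/-- Reversing either the product or the coproduct replaces the convolution inverse `s` of the
identity by `s⁻¹`; reversing both brings back `s`. -/
theorem sigmaBi_op_bijective : Function.Bijective (BialgStr.of k H).op.sigmaBi ∧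
    linInv (BialgStr.of k H).op.sigmaBi = (BialgStr.of k H).op.sigmaBiInv (antipInv k H) :=
  (BialgStr.isBialgebra_of H).op.bijective_sigmaBi (mul_comm_lTensor_antipInv k H)
    (mul_comm_rTensor_antipInv k H)

theorem sigmaBi_cop_bijective : Function.Bijective (BialgStr.of k H).cop.sigmaBi ∧
    linInv (BialgStr.of k H).cop.sigmaBi = (BialgStr.of k H).cop.sigmaBiInv (antipInv k H) := by
  refine (BialgStr.isBialgebra_of H).cop.bijective_sigmaBi (fun a => ?_) (fun a => ?_)
  · refine Eq.trans ?_ (mul_comm_rTensor_antipInv k H a)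
    change LinearMap.mul' k H
      (LinearMap.lTensor H _ (TensorProduct.comm k H H (Coalgebra.comul a))) = _
    rw [LinearMap.lTensor_comm]
  · refine Eq.trans ?_ (mul_comm_lTensor_antipInv k H a)
    change LinearMap.mul' k H
      (LinearMap.rTensor H _ (TensorProduct.comm k H H (Coalgebra.comul a))) = _
    rw [LinearMap.rTensor_comm]

theorem sigmaBi_op_cop_bijective : Function.Bijective (BialgStr.of k H).op.cop.sigmaBi ∧
    linInv (BialgStr.of k H).op.cop.sigmaBi = (BialgStr.of k H).op.cop.sigmaBiInv (antip k H) := by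
  have e : ∀ t : H ⊗[k] H, (BialgStr.of k H).op.mul t =
    LinearMap.mul' k H (TensorProduct.comm k H H t) := fun _ => rfl
  refine (BialgStr.isBialgebra_of H).op.cop.bijective_sigmaBi (fun a => ?_) (fun a => ?_)
  · refine Eq.trans ?_ (mul_rTensor_antip k H a)
    change (BialgStr.of k H).op.mul
      (LinearMap.lTensor H _ (TensorProduct.comm k H H (Coalgebra.comul a))) = _
    rw [e, LinearMap.lTensor_comm, TensorProduct.comm_comm]
  · refine Eq.trans ?_ (mul_lTensor_antip k H a)
    change (BialgStr.of k H).op.mul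
      (LinearMap.rTensor H _ (TensorProduct.comm k H H (Coalgebra.comul a))) = _
    rw [e, LinearMap.rTensor_comm, TensorProduct.comm_comm]

theorem bijectiveBraiding_Bprime : (Bprime k H).BijectiveBraiding :=
  forall_fin_four_lt (TensorProduct.comm k H H).bijective (sigmaBi_of_bijective k H).1
    (sigmaBi_cop_bijective k H).1 (sigmaBi_op_bijective k H).1 (sigmaBi_op_cop_bijective k H).1
    (TensorProduct.comm k (Module.Dual k H) (Module.Dual k H)).bijective

end Hopf

/-! ### The algebras of Cibils-Rosso and Panaite -/

section PassRight

variable {k : Type u} [Field k]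
variable {A B C : Type u} [AddCommGroup A] [Module k A] [AddCommGroup B] [Module k B]
  [AddCommGroup C] [Module k C] {M : Type u} [AddCommGroup M] [Module k M]

/-- Moving `C` to the right through `A` by `ξ`, and then through `B` by `ζ`. -/
def passRight (ξ : C ⊗[k] A →ₗ[k] A ⊗[k] C) (ζ : C ⊗[k] B →ₗ[k] B ⊗[k] C) :
    C ⊗[k] (A ⊗[k] B) →ₗ[k] (A ⊗[k] B) ⊗[k] C :=
  (TensorProduct.assoc k A B C).symm.toLinearMap ∘ₗ LinearMap.lTensor A ζ ∘ₗ
    (TensorProduct.assoc k A C B).toLinearMap ∘ₗ LinearMap.rTensor B ξ ∘ₗ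
    (TensorProduct.assoc k C A B).symm.toLinearMap

theorem passRight_tmul (ξ : C ⊗[k] A →ₗ[k] A ⊗[k] C) (ζ : C ⊗[k] B →ₗ[k] B ⊗[k] C)
    (c : C) (a : A) (b : B) : passRight ξ ζ (c ⊗ₜ (a ⊗ₜ b)) =
      (TensorProduct.assoc k A B C).symm (LinearMap.lTensor A ζ
        (TensorProduct.assoc k A C B (ξ (c ⊗ₜ a) ⊗ₜ b))) := by
  simp [passRight]

theorem ActCompat.passRight {ξ : C ⊗[k] A →ₗ[k] A ⊗[k] C} {ζ : C ⊗[k] B →ₗ[k] B ⊗[k] C}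
    {ρA : M ⊗[k] A →ₗ[k] M} {ρB : M ⊗[k] B →ₗ[k] M} {ρC : M ⊗[k] C →ₗ[k] M}
    (hA : ActCompat ξ ρA ρC) (hB : ActCompat ζ ρB ρC) :
    ActCompat (passRight ξ ζ) (prodAct ρA ρB) ρC := by
  refine ActCompat.of_tmul fun m c x => ?_
  induction x using TensorProduct.induction_on with
  | zero => simp
  | add x y hx hy => simp only [TensorProduct.tmul_add, TensorProduct.add_tmul, map_add, hx, hy]
  | tmul a b =>
  rw [prodAct_tmul, hA.tmul, passRight_tmul]
  generalize ξ (c ⊗ₜ a) = t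
  induction t using TensorProduct.induction_on with
  | zero => simp
  | add x y hx hy => simp only [TensorProduct.tmul_add, TensorProduct.add_tmul, map_add, hx, hy]
  | tmul a c =>
    rw [prodAct_tmul, hB.tmul, TensorProduct.assoc_tmul, LinearMap.lTensor_tmul]
    generalize ζ (c ⊗ₜ b) = t
    induction t using TensorProduct.induction_on with
    | zero => simp
    | add x y hx hy => simp only [TensorProduct.tmul_add, TensorProduct.add_tmul, map_add, hx, hy]
    | tmul c b => simp

theorem prodAct_comm {ρA : M ⊗[k] A →ₗ[k] M} {ρB : M ⊗[k] B →ₗ[k] M}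
    (h : ActCompat (TensorProduct.comm k B A).toLinearMap ρA ρB) :
    prodAct ρB ρA = prodAct ρA ρB ∘ₗ LinearMap.lTensor M (TensorProduct.comm k B A).toLinearMap :=
  TensorProduct.ext (LinearMap.ext fun m => LinearMap.ext fun t => by simpa using h m t)

/-- Compatibility for a reordered product of commuting actions. -/
theorem ActCompat.comm_right {ρA : M ⊗[k] A →ₗ[k] M} {ρB : M ⊗[k] B →ₗ[k] M}
    {ρC : M ⊗[k] C →ₗ[k] M} {ξ : C ⊗[k] (B ⊗[k] A) →ₗ[k] (B ⊗[k] A) ⊗[k] C}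
    (h : ActCompat (TensorProduct.comm k B A).toLinearMap ρA ρB)
    (hξ : ActCompat ξ (prodAct ρB ρA) ρC) :
    ActCompat (LinearMap.rTensor C (TensorProduct.comm k B A).toLinearMap ∘ₗ ξ ∘ₗ
      LinearMap.lTensor C (TensorProduct.comm k A B).toLinearMap) (prodAct ρA ρB) ρC := by
  have h' := prodAct_comm h
  refine ActCompat.of_tmul fun m c x => ?_
  have h1 := hξ.tmul m c (TensorProduct.comm k A B x)
  rw [h', LinearMap.comp_apply, LinearMap.lTensor_tmul, LinearEquiv.coe_coe,
    TensorProduct.comm_comm] at h1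
  rw [h1]
  simp only [LinearMap.comp_apply, LinearMap.lTensor_tmul, LinearEquiv.coe_coe]
  generalize ξ (c ⊗ₜ TensorProduct.comm k A B x) = t
  induction t using TensorProduct.induction_on with
  | zero => simp
  | add x y hx hy => simp only [TensorProduct.tmul_add, map_add, hx, hy]
  | tmul u c => simp [prodAct]

/-- This makes the criterion for modules over twisted products available for the untwisted tensor
factors of the three algebras. -/
theorem AlgStr.tensor_eq_twisted (S : AlgStr k A) (T : AlgStr k B) :
    S.tensor T = S.twisted T (TensorProduct.comm k B A).toLinearMap := by
  refine congrArg (fun m => AlgStr.mk m (S.one ⊗ₜ T.one)) ?_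
  refine TensorProduct.ext_fourfold' fun a b a' b' => ?_
  simp

theorem AlgStr.IsModule.tensor {S : AlgStr k A} {T : AlgStr k B}
    {ρA : M ⊗[k] A →ₗ[k] M} {ρB : M ⊗[k] B →ₗ[k] M} (hA : S.IsModule M ρA)
    (hB : T.IsModule M ρB) (h : ActCompat (TensorProduct.comm k B A).toLinearMap ρA ρB) :
    (S.tensor T).IsModule M (prodAct ρA ρB) := by
  rw [AlgStr.tensor_eq_twisted]
  exact hA.twisted hB h

theorem BialgStr.dual_op [Module.Finite k A] (S : BialgStr k A) :
    S.dual.toAlgStr.op = S.cop.dual.toAlgStr := by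
  refine congrArg (fun m => AlgStr.mk m S.counit) ?_
  refine TensorProduct.ext' fun l m => ?_
  ext a
  change TensorProduct.dualDistrib k A A (l ⊗ₜ m) (S.comul a) =
    TensorProduct.dualDistrib k A A (m ⊗ₜ l) (TensorProduct.comm k A A (S.comul a))
  generalize S.comul a = t
  induction t using TensorProduct.induction_on with
  | zero => simp
  | add x y hx hy => simp only [map_add, hx, hy]
  | tmul p q => simp [mul_comm]

theorem diagTwist_tmul (S : BialgStr k B) (t : (B ⊗[k] B) ⊗[k] A →ₗ[k] A) (b : B) (x : A) :
    diagTwist S t (b ⊗ₜ x) = LinearMap.rTensor B (t ∘ₗ (TensorProduct.mk k (B ⊗[k] B) A).flip x)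
      (TensorProduct.rightComm k B B B (LinearMap.rTensor B S.comul (S.comul b))) := by
  simp only [diagTwist, LinearMap.comp_apply, LinearMap.rTensor_tmul, LinearEquiv.coe_coe]
  generalize TensorProduct.rightComm k B B B (LinearMap.rTensor B S.comul (S.comul b)) = s
  induction s using TensorProduct.induction_on with
  | zero => simp
  | add x y hx hy => simp only [TensorProduct.add_tmul, map_add, hx, hy]
  | tmul u v => simp

/-- The diagonal twist of a product of two actions. -/
theorem diagTwist_cop_eq (S : BialgStr k B) (t : B ⊗[k] A →ₗ[k] A)
    {T : (B ⊗[k] B) ⊗[k] (A ⊗[k] A) →ₗ[k] A ⊗[k] A}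
    (hT : ∀ b b' l l', T ((b ⊗ₜ b') ⊗ₜ (l ⊗ₜ l')) = t (b ⊗ₜ l) ⊗ₜ t (b' ⊗ₜ l')) :
    LinearMap.rTensor B (TensorProduct.comm k A A).toLinearMap ∘ₗ
      passRight
        (LinearMap.rTensor B t ∘ₗ (TensorProduct.rightComm k B B A).toLinearMap ∘ₗ
          LinearMap.rTensor A S.comul)
        (LinearMap.rTensor B t ∘ₗ (TensorProduct.rightComm k B B A).toLinearMap ∘ₗ
          LinearMap.rTensor A S.cop.comul) ∘ₗ
      LinearMap.lTensor B (TensorProduct.comm k A A).toLinearMap = diagTwist S.cop T := by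
  refine TensorProduct.ext (LinearMap.ext fun b => TensorProduct.ext' fun l l' => ?_)
  simp only [LinearMap.compr₂ₛₗ_apply, TensorProduct.mk_apply, diagTwist_tmul]
  simp only [LinearMap.comp_apply, LinearMap.lTensor_tmul, LinearEquiv.coe_coe,
    TensorProduct.comm_tmul, passRight_tmul, LinearMap.rTensor_tmul, BialgStr.cop]
  -- Passing the second factor first splits off `b₍₁₎` and then divides the rest, which is the way
  -- the coopposite diagonal twist splits `b`. No coassociativity is needed.
  generalize S.comul b = s
  induction s using TensorProduct.induction_on with
  | zero => simp
  | add x y hx hy => simp only [TensorProduct.tmul_add, TensorProduct.add_tmul, map_add, hx, hy]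
  | tmul u v =>
    simp only [TensorProduct.rightComm_tmul, TensorProduct.assoc_tmul, LinearMap.lTensor_tmul,
      LinearMap.rTensor_tmul, LinearMap.comp_apply, LinearEquiv.coe_coe, TensorProduct.comm_tmul]
    generalize S.comul v = s
    induction s using TensorProduct.induction_on with
    | zero => simp
    | add x y hx hy => simp only [TensorProduct.tmul_add, TensorProduct.add_tmul, map_add, hx, hy]
    | tmul p q => simp [hT]

end PassRight

/-! ### The twists of the three algebras as composites of braidings. -/

section Twists

variable (k : Type u) [Field k] (H : Type u) [Ring H] [HopfAlgebra k H] [Module.Finite k H]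

theorem translate_tmul (g h : H) (l : Module.Dual k H) : translate k H ((g ⊗ₜ h) ⊗ₜ l) =
    (BialgStr.of k H).shift ((BialgStr.of k H).op.shift l g) h := by
  ext x
  simp [translate, BialgStr.of, BialgStr.op, AlgStr.op, Module.Dual.transpose]

theorem translateInv_tmul (g h : H) (l : Module.Dual k H) :
    translateInv k H (l ⊗ₜ (g ⊗ₜ h)) = (BialgStr.of k H).shift
      ((BialgStr.of k H).op.shift l (antip k H g)) (antipInv k H h) := by
  simp [translateInv, translate_tmul]

theorem op_shift_shift (l : Module.Dual k H) (g h : H) :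
    (BialgStr.of k H).op.shift ((BialgStr.of k H).shift l h) g =
      (BialgStr.of k H).shift ((BialgStr.of k H).op.shift l g) h :=
  ((BialgStr.isBialgebra_of H).isUAA.shift_op_shift l g h).symm

theorem sigmaBi_op_tmul (g : H) (l : Module.Dual k H) :
    (BialgStr.of k H).op.sigmaBi (g ⊗ₜ l) = TensorProduct.comm k H _ (LinearMap.lTensor H
      ((BialgStr.of k H).op.shift l) ((BialgStr.of k H).comul g)) :=
  (BialgStr.of k H).op.sigmaBi_tmul g l

theorem sigmaBi_cop_tmul (g : H) (l : Module.Dual k H) :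
    (BialgStr.of k H).cop.sigmaBi (g ⊗ₜ l) = TensorProduct.comm k H _ (LinearMap.lTensor H
      ((BialgStr.of k H).shift l) (TensorProduct.comm k H H ((BialgStr.of k H).comul g))) :=
  (BialgStr.of k H).cop.sigmaBi_tmul g l

theorem sigmaBi_op_cop_tmul (g : H) (l : Module.Dual k H) :
    (BialgStr.of k H).op.cop.sigmaBi (g ⊗ₜ l) = TensorProduct.comm k H _ (LinearMap.lTensor H
      ((BialgStr.of k H).op.shift l) (TensorProduct.comm k H H ((BialgStr.of k H).comul g))) :=
  (BialgStr.of k H).op.cop.sigmaBi_tmul g l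

theorem sigmaBiInv_op_tmul (t : H →ₗ[k] H) (g : H) (l : Module.Dual k H) :
    (BialgStr.of k H).op.sigmaBiInv t (l ⊗ₜ g) = LinearMap.lTensor H
      ((BialgStr.of k H).op.shift l ∘ₗ t) ((BialgStr.of k H).comul g) := rfl

theorem sigmaBiInv_cop_tmul (t : H →ₗ[k] H) (g : H) (l : Module.Dual k H) :
    (BialgStr.of k H).cop.sigmaBiInv t (l ⊗ₜ g) = LinearMap.lTensor H
      ((BialgStr.of k H).shift l ∘ₗ t) (TensorProduct.comm k H H ((BialgStr.of k H).comul g)) := rfl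

theorem sigmaBiInv_op_cop_tmul (t : H →ₗ[k] H) (g : H) (l : Module.Dual k H) :
    (BialgStr.of k H).op.cop.sigmaBiInv t (l ⊗ₜ g) = LinearMap.lTensor H
      ((BialgStr.of k H).op.shift l ∘ₗ t)
        (TensorProduct.comm k H H ((BialgStr.of k H).comul g)) := rfl

/-- The twist of `Y(H)` between `H^op ⊗ H` and `H^*`. -/
theorem passLeft_sigmaBi :
    passLeft (BialgStr.of k H).op.sigmaBi (BialgStr.of k H).sigmaBi =
      LinearMap.rTensor _ (translate k H) ∘ₗ (TensorProduct.rightComm k _ _ _).toLinearMap ∘ₗ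
        LinearMap.rTensor _ ((BialgStr.of k H).op.tensor (BialgStr.of k H)).cop.comul := by
  refine TensorProduct.ext_threefold fun g h l => ?_
  simp only [passLeft_tmul, LinearMap.comp_apply, LinearMap.rTensor_tmul, BialgStr.cop,
    BialgStr.tensor, TensorProduct.map_tmul, LinearEquiv.coe_coe, BialgStr.sigmaBi_tmul]
  change _ = LinearMap.rTensor _ (translate k H) (TensorProduct.rightComm k _ _ _
    (TensorProduct.comm k _ _ (TensorProduct.tensorTensorTensorComm k H H H H
      ((BialgStr.of k H).comul g ⊗ₜ (BialgStr.of k H).comul h)) ⊗ₜ l))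
  generalize (BialgStr.of k H).comul h = t
  induction t using TensorProduct.induction_on with
  | zero => simp
  | add x y hx hy => simp only [TensorProduct.tmul_add, TensorProduct.add_tmul, map_add, hx, hy]
  | tmul u v =>
    simp only [LinearMap.lTensor_tmul, TensorProduct.comm_tmul, TensorProduct.assoc_symm_tmul,
      LinearMap.rTensor_tmul, sigmaBi_op_tmul]
    generalize (BialgStr.of k H).comul g = t
    induction t using TensorProduct.induction_on with
    | zero => simp
    | add x y hx hy => simp only [TensorProduct.tmul_add, TensorProduct.add_tmul, map_add, hx, hy]
    | tmul p q => simp [translate_tmul, op_shift_shift]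

/-- The twist of `Y(H)` between `(H^*)^op` and `H^op ⊗ H`. -/
theorem passRight_sigmaBiInv :
    passRight ((BialgStr.of k H).op.cop.sigmaBiInv (antip k H))
        ((BialgStr.of k H).cop.sigmaBiInv (antipInv k H)) =
      LinearMap.lTensor _ (translateInv k H) ∘ₗ (TensorProduct.leftComm k _ _ _).toLinearMap ∘ₗ
        LinearMap.lTensor _ ((BialgStr.of k H).op.tensor (BialgStr.of k H)).cop.comul := by
  refine TensorProduct.ext (LinearMap.ext fun l => TensorProduct.ext' fun g h => ?_)
  simp only [LinearMap.compr₂ₛₗ_apply, TensorProduct.mk_apply, LinearMap.comp_apply,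
    passRight_tmul, LinearMap.lTensor_tmul, BialgStr.cop,
    BialgStr.tensor, TensorProduct.map_tmul, LinearEquiv.coe_coe]
  change (TensorProduct.assoc k _ _ _).symm (LinearMap.lTensor _
    ((BialgStr.of k H).cop.sigmaBiInv _) (TensorProduct.assoc k _ _ _
    ((BialgStr.of k H).op.cop.sigmaBiInv _ (l ⊗ₜ g) ⊗ₜ h))) =
    LinearMap.lTensor _ (translateInv k H) (TensorProduct.leftComm k _ _ _ (l ⊗ₜ
      TensorProduct.comm k _ _ (TensorProduct.tensorTensorTensorComm k H H H H
      ((BialgStr.of k H).comul g ⊗ₜ (BialgStr.of k H).comul h))))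
  rw [sigmaBiInv_op_cop_tmul]
  generalize (BialgStr.of k H).comul g = t
  induction t using TensorProduct.induction_on with
  | zero => simp
  | add x y hx hy => simp only [TensorProduct.tmul_add, TensorProduct.add_tmul, map_add, hx, hy]
  | tmul u v =>
    simp only [LinearMap.lTensor_tmul, TensorProduct.comm_tmul, TensorProduct.assoc_tmul,
      LinearMap.rTensor_tmul, sigmaBiInv_cop_tmul]
    generalize (BialgStr.of k H).comul h = t
    induction t using TensorProduct.induction_on with
    | zero => simp
    | add x y hx hy => simp only [TensorProduct.tmul_add, TensorProduct.add_tmul, map_add, hx, hy]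
    | tmul p q => simp [translateInv_tmul]

/-- For `(H^cop)^*` the translating components are the first ones, so the comultiplication appears
here without `cop`. -/
theorem passLeft_sigmaBi_cop :
    passLeft (BialgStr.of k H).op.cop.sigmaBi (BialgStr.of k H).cop.sigmaBi =
      LinearMap.rTensor _ (translate k H) ∘ₗ (TensorProduct.rightComm k _ _ _).toLinearMap ∘ₗ
        LinearMap.rTensor _ ((BialgStr.of k H).op.tensor (BialgStr.of k H)).comul := by
  refine TensorProduct.ext_threefold fun g h l => ?_
  simp only [passLeft_tmul, LinearMap.comp_apply, LinearMap.rTensor_tmul,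
    BialgStr.tensor, TensorProduct.map_tmul, LinearEquiv.coe_coe, sigmaBi_cop_tmul]
  change _ = LinearMap.rTensor _ (translate k H) (TensorProduct.rightComm k _ _ _
    (TensorProduct.tensorTensorTensorComm k H H H H
      ((BialgStr.of k H).comul g ⊗ₜ (BialgStr.of k H).comul h) ⊗ₜ l))
  generalize (BialgStr.of k H).comul h = t
  induction t using TensorProduct.induction_on with
  | zero => simp
  | add x y hx hy => simp only [TensorProduct.tmul_add, TensorProduct.add_tmul, map_add, hx, hy]
  | tmul u v =>
    simp only [LinearMap.lTensor_tmul, TensorProduct.comm_tmul, TensorProduct.assoc_symm_tmul,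
      LinearMap.rTensor_tmul, sigmaBi_op_cop_tmul]
    generalize (BialgStr.of k H).comul g = t
    induction t using TensorProduct.induction_on with
    | zero => simp
    | add x y hx hy => simp only [TensorProduct.tmul_add, TensorProduct.add_tmul, map_add, hx, hy]
    | tmul p q => simp [translate_tmul, op_shift_shift]

/-- The right action carries `s` and `s⁻¹`, and these cancel against the inverse antipode `s⁻¹ ⊗ s`
of the diagonal crossed product. The twist of `Z(H)` is therefore free of antipodes. -/
theorem biact_leftAct_rightAct (g h g' h' : H) (l l' : Module.Dual k H) :
    biact (leftAct k H) (rightAct k H) LinearMap.id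
      (TensorProduct.map (antipInv k H) (antip k H))
      (((g ⊗ₜ h) ⊗ₜ (g' ⊗ₜ h')) ⊗ₜ (l ⊗ₜ l')) =
    translate k H ((g ⊗ₜ h) ⊗ₜ l) ⊗ₜ translate k H ((g' ⊗ₜ h') ⊗ₜ l') := by
  simp [biact, leftAct, rightAct, translateInv_tmul, translate_tmul, antip_antipInv,
    antipInv_antip]

theorem biact_leftAct_rightAct' (b b' : H ⊗[k] H) (l l' : Module.Dual k H) :
    biact (leftAct k H) (rightAct k H) LinearMap.id
      (TensorProduct.map (antipInv k H) (antip k H)) ((b ⊗ₜ b') ⊗ₜ (l ⊗ₜ l')) =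
    translate k H (b ⊗ₜ l) ⊗ₜ translate k H (b' ⊗ₜ l') := by
  induction b using TensorProduct.induction_on with
  | zero => simp
  | add x y hx hy => simp only [TensorProduct.tmul_add, TensorProduct.add_tmul, map_add, hx, hy]
  | tmul g h =>
  induction b' using TensorProduct.induction_on with
  | zero => simp
  | add x y hx hy => simp only [TensorProduct.tmul_add, TensorProduct.add_tmul, map_add, hx, hy]
  | tmul g' h' => exact biact_leftAct_rightAct k H g h g' h' l l'

/-- The twist of `Z(H)`. -/
theorem passRight_passLeft_sigmaBi :
    LinearMap.rTensor _ (TensorProduct.comm k _ _).toLinearMap ∘ₗ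
      passRight (passLeft (BialgStr.of k H).op.cop.sigmaBi (BialgStr.of k H).cop.sigmaBi)
        (passLeft (BialgStr.of k H).op.sigmaBi (BialgStr.of k H).sigmaBi) ∘ₗ
      LinearMap.lTensor _ (TensorProduct.comm k _ _).toLinearMap =
    diagTwist ((BialgStr.of k H).op.tensor (BialgStr.of k H)).cop
      (biact (leftAct k H) (rightAct k H) LinearMap.id
        (TensorProduct.map (antipInv k H) (antip k H))) := by
  rw [passLeft_sigmaBi, passLeft_sigmaBi_cop]
  exact diagTwist_cop_eq _ _ (biact_leftAct_rightAct' k H)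

/-- This writes the double coproduct through `(Id ⊗ Δ) Δ` on each factor, the form in which the
inverse braidings split an element. -/
theorem BialgStr.rTensor_cop_comul_tensor {A B : Type u} [AddCommGroup A] [Module k A]
    [AddCommGroup B] [Module k B] (S : BialgStr k A) (T : BialgStr k B) (a : A) (b : B) :
    LinearMap.rTensor _ (S.tensor T).cop.comul ((S.tensor T).cop.comul (a ⊗ₜ b)) =
      LinearMap.rTensor _ (TensorProduct.comm k _ _).toLinearMap (TensorProduct.comm k _ _
        (LinearMap.lTensor _ (TensorProduct.tensorTensorTensorComm k _ _ _ _).toLinearMap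
          (TensorProduct.tensorTensorTensorComm k _ _ _ _
            (LinearMap.lTensor A S.comul (S.comul a) ⊗ₜ
              LinearMap.lTensor B T.comul (T.comul b))))) := by
  simp only [BialgStr.cop, BialgStr.tensor, LinearMap.comp_apply, TensorProduct.map_tmul,
    LinearEquiv.coe_coe]
  generalize S.comul a = s
  generalize T.comul b = t
  induction s using TensorProduct.induction_on with
  | zero => simp
  | add x y hx hy => simp only [TensorProduct.tmul_add, TensorProduct.add_tmul, map_add, hx, hy]
  | tmul u v =>
  induction t using TensorProduct.induction_on with
  | zero => simp
  | add x y hx hy => simp only [TensorProduct.tmul_add, TensorProduct.add_tmul, map_add, hx, hy]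
  | tmul p q => simp

/-- In Sweedler notation the value is `h₍₂₎ ⊗ l(- s(h₍₃₎)) ⊗ l'(- s⁻¹(h₍₁₎))`: the functional `l'`
is passed first and takes `h₍₁₎`. -/
theorem passLeft_sigmaBiInv_tmul (l l' : Module.Dual k H) (h : H) :
    passLeft ((BialgStr.of k H).sigmaBiInv (antip k H))
      ((BialgStr.of k H).cop.sigmaBiInv (antipInv k H)) ((l ⊗ₜ l') ⊗ₜ h) =
    LinearMap.lTensor H (TensorProduct.comm k _ _).toLinearMap (TensorProduct.leftComm k _ _ _
      (TensorProduct.map ((BialgStr.of k H).shift l' ∘ₗ antipInv k H)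
        (LinearMap.lTensor H ((BialgStr.of k H).shift l ∘ₗ antip k H))
        (LinearMap.lTensor H (BialgStr.of k H).comul ((BialgStr.of k H).comul h)))) := by
  rw [passLeft_tmul, sigmaBiInv_cop_tmul]
  generalize (BialgStr.of k H).comul h = t
  induction t using TensorProduct.induction_on with
  | zero => simp
  | add x y hx hy => simp only [TensorProduct.tmul_add, TensorProduct.add_tmul, map_add, hx, hy]
  | tmul u v =>
    simp only [TensorProduct.comm_tmul, LinearMap.lTensor_tmul, TensorProduct.assoc_symm_tmul,
      LinearMap.rTensor_tmul, BialgStr.sigmaBiInv_tmul, TensorProduct.map_tmul]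
    generalize (BialgStr.of k H).comul v = t
    induction t using TensorProduct.induction_on with
    | zero => simp
    | add x y hx hy => simp only [TensorProduct.tmul_add, TensorProduct.add_tmul, map_add, hx, hy]
    | tmul p q => simp

theorem passLeft_sigmaBiInv_op_tmul (l l' : Module.Dual k H) (h : H) :
    passLeft ((BialgStr.of k H).op.sigmaBiInv (antipInv k H))
      ((BialgStr.of k H).op.cop.sigmaBiInv (antip k H)) ((l ⊗ₜ l') ⊗ₜ h) =
    LinearMap.lTensor H (TensorProduct.comm k _ _).toLinearMap (TensorProduct.leftComm k _ _ _
      (TensorProduct.map ((BialgStr.of k H).op.shift l' ∘ₗ antip k H)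
        (LinearMap.lTensor H ((BialgStr.of k H).op.shift l ∘ₗ antipInv k H))
        (LinearMap.lTensor H (BialgStr.of k H).comul ((BialgStr.of k H).comul h)))) := by
  rw [passLeft_tmul, sigmaBiInv_op_cop_tmul]
  generalize (BialgStr.of k H).comul h = t
  induction t using TensorProduct.induction_on with
  | zero => simp
  | add x y hx hy => simp only [TensorProduct.tmul_add, TensorProduct.add_tmul, map_add, hx, hy]
  | tmul u v =>
    simp only [TensorProduct.comm_tmul, LinearMap.lTensor_tmul, TensorProduct.assoc_symm_tmul,
      LinearMap.rTensor_tmul, sigmaBiInv_op_tmul, TensorProduct.map_tmul]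
    generalize (BialgStr.of k H).comul v = t
    induction t using TensorProduct.induction_on with
    | zero => simp
    | add x y hx hy => simp only [TensorProduct.tmul_add, TensorProduct.add_tmul, map_add, hx, hy]
    | tmul p q => simp

/-- The twist of `X(H)`. -/
theorem passRight_passLeft_sigmaBiInv :
    passRight (passLeft ((BialgStr.of k H).sigmaBiInv (antip k H))
        ((BialgStr.of k H).cop.sigmaBiInv (antipInv k H)))
      (passLeft ((BialgStr.of k H).op.sigmaBiInv (antipInv k H))
        ((BialgStr.of k H).op.cop.sigmaBiInv (antip k H))) =
    (TensorProduct.comm k _ _).toLinearMap ∘ₗ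
      diagTwist ((BialgStr.of k H).tensor (BialgStr.of k H).op).cop
        (biact (leftAct k H ∘ₗ LinearMap.rTensor _ (TensorProduct.comm k H H).toLinearMap)
          (rightAct k H ∘ₗ LinearMap.lTensor _ (TensorProduct.comm k H H).toLinearMap)
          (TensorProduct.map (antip k H) (antipInv k H)) LinearMap.id) ∘ₗ
      (TensorProduct.comm k _ _).toLinearMap := by
  refine TensorProduct.ext (TensorProduct.ext' fun l l' => TensorProduct.ext' fun h g => ?_)
  simp only [LinearMap.compr₂ₛₗ_apply, TensorProduct.mk_apply, LinearMap.comp_apply,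
    LinearEquiv.coe_coe, TensorProduct.comm_tmul, passRight_tmul, diagTwist_tmul,
    passLeft_sigmaBiInv_tmul, BialgStr.rTensor_cop_comul_tensor]
  set T := biact (leftAct k H ∘ₗ LinearMap.rTensor _ (TensorProduct.comm k H H).toLinearMap)
    (rightAct k H ∘ₗ LinearMap.lTensor _ (TensorProduct.comm k H H).toLinearMap)
    (TensorProduct.map (antip k H) (antipInv k H)) LinearMap.id with hT
  -- The left action receives the antipodes from `s ⊗ s⁻¹`, the right one already contains its own.
  -- Only these values of `T` on pure tensors matter below.
  have hT' : ∀ h₁ g₁ h₃ g₃, (T ∘ₗ (TensorProduct.mk k ((H ⊗[k] H) ⊗[k] (H ⊗[k] H))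
      (Module.Dual k H ⊗[k] Module.Dual k H)).flip (l ⊗ₜ l')) ((h₃ ⊗ₜ g₃) ⊗ₜ (h₁ ⊗ₜ g₁)) =
      (BialgStr.of k H).shift ((BialgStr.of k H).op.shift l (antipInv k H g₃)) (antip k H h₃) ⊗ₜ
      (BialgStr.of k H).shift ((BialgStr.of k H).op.shift l' (antip k H g₁)) (antipInv k H h₁) := by
    intro h₁ g₁ h₃ g₃
    simp [hT, biact, leftAct, rightAct, translateInv_tmul, translate_tmul]
  generalize T ∘ₗ (TensorProduct.mk k ((H ⊗[k] H) ⊗[k] (H ⊗[k] H))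
      (Module.Dual k H ⊗[k] Module.Dual k H)).flip (l ⊗ₜ l') = T' at hT'
  clear_value T
  clear hT T
  change _ = TensorProduct.comm k (Module.Dual k H ⊗[k] Module.Dual k H) (H ⊗[k] H)
    (LinearMap.rTensor (H ⊗[k] H) T'
        (TensorProduct.rightComm k (H ⊗[k] H) (H ⊗[k] H) (H ⊗[k] H)
          (LinearMap.rTensor (H ⊗[k] H) (TensorProduct.comm k (H ⊗[k] H) (H ⊗[k] H)).toLinearMap
            (TensorProduct.comm k (H ⊗[k] H) ((H ⊗[k] H) ⊗[k] (H ⊗[k] H))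
              (LinearMap.lTensor (H ⊗[k] H)
                (TensorProduct.tensorTensorTensorComm k H H H H).toLinearMap
                (TensorProduct.tensorTensorTensorComm k H (H ⊗[k] H) H (H ⊗[k] H)
                  (LinearMap.lTensor H (BialgStr.of k H).comul ((BialgStr.of k H).comul h) ⊗ₜ
                    LinearMap.lTensor H (BialgStr.of k H).comul
                      ((BialgStr.of k H).comul g))))))))
  generalize LinearMap.lTensor H (BialgStr.of k H).comul ((BialgStr.of k H).comul h) = s
  induction s using TensorProduct.induction_on with
  | zero => simp
  | add x y hx hy => simp only [TensorProduct.tmul_add, TensorProduct.add_tmul, map_add, hx, hy]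
  | tmul h₁ s =>
  induction s using TensorProduct.induction_on with
  | zero => simp
  | add x y hx hy => simp only [TensorProduct.tmul_add, TensorProduct.add_tmul, map_add, hx, hy]
  | tmul h₂ h₃ =>
  simp only [TensorProduct.map_tmul, LinearMap.lTensor_tmul, TensorProduct.leftComm_tmul,
    LinearEquiv.coe_coe, TensorProduct.comm_tmul, TensorProduct.assoc_tmul,
    passLeft_sigmaBiInv_op_tmul, LinearMap.comp_apply]
  generalize LinearMap.lTensor H (BialgStr.of k H).comul ((BialgStr.of k H).comul g) = s
  induction s using TensorProduct.induction_on with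
  | zero => simp
  | add x y hx hy => simp only [TensorProduct.tmul_add, TensorProduct.add_tmul, map_add, hx, hy]
  | tmul g₁ s =>
  induction s using TensorProduct.induction_on with
  | zero => simp
  | add x y hx hy => simp only [TensorProduct.tmul_add, TensorProduct.add_tmul, map_add, hx, hy]
  | tmul g₂ g₃ =>
  simp [hT', op_shift_shift]

end Twists

/-- Acting on `1` by `x` gives `fromPerm (e x)`, and `fromPerm` is an injective algebra map.
Multiplicativity of `e` is therefore associativity of the action at `1`, and no products have to be
compared directly. -/
theorem AlgSystem.isAlgIso_of_isModule {k : Type u} [Field k] {S : AlgSystem k 4}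
    (hS : S.IsSystemOfUAAs) (hb : S.BijectiveBraiding) {θ : Equiv.Perm (Fin 4)}
    {Q : Type u} [AddCommGroup Q] [Module k Q] {P : AlgStr k Q} (e : Q ≃ₗ[k] (S.perm θ).BTP)
    {ρ : S.BTP ⊗[k] Q →ₗ[k] S.BTP} (hP : P.IsModule S.BTP ρ)
    (h : ∀ m x, ρ (m ⊗ₜ x) = S.permIterProd θ (restr S.btp.mul) (m ⊗ₜ e x)) :
    IsAlgIso P (S.perm θ).btp e where
  map_mul x y := by
    refine (fromPerm_bijective hS hb θ).1 ?_
    refine Eq.trans ?_ (fromPerm_mul hS hb θ (e x) (e y)).symm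
    refine (h S.btp.one _).symm.trans ?_
    refine (hP.assoc S.btp.one x y).symm.trans ?_
    rw [h, h]
    exact permIterProd_mul hS θ _ _
  map_one := by
    refine (fromPerm_bijective hS hb θ).1 ?_
    refine Eq.trans ?_ (fromPerm_one hS θ).symm
    exact (h S.btp.one _).symm.trans (hP.unit _)

/-! ### Identification of the three algebras with permuted braided tensor products. -/

section XYZ

variable (k : Type u) [Field k] (H : Type u) [Ring H] [HopfAlgebra k H] [Module.Finite k H]
  {M : Type u} [AddCommGroup M] [Module k M]

/-- The module axioms over `B'(H)` and the compatibilities for the inverse braidings. -/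
structure IsHopfQuadruple (r₀ r₁ : M ⊗[k] H →ₗ[k] M) (r₂ r₃ : M ⊗[k] Module.Dual k H →ₗ[k] M) :
    Prop where
  mod₀ : (BialgStr.of k H).toAlgStr.IsModule M r₀
  mod₁ : (BialgStr.of k H).toAlgStr.op.IsModule M r₁
  mod₂ : (BialgStr.of k H).dual.toAlgStr.IsModule M r₂
  mod₃ : (BialgStr.of k H).dual.toAlgStr.op.IsModule M r₃
  c₀₁ : ActCompat (TensorProduct.comm k H H).toLinearMap r₁ r₀
  c₁₀ : ActCompat (TensorProduct.comm k H H).toLinearMap r₀ r₁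
  c₃₂ : ActCompat (TensorProduct.comm k (Module.Dual k H) (Module.Dual k H)).toLinearMap r₂ r₃
  c₀₂ : ActCompat (BialgStr.of k H).sigmaBi r₂ r₀
  c₁₂ : ActCompat (BialgStr.of k H).op.sigmaBi r₂ r₁
  c₀₃ : ActCompat (BialgStr.of k H).cop.sigmaBi r₃ r₀
  c₁₃ : ActCompat (BialgStr.of k H).op.cop.sigmaBi r₃ r₁
  c₂₀ : ActCompat ((BialgStr.of k H).sigmaBiInv (antip k H)) r₀ r₂
  c₂₁ : ActCompat ((BialgStr.of k H).op.sigmaBiInv (antipInv k H)) r₁ r₂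
  c₃₀ : ActCompat ((BialgStr.of k H).cop.sigmaBiInv (antipInv k H)) r₀ r₃
  c₃₁ : ActCompat ((BialgStr.of k H).op.cop.sigmaBiInv (antip k H)) r₁ r₃

variable {k H}

theorem isHopfQuadruple {ρ : ∀ i, M ⊗[k] (Bprime k H).V i →ₗ[k] M}
    (h : (Bprime k H).toBraidedData.IsModule M ρ) :
    IsHopfQuadruple k H (ρ 0) (ρ 1) (ρ 2) (ρ 3) := by
  obtain ⟨h1, h2⟩ := AlgSystem.isModule_iff.1 h
  have h3 : ∀ {i j : Fin 4} (hij : i < j),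
      ActCompat (linInv ((Bprime k H).σ i j hij.le)) (ρ i) (ρ j) :=
    fun hij => AlgSystem.actCompat_linInv (bijectiveBraiding_Bprime k H) h hij
  have e₂₀ : ActCompat (linInv (BialgStr.of k H).sigmaBi) (ρ 0) (ρ 2) :=
    h3 (by decide : (0 : Fin 4) < 2)
  have e₂₁ : ActCompat (linInv (BialgStr.of k H).op.sigmaBi) (ρ 1) (ρ 2) :=
    h3 (by decide : (1 : Fin 4) < 2)
  have e₃₀ : ActCompat (linInv (BialgStr.of k H).cop.sigmaBi) (ρ 0) (ρ 3) :=
    h3 (by decide : (0 : Fin 4) < 3)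
  have e₃₁ : ActCompat (linInv (BialgStr.of k H).op.cop.sigmaBi) (ρ 1) (ρ 3) :=
    h3 (by decide : (1 : Fin 4) < 3)
  have e₀₁ : ActCompat (TensorProduct.comm k H H).toLinearMap (ρ 1) (ρ 0) := h2 0 1 (by decide)
  have e₂₃ : ActCompat (TensorProduct.comm k (Module.Dual k H) (Module.Dual k H)).toLinearMap
    (ρ 3) (ρ 2) := h2 2 3 (by decide)
  rw [(sigmaBi_of_bijective k H).2] at e₂₀
  rw [(sigmaBi_op_bijective k H).2] at e₂₁
  rw [(sigmaBi_cop_bijective k H).2] at e₃₀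
  rw [(sigmaBi_op_cop_bijective k H).2] at e₃₁
  refine ⟨h1 0, h1 1, h1 2, ?_, e₀₁, e₀₁.symm, e₂₃.symm, h2 0 2 (by decide),
    h2 1 2 (by decide), h2 0 3 (by decide), h2 1 3 (by decide), e₂₀, e₂₁, e₃₀, e₃₁⟩
  rw [BialgStr.dual_op]
  exact h1 3

variable {r₀ r₁ : M ⊗[k] H →ₗ[k] M} {r₂ r₃ : M ⊗[k] Module.Dual k H →ₗ[k] M}

/-- The twist moves the pair of duals to the right, through `H` and then through `H^op`. All four
elementary exchanges use inverse braidings. -/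
theorem IsHopfQuadruple.isModule_algX (h : IsHopfQuadruple k H r₀ r₁ r₂ r₃) :
    (algX k H).IsModule M (prodAct (prodAct r₀ r₁) (prodAct r₂ r₃)) := by
  have hc := (h.c₂₀.passLeft h.c₃₀).passRight (h.c₂₁.passLeft h.c₃₁)
  rw [passRight_passLeft_sigmaBiInv] at hc
  exact (h.mod₀.tensor h.mod₁ h.c₁₀).twisted (h.mod₂.tensor h.mod₃ h.c₃₂) hc

/-- Here `H^*` is passed by the original braidings, `(H^cop)^*` by the inverse ones, and the two
duals merely commute. -/
theorem IsHopfQuadruple.isModule_algY (h : IsHopfQuadruple k H r₀ r₁ r₂ r₃) :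
    (algY k H).IsModule M (prodAct r₂ (prodAct (prodAct r₁ r₀) r₃)) := by
  have hc := h.c₁₂.passLeft h.c₀₂
  rw [passLeft_sigmaBi] at hc
  have hc' := h.c₃₁.passRight h.c₃₀
  rw [passRight_sigmaBiInv] at hc'
  exact h.mod₂.twisted ((h.mod₁.tensor h.mod₀ h.c₀₁).twisted h.mod₃ hc') (hc.passLeft h.c₃₂)

/-- The pair `H^op ⊗ H` passes `(H^cop)^*` before `H^*`, contrary to the order of the tensor
factors. Since the two dual actions commute, `ActCompat.comm_right` restores the order. -/
theorem IsHopfQuadruple.isModule_algZ (h : IsHopfQuadruple k H r₀ r₁ r₂ r₃) :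
    (algZ k H).IsModule M (prodAct (prodAct r₂ r₃) (prodAct r₁ r₀)) := by
  have hc := ActCompat.comm_right h.c₃₂ ((h.c₁₃.passLeft h.c₀₃).passRight (h.c₁₂.passLeft h.c₀₂))
  rw [passRight_passLeft_sigmaBi] at hc
  exact (h.mod₂.tensor h.mod₃ h.c₃₂).twisted (h.mod₁.tensor h.mod₀ h.c₀₁) hc

/-- Four actions as a family. -/
def quadruple (r₀ r₁ : M ⊗[k] H →ₗ[k] M) (r₂ r₃ : M ⊗[k] Module.Dual k H →ₗ[k] M) :
    ∀ i, M ⊗[k] (Bprime k H).V i →ₗ[k] M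
  | 0 => r₀
  | 1 => r₁
  | 2 => r₂
  | 3 => r₃

theorem quadruple_eq (ρ : ∀ i, M ⊗[k] (Bprime k H).V i →ₗ[k] M) :
    quadruple (H := H) (ρ 0) (ρ 1) (ρ 2) (ρ 3) = ρ :=
  funext (forall_fin_four rfl rfl rfl rfl)

theorem permIterProd_permX (m : M)
    (x : (H ⊗[k] H) ⊗[k] (Module.Dual k H ⊗[k] Module.Dual k H)) :
    prodAct (prodAct r₀ r₁) (prodAct r₂ r₃) (m ⊗ₜ x) =
      (Bprime k H).permIterProd permX (quadruple r₀ r₁ r₂ r₃) (m ⊗ₜ rebracketX k H x) := by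
  induction x using TensorProduct.induction_on with
  | zero => simp
  | add x y hx hy => simp only [TensorProduct.tmul_add, TensorProduct.add_tmul, map_add, hx, hy]
  | tmul y z =>
  induction y using TensorProduct.induction_on with
  | zero => simp
  | add x y hx hy => simp only [TensorProduct.tmul_add, TensorProduct.add_tmul, map_add, hx, hy]
  | tmul a b =>
  induction z using TensorProduct.induction_on with
  | zero => simp
  | add x y hx hy => simp only [TensorProduct.tmul_add, TensorProduct.add_tmul, map_add, hx, hy]
  | tmul c d =>
  refine Eq.trans ?_ (AlgSystem.iterProd_tmul (S := (Bprime k H).perm permX)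
    (fun i => quadruple r₀ r₁ r₂ r₃ (permX⁻¹ i)) m a b c d).symm
  simp only [prodAct_tmul]
  rfl

theorem permIterProd_permY (m : M)
    (x : Module.Dual k H ⊗[k] ((H ⊗[k] H) ⊗[k] Module.Dual k H)) :
    prodAct r₂ (prodAct (prodAct r₁ r₀) r₃) (m ⊗ₜ x) =
      (Bprime k H).permIterProd permY (quadruple r₀ r₁ r₂ r₃) (m ⊗ₜ rebracketY k H x) := by
  induction x using TensorProduct.induction_on with
  | zero => simp
  | add x y hx hy => simp only [TensorProduct.tmul_add, TensorProduct.add_tmul, map_add, hx, hy]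
  | tmul a y =>
  induction y using TensorProduct.induction_on with
  | zero => simp
  | add x y hx hy => simp only [TensorProduct.tmul_add, TensorProduct.add_tmul, map_add, hx, hy]
  | tmul y d =>
  induction y using TensorProduct.induction_on with
  | zero => simp
  | add x y hx hy => simp only [TensorProduct.tmul_add, TensorProduct.add_tmul, map_add, hx, hy]
  | tmul b c =>
  refine Eq.trans ?_ (AlgSystem.iterProd_tmul (S := (Bprime k H).perm permY)
    (fun i => quadruple r₀ r₁ r₂ r₃ (permY⁻¹ i)) m a b c d).symm
  simp only [prodAct_tmul]
  rfl

theorem permIterProd_permZ (m : M)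
    (x : (Module.Dual k H ⊗[k] Module.Dual k H) ⊗[k] (H ⊗[k] H)) :
    prodAct (prodAct r₂ r₃) (prodAct r₁ r₀) (m ⊗ₜ x) =
      (Bprime k H).permIterProd permZ (quadruple r₀ r₁ r₂ r₃) (m ⊗ₜ rebracketZ k H x) := by
  induction x using TensorProduct.induction_on with
  | zero => simp
  | add x y hx hy => simp only [TensorProduct.tmul_add, TensorProduct.add_tmul, map_add, hx, hy]
  | tmul y z =>
  induction y using TensorProduct.induction_on with
  | zero => simp
  | add x y hx hy => simp only [TensorProduct.tmul_add, TensorProduct.add_tmul, map_add, hx, hy]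
  | tmul a b =>
  induction z using TensorProduct.induction_on with
  | zero => simp
  | add x y hx hy => simp only [TensorProduct.tmul_add, TensorProduct.add_tmul, map_add, hx, hy]
  | tmul c d =>
  refine Eq.trans ?_ (AlgSystem.iterProd_tmul (S := (Bprime k H).perm permZ)
    (fun i => quadruple r₀ r₁ r₂ r₃ (permZ⁻¹ i)) m a b c d).symm
  simp only [prodAct_tmul]
  rfl

variable (k H)

theorem isAlgIso_rebracketX : IsAlgIso (algX k H) (thetaW k H permX) (rebracketX k H) :=
  AlgSystem.isAlgIso_of_isModule (isSystemOfUAAs_Bprime k H) (bijectiveBraiding_Bprime k H)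
    (rebracketX k H)
    (isHopfQuadruple (AlgSystem.isModule_restr_mul (isSystemOfUAAs_Bprime k H)).1).isModule_algX
    fun m x => (permIterProd_permX m x).trans (by rw [quadruple_eq])

theorem isAlgIso_rebracketY : IsAlgIso (algY k H) (thetaW k H permY) (rebracketY k H) :=
  AlgSystem.isAlgIso_of_isModule (isSystemOfUAAs_Bprime k H) (bijectiveBraiding_Bprime k H)
    (rebracketY k H)
    (isHopfQuadruple (AlgSystem.isModule_restr_mul (isSystemOfUAAs_Bprime k H)).1).isModule_algY
    fun m x => (permIterProd_permY m x).trans (by rw [quadruple_eq])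

theorem isAlgIso_rebracketZ : IsAlgIso (algZ k H) (thetaW k H permZ) (rebracketZ k H) :=
  AlgSystem.isAlgIso_of_isModule (isSystemOfUAAs_Bprime k H) (bijectiveBraiding_Bprime k H)
    (rebracketZ k H)
    (isHopfQuadruple (AlgSystem.isModule_restr_mul (isSystemOfUAAs_Bprime k H)).1).isModule_algZ
    fun m x => (permIterProd_permZ m x).trans (by rw [quadruple_eq])

end XYZ

/-! ### Coactions and actions of the dual -/

section Coaction

variable {k : Type u} [Field k] {A B : Type u} [AddCommGroup A] [Module k A]
  [AddCommGroup B] [Module k B]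
  {M N : Type u} [AddCommGroup M] [Module k M] [AddCommGroup N] [Module k N]

/-- `m ⊗ a ↦ l(a) m`. -/
def slice (M : Type u) [AddCommGroup M] [Module k M] (l : Module.Dual k A) : M ⊗[k] A →ₗ[k] M :=
  (TensorProduct.rid k M).toLinearMap ∘ₗ LinearMap.lTensor M l

@[simp]
theorem slice_tmul (l : Module.Dual k A) (m : M) (a : A) : slice M l (m ⊗ₜ a) = l a • m := by
  simp [slice]

theorem map_slice (f : M →ₗ[k] N) (l : Module.Dual k A) (t : M ⊗[k] A) :
    f (slice M l t) = slice N l (LinearMap.rTensor A f t) := by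
  induction t using TensorProduct.induction_on with
  | zero => simp
  | add x y hx hy => simp only [map_add, hx, hy]
  | tmul m a => simp

theorem slice_slice (l : Module.Dual k A) (l' : Module.Dual k B) (t : (M ⊗[k] A) ⊗[k] B) :
    slice M l (slice (M ⊗[k] A) l' t) =
      slice M l' (slice (M ⊗[k] B) l (TensorProduct.rightComm k M A B t)) := by
  induction t using TensorProduct.induction_on with
  | zero => simp
  | add x y hx hy => simp only [map_add, hx, hy]
  | tmul t b =>
  induction t using TensorProduct.induction_on with
  | zero => simp
  | add x y hx hy => simp only [TensorProduct.add_tmul, map_add, hx, hy]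
  | tmul m a => simp [smul_smul, mul_comm]

/-- The action of the dual space given by `δ : M → M ⊗ A`. -/
def coAct (δ : M →ₗ[k] M ⊗[k] A) : M ⊗[k] Module.Dual k A →ₗ[k] M :=
  (TensorProduct.rid k M).toLinearMap ∘ₗ LinearMap.lTensor M (contractRight k A) ∘ₗ
    (TensorProduct.assoc k M A (Module.Dual k A)).toLinearMap ∘ₗ
    LinearMap.rTensor (Module.Dual k A) δ

theorem coAct_tmul (δ : M →ₗ[k] M ⊗[k] A) (m : M) (l : Module.Dual k A) :
    coAct δ (m ⊗ₜ l) = slice M l (δ m) := by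
  simp only [coAct, LinearMap.comp_apply, LinearMap.rTensor_tmul, LinearEquiv.coe_coe]
  generalize δ m = t
  induction t using TensorProduct.induction_on with
  | zero => simp
  | add x y hx hy => simp only [TensorProduct.add_tmul, map_add, hx, hy]
  | tmul m a => simp

section Finite

variable [Module.Finite k A] [Module.Finite k B]

/-- A dual basis of the finite-dimensional space `A` reconstructs a tensor from its slices. -/
theorem slice_ext {s t : M ⊗[k] A} (h : ∀ l, slice M l s = slice M l t) : s = t := by
  let b := Module.finBasis k A
  have key : ∀ t : M ⊗[k] A, ∑ i, slice M (b.coord i) t ⊗ₜ[k] b i = t := by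
    intro t
    induction t using TensorProduct.induction_on with
    | zero => simp
    | add x y hx hy =>
      simp only [map_add, TensorProduct.add_tmul, Finset.sum_add_distrib, hx, hy]
    | tmul m a =>
      simp only [slice_tmul, TensorProduct.smul_tmul, ← TensorProduct.tmul_sum]
      exact congrArg _ (b.sum_repr a)
  rw [← key s, ← key t]
  simp only [h]

theorem slice_slice_ext {s t : (M ⊗[k] A) ⊗[k] B}
    (h : ∀ l l', slice M l (slice (M ⊗[k] A) l' s) = slice M l (slice (M ⊗[k] A) l' t)) : s = t :=
  slice_ext fun l' => slice_ext fun l => h l l'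

/-- For a basis `b` of `A` with coordinates `b^i`, the coaction is `δ(m) = ∑ r(m ⊗ b^i) ⊗ b_i`. -/
theorem exists_coAct (r : M ⊗[k] Module.Dual k A →ₗ[k] M) :
    ∃ δ : M →ₗ[k] M ⊗[k] A, coAct δ = r := by
  let b := Module.finBasis k A
  refine ⟨∑ i, (TensorProduct.mk k M A).flip (b i) ∘ₗ r ∘ₗ
    (TensorProduct.mk k M (Module.Dual k A)).flip (b.coord i), TensorProduct.ext' fun m l => ?_⟩
  rw [coAct_tmul]
  trans ∑ i, l (b i) • r (m ⊗ₜ b.coord i)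
  · simp
  · simp only [← map_smul, ← TensorProduct.tmul_smul, ← map_sum, ← TensorProduct.tmul_sum,
      b.sum_dual_apply_smul_coord]

/-- Since `(l l')(a) = l'(a₍₁₎) l(a₍₂₎)`, pairing the two sides of coassociativity with functionals
gives exactly the two sides of the right module axiom. The reversed order in the dual product makes
right comodules correspond to right modules. -/
theorem isModule_coAct_iff (S : BialgStr k A) {δ : M →ₗ[k] M ⊗[k] A} :
    S.dual.toAlgStr.IsModule M (coAct δ) ↔
      (TensorProduct.assoc k M A A).toLinearMap ∘ₗ LinearMap.rTensor A δ ∘ₗ δ =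
          LinearMap.lTensor M S.comul ∘ₗ δ ∧
        (TensorProduct.rid k M).toLinearMap ∘ₗ LinearMap.lTensor M S.counit ∘ₗ δ =
          LinearMap.id := by
  have h1 : ∀ m l l', coAct δ (coAct δ (m ⊗ₜ l) ⊗ₜ l') =
      slice M l' (slice (M ⊗[k] A) l (LinearMap.rTensor A δ (δ m))) := fun m l l' => by
    rw [coAct_tmul, coAct_tmul, map_slice]
  have h2 : ∀ m l l', coAct δ (m ⊗ₜ S.dual.mul (l ⊗ₜ l')) = slice M l' (slice (M ⊗[k] A) l
      ((TensorProduct.assoc k M A A).symm (LinearMap.lTensor M S.comul (δ m)))) := by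
    intro m l l'
    rw [coAct_tmul]
    generalize δ m = t
    induction t using TensorProduct.induction_on with
    | zero => simp
    | add x y hx hy => simp only [map_add, hx, hy]
    | tmul m a =>
      rw [slice_tmul, BialgStr.dual_mul_tmul_apply, LinearMap.lTensor_tmul]
      generalize S.comul a = t
      induction t using TensorProduct.induction_on with
      | zero => simp
      | add x y hx hy => simp only [TensorProduct.tmul_add, map_add, add_smul, hx, hy]
      | tmul u v => simp [smul_smul, mul_comm]
  constructor
  · intro h
    refine ⟨LinearMap.ext fun m => ?_, LinearMap.ext fun m => ?_⟩
    · have : LinearMap.rTensor A δ (δ m) =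
          (TensorProduct.assoc k M A A).symm (LinearMap.lTensor M S.comul (δ m)) :=
        slice_slice_ext fun l l' => by rw [← h1, ← h2, h.assoc]
      simp [this]
    · exact (coAct_tmul δ m S.counit).symm.trans (h.unit m)
  · rintro ⟨h, h'⟩
    refine ⟨fun m l l' => ?_, fun m => ?_⟩
    · rw [h1, h2]
      have := LinearMap.congr_fun h m
      simp only [LinearMap.comp_apply, LinearEquiv.coe_coe] at this
      rw [← this, LinearEquiv.symm_apply_apply]
    · exact (coAct_tmul δ m S.counit).trans (LinearMap.congr_fun h' m)

/-- By the formula for `σ_bi`, the right-hand side of the compatibility is the slice by `l` of `m₍₀₎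
· a₍₁₎ ⊗ m₍₁₎ a₍₂₎`, and the left-hand side is the slice of `δ(m · a)`. -/
theorem actCompat_sigmaBi_coAct_iff (S : BialgStr k A) {δ : M →ₗ[k] M ⊗[k] A}
    {r : M ⊗[k] A →ₗ[k] M} : ActCompat S.sigmaBi (coAct δ) r ↔
      δ ∘ₗ r = TensorProduct.map r S.mul ∘ₗ
        (TensorProduct.tensorTensorTensorComm k M A A A).toLinearMap ∘ₗ
        TensorProduct.map δ S.comul := by
  have h1 : ∀ m a l, prodAct (coAct δ) r (m ⊗ₜ S.sigmaBi (a ⊗ₜ l)) =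
      slice M l (TensorProduct.map r S.mul
        (TensorProduct.tensorTensorTensorComm k M A A A (δ m ⊗ₜ S.comul a))) := by
    intro m a l
    rw [BialgStr.sigmaBi_tmul]
    generalize S.comul a = s
    induction s using TensorProduct.induction_on with
    | zero => simp
    | add x y hx hy => simp only [TensorProduct.tmul_add, map_add, hx, hy]
    | tmul u v =>
      rw [LinearMap.lTensor_tmul, TensorProduct.comm_tmul, prodAct_tmul, coAct_tmul]
      generalize δ m = t
      induction t using TensorProduct.induction_on with
      | zero => simp
      | add x y hx hy => simp only [TensorProduct.add_tmul, map_add, hx, hy]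
      | tmul m a => simp [← TensorProduct.smul_tmul']
  constructor
  · intro h
    refine TensorProduct.ext' fun m a => slice_ext fun l => ?_
    have := h.tmul m a l
    rw [h1, coAct_tmul] at this
    exact this
  · intro h
    refine ActCompat.of_tmul fun m a l => ?_
    rw [h1, coAct_tmul]
    exact congrArg _ (LinearMap.congr_fun h (m ⊗ₜ a))

theorem actCompat_comm_coAct_iff {δ : M →ₗ[k] M ⊗[k] A} {γ : M →ₗ[k] M ⊗[k] B} :
    ActCompat (TensorProduct.comm k (Module.Dual k A) (Module.Dual k B)).toLinearMap
        (coAct γ) (coAct δ) ↔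
      LinearMap.rTensor A γ ∘ₗ δ =
        (TensorProduct.rightComm k M A B).toLinearMap ∘ₗ LinearMap.rTensor B δ ∘ₗ γ := by
  have h1 : ∀ m l l', coAct γ (coAct δ (m ⊗ₜ l) ⊗ₜ l') =
      slice M l' (slice (M ⊗[k] B) l (LinearMap.rTensor A γ (δ m))) := fun m l l' => by
    rw [coAct_tmul, coAct_tmul, map_slice]
  have h2 : ∀ m l l', coAct δ (coAct γ (m ⊗ₜ l') ⊗ₜ l) = slice M l' (slice (M ⊗[k] B) l
      (TensorProduct.rightComm k M A B (LinearMap.rTensor B δ (γ m)))) := fun m l l' => by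
    rw [coAct_tmul, coAct_tmul, map_slice, slice_slice]
  constructor
  · intro h
    refine LinearMap.ext fun m => slice_slice_ext fun l' l => ?_
    rw [LinearMap.comp_apply, ← h1, h.tmul]
    exact h2 m l l'
  · intro h
    refine ActCompat.of_tmul fun m l l' => ?_
    rw [LinearEquiv.coe_coe, TensorProduct.comm_tmul, prodAct_tmul, h1, h2]
    exact congrArg (fun t => slice M l' (slice (M ⊗[k] B) l t)) (LinearMap.congr_fun h m)

end Finite

end Coaction

/-! ### Hopf bimodules as braided modules -/

section Translate

variable {k : Type u} [Field k] {A M N P : Type u} [AddCommGroup A] [Module k A]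
  [AddCommGroup M] [Module k M] [AddCommGroup N] [Module k N] [AddCommGroup P] [Module k P]

theorem equiv_comp_inj (e : N ≃ₗ[k] P) {f g : M →ₗ[k] N} :
    e.toLinearMap ∘ₗ f = e.toLinearMap ∘ₗ g ↔ f = g :=
  ⟨fun h => LinearMap.ext fun x => e.injective (LinearMap.congr_fun h x), fun h => by rw [h]⟩

theorem comp_equiv_inj (e : M ≃ₗ[k] N) {f g : N →ₗ[k] P} :
    f ∘ₗ e.toLinearMap = g ∘ₗ e.toLinearMap ↔ f = g :=
  ⟨fun h => LinearMap.ext fun x => by simpa using LinearMap.congr_fun h (e.symm x),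
    fun h => by rw [h]⟩

/-- A left action as a right action of the opposite algebra. -/
abbrev flipAct (lam : A ⊗[k] M →ₗ[k] M) : M ⊗[k] A →ₗ[k] M :=
  lam ∘ₗ (TensorProduct.comm k M A).toLinearMap

/-- A left coaction as a right coaction of the coopposite coalgebra. -/
abbrev flipCoact (γ : M →ₗ[k] A ⊗[k] M) : M →ₗ[k] M ⊗[k] A :=
  (TensorProduct.comm k A M).toLinearMap ∘ₗ γ

theorem isModule_flipAct_iff (S : AlgStr k A) (lam : A ⊗[k] M →ₗ[k] M) :
    S.op.IsModule M (flipAct lam) ↔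
      (∀ g h m, lam (g ⊗ₜ lam (h ⊗ₜ m)) = lam (S.mul (g ⊗ₜ h) ⊗ₜ m)) ∧
        ∀ m, lam (S.one ⊗ₜ m) = m :=
  ⟨fun h => ⟨fun x y m => h.assoc m y x, h.unit⟩, fun h => ⟨fun m x y => h.1 y x m, h.2⟩⟩

theorem actCompat_comm_flipAct_iff (ρ : M ⊗[k] A →ₗ[k] M) (lam : A ⊗[k] M →ₗ[k] M) :
    ActCompat (TensorProduct.comm k A A).toLinearMap (flipAct lam) ρ ↔
      ∀ g m h, ρ (lam (g ⊗ₜ m) ⊗ₜ h) = lam (g ⊗ₜ ρ (m ⊗ₜ h)) :=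
  ⟨fun h g m x => by simpa using (h.tmul m x g).symm,
    fun h => ActCompat.of_tmul fun m x g => by simpa using (h g m x).symm⟩

/-- A left action is a right action of `H^op`, and a left coaction a right coaction of `H^cop`. This
lemma and the next two thus bring the remaining Hopf conditions into the form of
`actCompat_sigmaBi_coAct_iff` for `op`, `cop` and `op.cop`. -/
theorem coact_flip_left_iff (S : BialgStr k A) (δ : M →ₗ[k] M ⊗[k] A) (lam : A ⊗[k] M →ₗ[k] M) :
    δ ∘ₗ flipAct lam = TensorProduct.map (flipAct lam) S.op.mul ∘ₗ
        (TensorProduct.tensorTensorTensorComm k M A A A).toLinearMap ∘ₗ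
        TensorProduct.map δ S.op.comul ↔
      δ ∘ₗ lam = TensorProduct.map lam S.mul ∘ₗ
        (TensorProduct.tensorTensorTensorComm k A A M A).toLinearMap ∘ₗ
        TensorProduct.map S.comul δ := by
  rw [← comp_equiv_inj (TensorProduct.comm k M A), LinearMap.comp_assoc]
  refine Eq.congr_right (TensorProduct.ext' fun m a => ?_)
  change TensorProduct.map (flipAct lam) S.op.mul
    (TensorProduct.tensorTensorTensorComm k M A A A (δ m ⊗ₜ S.comul a)) =
    TensorProduct.map lam S.mul
      (TensorProduct.tensorTensorTensorComm k A A M A (S.comul a ⊗ₜ δ m))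
  generalize S.comul a = s
  generalize δ m = t
  induction s using TensorProduct.induction_on with
  | zero => simp
  | add x y hx hy => simp only [TensorProduct.tmul_add, TensorProduct.add_tmul, map_add, hx, hy]
  | tmul u v =>
  induction t using TensorProduct.induction_on with
  | zero => simp
  | add x y hx hy => simp only [TensorProduct.tmul_add, TensorProduct.add_tmul, map_add, hx, hy]
  | tmul m a => simp [AlgStr.op_mul_tmul, BialgStr.op]

theorem flip_coact_right_iff (S : BialgStr k A) (γ : M →ₗ[k] A ⊗[k] M) (ρ : M ⊗[k] A →ₗ[k] M) :
    flipCoact γ ∘ₗ ρ = TensorProduct.map ρ S.cop.mul ∘ₗ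
        (TensorProduct.tensorTensorTensorComm k M A A A).toLinearMap ∘ₗ
        TensorProduct.map (flipCoact γ) S.cop.comul ↔
      γ ∘ₗ ρ = TensorProduct.map S.mul ρ ∘ₗ
        (TensorProduct.tensorTensorTensorComm k A M A A).toLinearMap ∘ₗ
        TensorProduct.map γ S.comul := by
  rw [← equiv_comp_inj (TensorProduct.comm k A M), LinearMap.comp_assoc]
  refine Eq.congr_right (TensorProduct.ext' fun m a => ?_)
  change TensorProduct.map ρ S.mul (TensorProduct.tensorTensorTensorComm k M A A A
      (TensorProduct.comm k A M (γ m) ⊗ₜ TensorProduct.comm k A A (S.comul a))) =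
    TensorProduct.comm k A M (TensorProduct.map S.mul ρ
      (TensorProduct.tensorTensorTensorComm k A M A A (γ m ⊗ₜ S.comul a)))
  generalize S.comul a = s
  generalize γ m = t
  induction s using TensorProduct.induction_on with
  | zero => simp
  | add x y hx hy => simp only [TensorProduct.tmul_add, TensorProduct.add_tmul, map_add, hx, hy]
  | tmul u v =>
  induction t using TensorProduct.induction_on with
  | zero => simp
  | add x y hx hy => simp only [TensorProduct.tmul_add, TensorProduct.add_tmul, map_add, hx, hy]
  | tmul m a => simp

theorem flip_coact_flip_left_iff (S : BialgStr k A) (γ : M →ₗ[k] A ⊗[k] M)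
    (lam : A ⊗[k] M →ₗ[k] M) :
    flipCoact γ ∘ₗ flipAct lam = TensorProduct.map (flipAct lam) S.op.cop.mul ∘ₗ
        (TensorProduct.tensorTensorTensorComm k M A A A).toLinearMap ∘ₗ
        TensorProduct.map (flipCoact γ) S.op.cop.comul ↔
      γ ∘ₗ lam = TensorProduct.map S.mul lam ∘ₗ
        (TensorProduct.tensorTensorTensorComm k A A A M).toLinearMap ∘ₗ
        TensorProduct.map S.comul γ := by
  rw [← comp_equiv_inj (TensorProduct.comm k M A), ← equiv_comp_inj (TensorProduct.comm k A M),
    LinearMap.comp_assoc, LinearMap.comp_assoc]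
  refine Eq.congr_right (TensorProduct.ext' fun m a => ?_)
  change TensorProduct.map (flipAct lam) S.op.mul (TensorProduct.tensorTensorTensorComm k M A A A
      (TensorProduct.comm k A M (γ m) ⊗ₜ TensorProduct.comm k A A (S.comul a))) =
    TensorProduct.comm k A M (TensorProduct.map S.mul lam
      (TensorProduct.tensorTensorTensorComm k A A A M (S.comul a ⊗ₜ γ m)))
  generalize S.comul a = s
  generalize γ m = t
  induction s using TensorProduct.induction_on with
  | zero => simp
  | add x y hx hy => simp only [TensorProduct.tmul_add, TensorProduct.add_tmul, map_add, hx, hy]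
  | tmul u v =>
  induction t using TensorProduct.induction_on with
  | zero => simp
  | add x y hx hy => simp only [TensorProduct.tmul_add, TensorProduct.add_tmul, map_add, hx, hy]
  | tmul m a => simp [AlgStr.op_mul_tmul, BialgStr.op]

theorem flipCoact_coassoc_iff (S : BialgStr k A) (γ : M →ₗ[k] A ⊗[k] M) :
    (TensorProduct.assoc k M A A).toLinearMap ∘ₗ LinearMap.rTensor A (flipCoact γ) ∘ₗ flipCoact γ =
        LinearMap.lTensor M S.cop.comul ∘ₗ flipCoact γ ↔
      (TensorProduct.assoc k A A M).toLinearMap ∘ₗ LinearMap.rTensor M S.comul ∘ₗ γ =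
        LinearMap.lTensor A γ ∘ₗ γ := by
  -- `E` reverses the order of the factors. This interchanges the two sides of coassociativity,
  -- hence the use of `eq_comm`.
  let E : M ⊗[k] (A ⊗[k] A) ≃ₗ[k] A ⊗[k] (A ⊗[k] M) :=
    TensorProduct.comm k M (A ⊗[k] A) ≪≫ₗ
      TensorProduct.congr (TensorProduct.comm k A A) (LinearEquiv.refl k M) ≪≫ₗ
      TensorProduct.assoc k A A M
  rw [← equiv_comp_inj E, eq_comm]
  refine (Eq.congr_left (LinearMap.ext fun m => ?_)).trans
    (Eq.congr_right (LinearMap.ext fun m => ?_))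
  · simp only [LinearMap.comp_apply, LinearEquiv.coe_coe]
    generalize γ m = t
    induction t using TensorProduct.induction_on with
    | zero => simp
    | add x y hx hy => simp only [map_add, hx, hy]
    | tmul a m =>
      change E (m ⊗ₜ TensorProduct.comm k A A (S.comul a)) =
        TensorProduct.assoc k A A M (S.comul a ⊗ₜ m)
      generalize S.comul a = t
      induction t using TensorProduct.induction_on with
      | zero => simp
      | add x y hx hy =>
        simp only [TensorProduct.tmul_add, TensorProduct.add_tmul, map_add, hx, hy]
      | tmul u v => simp [E]
  · simp only [LinearMap.comp_apply, LinearEquiv.coe_coe]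
    generalize γ m = t
    induction t using TensorProduct.induction_on with
    | zero => simp
    | add x y hx hy => simp only [map_add, hx, hy]
    | tmul a m =>
      simp only [TensorProduct.comm_tmul, LinearMap.rTensor_tmul, LinearMap.lTensor_tmul,
        LinearMap.comp_apply, LinearEquiv.coe_coe]
      generalize γ m = t
      induction t using TensorProduct.induction_on with
      | zero => simp
      | add x y hx hy =>
        simp only [TensorProduct.tmul_add, TensorProduct.add_tmul, map_add, hx, hy]
      | tmul u v => simp [E]

theorem flipCoact_counit (l : Module.Dual k A) (γ : M →ₗ[k] A ⊗[k] M) :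
    (TensorProduct.rid k M).toLinearMap ∘ₗ LinearMap.lTensor M l ∘ₗ flipCoact γ =
      (TensorProduct.lid k M).toLinearMap ∘ₗ LinearMap.rTensor M l ∘ₗ γ := by
  refine LinearMap.ext fun m => ?_
  simp only [LinearMap.comp_apply, LinearEquiv.coe_coe]
  generalize γ m = t
  induction t using TensorProduct.induction_on with
  | zero => simp
  | add x y hx hy => simp only [map_add, hx, hy]
  | tmul a m => simp

theorem flipCoact_comm_iff (δ : M →ₗ[k] M ⊗[k] A) (γ : M →ₗ[k] A ⊗[k] M) :
    LinearMap.rTensor A (flipCoact γ) ∘ₗ δ =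
        (TensorProduct.rightComm k M A A).toLinearMap ∘ₗ LinearMap.rTensor A δ ∘ₗ flipCoact γ ↔
      (TensorProduct.assoc k A M A).toLinearMap ∘ₗ LinearMap.rTensor A γ ∘ₗ δ =
        LinearMap.lTensor A δ ∘ₗ γ := by
  let E : (M ⊗[k] A) ⊗[k] A ≃ₗ[k] A ⊗[k] (M ⊗[k] A) :=
    TensorProduct.congr (TensorProduct.comm k M A) (LinearEquiv.refl k A) ≪≫ₗ
      TensorProduct.assoc k A M A
  rw [← equiv_comp_inj E]
  refine (Eq.congr_left (LinearMap.ext fun m => ?_)).trans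
    (Eq.congr_right (LinearMap.ext fun m => ?_))
  · simp only [LinearMap.comp_apply, LinearEquiv.coe_coe]
    generalize δ m = t
    induction t using TensorProduct.induction_on with
    | zero => simp
    | add x y hx hy => simp only [map_add, hx, hy]
    | tmul m a =>
      simp only [LinearMap.rTensor_tmul, LinearMap.comp_apply, LinearEquiv.coe_coe]
      generalize γ m = t
      induction t using TensorProduct.induction_on with
      | zero => simp
      | add x y hx hy => simp only [TensorProduct.add_tmul, map_add, hx, hy]
      | tmul u v => simp [E]
  · simp only [LinearMap.comp_apply, LinearEquiv.coe_coe]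
    generalize γ m = t
    induction t using TensorProduct.induction_on with
    | zero => simp
    | add x y hx hy => simp only [map_add, hx, hy]
    | tmul a m =>
      simp only [TensorProduct.comm_tmul, LinearMap.rTensor_tmul, LinearMap.lTensor_tmul]
      generalize δ m = t
      induction t using TensorProduct.induction_on with
      | zero => simp
      | add x y hx hy =>
        simp only [TensorProduct.tmul_add, TensorProduct.add_tmul, map_add, hx, hy]
      | tmul u v => simp [E]

end Translate

section HopfBimodules

variable {k : Type u} [Field k] {H : Type u} [Ring H] [Bialgebra k H] [Module.Finite k H]

namespace HopfBimod

/-- The fourth action thereby has the same form as the third, with the flipped coaction, so the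
results on `coAct` apply to both. -/
theorem act_three (X : HopfBimod k H) : X.act 3 = coAct (flipCoact X.γ) := by
  refine TensorProduct.ext' fun m (l : Module.Dual k H) => ?_
  refine Eq.trans ?_ (coAct_tmul _ m l).symm
  change TensorProduct.lid k X.M (LinearMap.rTensor X.M (contractLeft k H)
    ((TensorProduct.assoc k (Module.Dual k H) H X.M).symm (l ⊗ₜ X.γ m))) =
      slice X.M l (TensorProduct.comm k H X.M (X.γ m))
  generalize X.γ m = t
  induction t using TensorProduct.induction_on with
  | zero => simp
  | add x y hx hy => simp only [TensorProduct.tmul_add, map_add, hx, hy]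
  | tmul a m => simp

theorem isModule_act (X : HopfBimod k H) : (Bprime k H).toBraidedData.IsModule X.M X.act := by
  let S := BialgStr.of k H
  have h3 := X.act_three
  refine AlgSystem.isModule_iff.2 ⟨forall_fin_four ?_ ?_ ?_ ?_,
    forall_fin_four_lt ?_ ?_ ?_ ?_ ?_ ?_⟩
  · exact ⟨X.right_assoc, X.right_unit⟩
  · exact (isModule_flipAct_iff S.toAlgStr X.lam).2 ⟨X.left_assoc, X.left_unit⟩
  · exact (isModule_coAct_iff S).2 ⟨X.right_coassoc, X.right_counit⟩
  · rw [h3]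
    exact (isModule_coAct_iff S.cop).2 ⟨(flipCoact_coassoc_iff S X.γ).2 X.left_coassoc,
      (flipCoact_counit _ _).trans X.left_counit⟩
  · exact (actCompat_comm_flipAct_iff X.ρ X.lam).2 X.left_right
  · exact (actCompat_sigmaBi_coAct_iff S).2 X.hopf_right_right
  · rw [h3]
    exact (actCompat_sigmaBi_coAct_iff S.cop).2 ((flip_coact_right_iff S _ _).2 X.hopf_right_left)
  · exact (actCompat_sigmaBi_coAct_iff S.op).2 ((coact_flip_left_iff S _ _).2 X.hopf_left_right)
  · rw [h3]
    exact (actCompat_sigmaBi_coAct_iff S.op.cop).2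
      ((flip_coact_flip_left_iff S _ _).2 X.hopf_left_left)
  · rw [h3]
    exact actCompat_comm_coAct_iff.2 ((flipCoact_comm_iff _ _).2 X.left_right_co)

/-- Every braided module comes from a Hopf bimodule. -/
theorem exists_act_eq {M : Type u} [AddCommGroup M] [Module k M] [Module.Finite k M]
    {r : ∀ i, M ⊗[k] (Bprime k H).V i →ₗ[k] M} (h : (Bprime k H).toBraidedData.IsModule M r) :
    ∃ X : HopfBimod k H, ∃ h', Nonempty ((⟨X.M, X.act, h'⟩ :
      BrMod (Bprime k H).toBraidedData) ≅ ⟨M, r, h⟩) := by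
  let S := BialgStr.of k H
  obtain ⟨h1, h2⟩ := AlgSystem.isModule_iff.1 h
  let ρ : M ⊗[k] H →ₗ[k] M := r 0
  let r₁ : M ⊗[k] H →ₗ[k] M := r 1
  let lam : H ⊗[k] M →ₗ[k] M := r₁ ∘ₗ (TensorProduct.comm k H M).toLinearMap
  have hlam : flipAct lam = r₁ := by
    refine TensorProduct.ext' fun m a => ?_
    simp [lam]
  -- Finite dimension turns the two actions of dual spaces into coactions.
  obtain ⟨δ, hδ⟩ : ∃ δ : M →ₗ[k] M ⊗[k] H, coAct δ = r 2 := exists_coAct (r 2)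
  obtain ⟨γ', hγ'⟩ : ∃ δ : M →ₗ[k] M ⊗[k] H, coAct δ = r 3 := exists_coAct (r 3)
  let γ : M →ₗ[k] H ⊗[k] M := (TensorProduct.comm k M H).toLinearMap ∘ₗ γ'
  have hγ : flipCoact γ = γ' := by
    refine LinearMap.ext fun m => ?_
    simp [γ]
  have m₀ : S.toAlgStr.IsModule M ρ := h1 0
  have m₁ : S.toAlgStr.op.IsModule M r₁ := h1 1
  have m₂ : S.dual.toAlgStr.IsModule M (r 2) := h1 2
  have m₃ : S.cop.dual.toAlgStr.IsModule M (r 3) := h1 3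
  have c₀₁ : ActCompat (TensorProduct.comm k H H).toLinearMap r₁ ρ := h2 0 1 (by decide)
  have c₀₂ : ActCompat S.sigmaBi (r 2) ρ := h2 0 2 (by decide)
  have c₀₃ : ActCompat S.cop.sigmaBi (r 3) ρ := h2 0 3 (by decide)
  have c₁₂ : ActCompat S.op.sigmaBi (r 2) r₁ := h2 1 2 (by decide)
  have c₁₃ : ActCompat S.op.cop.sigmaBi (r 3) r₁ := h2 1 3 (by decide)
  have c₂₃ : ActCompat (TensorProduct.comm k (Module.Dual k H) (Module.Dual k H)).toLinearMap
    (r 3) (r 2) := h2 2 3 (by decide)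
  rw [← hlam] at m₁ c₀₁ c₁₂ c₁₃
  rw [← hδ] at m₂ c₀₂ c₁₂ c₂₃
  rw [← hγ', ← hγ] at m₃ c₀₃ c₁₃ c₂₃
  rw [isModule_coAct_iff] at m₂ m₃
  let X : HopfBimod k H :=
    { M := M
      ρ := ρ
      lam := lam
      δ := δ
      γ := γ
      right_assoc := m₀.assoc
      right_unit := m₀.unit
      left_assoc := ((isModule_flipAct_iff S.toAlgStr lam).1 m₁).1
      left_unit := ((isModule_flipAct_iff S.toAlgStr lam).1 m₁).2
      left_right := (actCompat_comm_flipAct_iff ρ lam).1 c₀₁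
      right_coassoc := m₂.1
      right_counit := m₂.2
      left_coassoc := (flipCoact_coassoc_iff S γ).1 m₃.1
      left_counit := (flipCoact_counit S.counit γ).symm.trans m₃.2
      left_right_co := (flipCoact_comm_iff δ γ).1 (actCompat_comm_coAct_iff.1 c₂₃)
      hopf_right_right := (actCompat_sigmaBi_coAct_iff S).1 c₀₂
      hopf_left_right :=
        (coact_flip_left_iff S δ lam).1 ((actCompat_sigmaBi_coAct_iff S.op).1 c₁₂)
      hopf_right_left :=
        (flip_coact_right_iff S γ ρ).1 ((actCompat_sigmaBi_coAct_iff S.cop).1 c₀₃)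
      hopf_left_left :=
        (flip_coact_flip_left_iff S γ lam).1 ((actCompat_sigmaBi_coAct_iff S.op.cop).1 c₁₃) }
  have e : ∀ i, X.act i = r i :=
    forall_fin_four rfl hlam hδ (X.act_three.trans ((congrArg coAct hγ).trans hγ'))
  exact ⟨X, X.isModule_act, BrMod.nonempty_iso (M := M) (ρ := X.act) e X.isModule_act h⟩

theorem isEquivalence_toBrMod
    (h : ∀ X : HopfBimod k H, (Bprime k H).toBraidedData.IsModule X.M X.act) :
    (toBrMod h).IsEquivalence where
  faithful := ⟨fun {X Y f g} e => Hom.ext (congrArg (fun q :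
    (toBrMod h).obj X ⟶ (toBrMod h).obj Y => BrMod.Hom.map q) e)⟩
  full := ⟨fun {X Y} f => by
    let f' : X.M →ₗ[k] Y.M := f.map
    have hf : ∀ i, f' ∘ₗ X.act i = Y.act i ∘ₗ LinearMap.rTensor _ f' := f.comm
    -- A map which intertwines the actions of the dual intertwines all slices of the coactions, and
    -- hence the coactions.
    have key : ∀ {δ : X.M →ₗ[k] X.M ⊗[k] H} {δ' : Y.M →ₗ[k] Y.M ⊗[k] H},
        f' ∘ₗ coAct δ = coAct δ' ∘ₗ LinearMap.rTensor _ f' →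
        ∀ m, LinearMap.rTensor H f' (δ m) = δ' (f' m) := by
      intro δ δ' e m
      refine slice_ext fun l => ?_
      have := LinearMap.congr_fun e (m ⊗ₜ l)
      rw [LinearMap.comp_apply, LinearMap.comp_apply, LinearMap.rTensor_tmul, coAct_tmul,
        coAct_tmul, map_slice] at this
      exact this
    have h3 := hf 3
    rw [act_three, act_three] at h3
    refine ⟨⟨f', hf 0, ?_, LinearMap.ext (key (hf 2)), LinearMap.ext fun m => ?_⟩, rfl⟩
    · exact TensorProduct.ext' fun a m => LinearMap.congr_fun (hf 1) (m ⊗ₜ a)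
    · refine (TensorProduct.comm k H Y.M).injective (Eq.trans ?_ (key h3 m))
      change TensorProduct.comm k H Y.M (LinearMap.lTensor H f' (X.γ m)) =
        LinearMap.rTensor H f' (TensorProduct.comm k H X.M (X.γ m))
      rw [LinearMap.rTensor_comm]⟩
  essSurj := ⟨fun Z => by
    obtain ⟨X, h', e⟩ := exists_act_eq Z.isModule
    exact ⟨X, e⟩⟩

end HopfBimod

end HopfBimodules

/-! ### The functor from bialgebras to braided systems -/

section Morphisms

variable {k : Type u} [Field k] {A B : Type u} [AddCommGroup A] [Module k A]
  [AddCommGroup B] [Module k B]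

/-- Morphisms of bialgebras. -/
structure BialgStr.IsHom (S : BialgStr k A) (T : BialgStr k B) (f : A →ₗ[k] B) : Prop where
  map_mul : ∀ a b, f (S.mul (a ⊗ₜ b)) = T.mul (f a ⊗ₜ f b)
  map_one : f S.one = T.one
  map_comul : ∀ a, T.comul (f a) = TensorProduct.map f f (S.comul a)
  map_counit : ∀ a, T.counit (f a) = S.counit a

variable {S : BialgStr k A} {T : BialgStr k B} {f : A →ₗ[k] B} {g : B →ₗ[k] A}

theorem BialgStr.IsHom.op (h : S.IsHom T f) : S.op.IsHom T.op f :=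
  ⟨fun a b => h.map_mul b a, h.map_one, h.map_comul, h.map_counit⟩

theorem BialgStr.IsHom.cop (h : S.IsHom T f) : S.cop.IsHom T.cop f where
  map_mul := h.map_mul
  map_one := h.map_one
  map_counit := h.map_counit
  map_comul a := by
    change TensorProduct.comm k B B (T.comul (f a)) =
      TensorProduct.map f f (TensorProduct.comm k A A (S.comul a))
    rw [h.map_comul, TensorProduct.map_comm]

theorem AlgStr.map_sigmaAss {S : AlgStr k A} {T : AlgStr k B}
    (hm : ∀ a b, f (S.mul (a ⊗ₜ b)) = T.mul (f a ⊗ₜ f b)) (h1 : f S.one = T.one) :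
    TensorProduct.map f f ∘ₗ S.sigmaAss = T.sigmaAss ∘ₗ TensorProduct.map f f :=
  TensorProduct.ext' fun a b => by simp [AlgStr.sigmaAss_tmul, hm, h1]

variable [Module.Finite k A] [Module.Finite k B]

theorem BialgStr.IsHom.dualMap_mul (h : T.IsHom S g) (l l' : Module.Dual k A) :
    g.dualMap (S.dual.mul (l ⊗ₜ l')) = T.dual.mul (g.dualMap l ⊗ₜ g.dualMap l') := by
  ext b
  rw [LinearMap.dualMap_apply, dual_mul_tmul_apply, dual_mul_tmul_apply, h.map_comul]
  generalize T.comul b = t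
  induction t using TensorProduct.induction_on with
  | zero => simp
  | add x y hx hy => simp only [map_add, hx, hy]
  | tmul u v => simp

theorem BialgStr.IsHom.dualMap_one (h : T.IsHom S g) : g.dualMap S.dual.one = T.dual.one :=
  LinearMap.ext h.map_counit

/-- The condition `g ∘ f = id` enters through `g^*(l(- v)) = (g^* l)(- f(v))`. -/
theorem BialgStr.IsHom.map_sigmaBi (hf : S.IsHom T f) (hg : T.IsHom S g)
    (hgf : ∀ a, g (f a) = a) :
    TensorProduct.map g.dualMap f ∘ₗ S.sigmaBi = T.sigmaBi ∘ₗ TensorProduct.map f g.dualMap := by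
  refine TensorProduct.ext' fun a l => ?_
  rw [LinearMap.comp_apply, LinearMap.comp_apply, TensorProduct.map_tmul, sigmaBi_tmul,
    sigmaBi_tmul, hf.map_comul]
  generalize S.comul a = t
  induction t using TensorProduct.induction_on with
  | zero => simp
  | add x y hx hy => simp only [map_add, hx, hy]
  | tmul u v =>
    have e : g.dualMap (S.shift l v) = T.shift (g.dualMap l) (f v) := by
      ext b
      simp [hg.map_mul, hgf]
    simp [e]

section Recover

variable {p : Module.Dual k A →ₗ[k] Module.Dual k B}

/-- Evaluating the dual leg of the braiding relation at `1` turns `l(- a₍₂₎)` into the scalar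
`l(a₍₂₎)`. -/
theorem slice_map_of_map_sigmaBi (hS : S.IsBialgebra) (hT : T.IsBialgebra)
    (hσ : TensorProduct.map p f ∘ₗ S.sigmaBi = T.sigmaBi ∘ₗ TensorProduct.map f p)
    (hp : ∀ l, p l T.one = l S.one) (a : A) (l : Module.Dual k A) :
    slice B l (LinearMap.rTensor A f (S.comul a)) = slice B (p l) (T.comul (f a)) := by
  have h := LinearMap.congr_fun hσ (a ⊗ₜ l)
  rw [LinearMap.comp_apply, LinearMap.comp_apply, TensorProduct.map_tmul,
    BialgStr.sigmaBi_tmul, BialgStr.sigmaBi_tmul] at h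
  have h' := congrArg (fun t => slice B (Module.Dual.eval k B T.one)
    (TensorProduct.comm k (Module.Dual k B) B t)) h
  beta_reduce at h'
  refine Eq.trans ?_ (h'.trans ?_)
  · generalize S.comul a = t
    induction t using TensorProduct.induction_on with
    | zero => simp
    | add x y hx hy => simp only [map_add, hx, hy]
    | tmul u v => simp [hp, hS.isUAA.one_mul]
  · generalize T.comul (f a) = t
    induction t using TensorProduct.induction_on with
    | zero => simp
    | add x y hx hy => simp only [map_add, hx, hy]
    | tmul u v => simp [hT.isUAA.one_mul]

/-- Applying the counit to the remaining leg removes the comultiplication. Hence the dual component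
`p` is determined by `f`. -/
theorem apply_of_map_sigmaBi (hS : S.IsBialgebra) (hT : T.IsBialgebra)
    (hσ : TensorProduct.map p f ∘ₗ S.sigmaBi = T.sigmaBi ∘ₗ TensorProduct.map f p)
    (hp : ∀ l, p l T.one = l S.one) (hε : ∀ a, T.counit (f a) = S.counit a)
    (a : A) (l : Module.Dual k A) : p l (f a) = l a := by
  have h := congrArg T.counit (slice_map_of_map_sigmaBi hS hT hσ hp a l)
  have h1 : ∀ t : A ⊗[k] A, T.counit (slice B l (LinearMap.rTensor A f t)) =
      l (TensorProduct.lid k A (LinearMap.rTensor A S.counit t)) := by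
    intro t
    induction t using TensorProduct.induction_on with
    | zero => simp
    | add x y hx hy => simp only [map_add, hx, hy]
    | tmul u v => simp [hε, mul_comm]
  have h2 : ∀ t : B ⊗[k] B, T.counit (slice B (p l) t) =
      p l (TensorProduct.lid k B (LinearMap.rTensor B T.counit t)) := by
    intro t
    induction t using TensorProduct.induction_on with
    | zero => simp
    | add x y hx hy => simp only [map_add, hx, hy]
    | tmul u v => simp [mul_comm]
  rw [h1, h2, hS.counit_left, hT.counit_left] at h
  exact h.symm

/-- The slice identity holds for all `l`, hence without `l`: `f(a₍₁₎) ⊗ a₍₂₎` equals `(Id ⊗ g)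
Δ(f(a))`. Applying `f` to the second leg finishes. -/
theorem map_comul_of_map_sigmaBi (hS : S.IsBialgebra) (hT : T.IsBialgebra)
    (hσ : TensorProduct.map p f ∘ₗ S.sigmaBi = T.sigmaBi ∘ₗ TensorProduct.map f p)
    (hp : ∀ l, p l T.one = l S.one) (hpl : ∀ l a, p l (f a) = l a)
    (hfg : ∀ b, f (g b) = b) (a : A) :
    T.comul (f a) = TensorProduct.map f f (S.comul a) := by
  have h : LinearMap.rTensor A f (S.comul a) = LinearMap.lTensor B g (T.comul (f a)) := by
    refine slice_ext fun l => ?_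
    rw [slice_map_of_map_sigmaBi hS hT hσ hp]
    generalize T.comul (f a) = t
    induction t using TensorProduct.induction_on with
    | zero => simp
    | add x y hx hy => simp only [map_add, hx, hy]
    | tmul u v =>
      have := hpl l (g v)
      rw [hfg] at this
      simp [this]
  have h' := congrArg (LinearMap.lTensor B f) h
  have e : f ∘ₗ g = LinearMap.id := LinearMap.ext hfg
  rw [← LinearMap.comp_apply (LinearMap.lTensor B f) (LinearMap.rTensor A f),
    LinearMap.lTensor_comp_rTensor,
    ← LinearMap.comp_apply (LinearMap.lTensor B f) (LinearMap.lTensor B g),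
    ← LinearMap.lTensor_comp, e, LinearMap.lTensor_id, LinearMap.id_apply] at h'
  exact h'.symm

/-- Applying `φ` to the unit leg of `1 ⊗ a b` recovers the product. -/
theorem map_mul_of_map_sigmaAss {S : AlgStr k A} {T : AlgStr k B} {φ : Module.Dual k B}
    (hφ : φ T.one = 1) (h1 : f S.one = T.one)
    (h : TensorProduct.map f f ∘ₗ S.sigmaAss = T.sigmaAss ∘ₗ TensorProduct.map f f) (a b : A) :
    f (S.mul (a ⊗ₜ b)) = T.mul (f a ⊗ₜ f b) := by
  have := congrArg (fun t => TensorProduct.lid k B (LinearMap.rTensor B φ t))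
    (LinearMap.congr_fun h (a ⊗ₜ b))
  simpa [AlgStr.sigmaAss_tmul, h1, hφ] using this

end Recover

end Morphisms

/-! ### Morphisms between the systems of two bialgebras. -/

section Bprime

variable {k : Type u} [Field k] {H K : Type u} [Ring H] [Bialgebra k H] [Module.Finite k H]
  [Ring K] [Bialgebra k K] [Module.Finite k K]

theorem forall_fin_four_le {P : ∀ i j : Fin 4, i ≤ j → Prop} (hd : ∀ i, P i i le_rfl)
    (h : ∀ i j (h : i < j), P i j h.le) (i j : Fin 4) (hij : i ≤ j) : P i j hij := by
  rcases hij.eq_or_lt with rfl | h'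
  · exact hd i
  · exact h i j h'

theorem isMorphism_BprimeMap {f : H →ₗ[k] K} {g : K →ₗ[k] H}
    (hf : (BialgStr.of k H).IsHom (BialgStr.of k K) f)
    (hg : (BialgStr.of k K).IsHom (BialgStr.of k H) g) (hgf : ∀ a, g (f a) = a) :
    BraidedData.IsMorphism (Bprime k H).toBraidedData (Bprime k K).toBraidedData
      (BprimeMap f g) where
  braiding := forall_fin_four_le
    (forall_fin_four (AlgStr.map_sigmaAss hf.map_mul hf.map_one)
      (AlgStr.map_sigmaAss hf.op.map_mul hf.map_one)
      (AlgStr.map_sigmaAss hg.dualMap_mul hg.dualMap_one)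
      (AlgStr.map_sigmaAss hg.cop.dualMap_mul hg.cop.dualMap_one))
    (forall_fin_four_lt (TensorProduct.ext' fun _ _ => rfl) (hf.map_sigmaBi hg hgf)
      (hf.cop.map_sigmaBi hg.cop hgf) (hf.op.map_sigmaBi hg.op hgf)
      (hf.op.cop.map_sigmaBi hg.op.cop hgf) (TensorProduct.ext' fun _ _ => rfl))
  unit := forall_fin_four hf.map_one hf.map_one hg.dualMap_one hg.dualMap_one
  counit := forall_fin_four (LinearMap.ext hf.map_counit) (LinearMap.ext hf.map_counit)
    (LinearMap.ext fun (l : Module.Dual k H) =>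
      show l (g (BialgStr.of k K).one) = l (BialgStr.of k H).one from congrArg l hg.map_one)
    (LinearMap.ext fun (l : Module.Dual k H) =>
      show l (g (BialgStr.of k K).one) = l (BialgStr.of k H).one from congrArg l hg.map_one)

/-- Isomorphisms of the braided systems come from isomorphisms of bialgebras. -/
theorem isHom_of_isMorphism {a : ∀ i, (Bprime k H).V i →ₗ[k] (Bprime k K).V i}
    (h : BraidedData.IsMorphism (Bprime k H).toBraidedData (Bprime k K).toBraidedData a)
    {g : K →ₗ[k] H} (hfg : ∀ x : K, a 0 (g x) = x) :
    BialgStr.IsHom (A := H) (B := K) (BialgStr.of k H) (BialgStr.of k K) (a 0) ∧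
      a = BprimeMap (H := H) (K := K) (a 0) g := by
  let S := BialgStr.of k H
  let T := BialgStr.of k K
  have hS : S.IsBialgebra := BialgStr.isBialgebra_of H
  have hT : T.IsBialgebra := BialgStr.isBialgebra_of K
  let f : H →ₗ[k] K := a 0
  let f₁ : H →ₗ[k] K := a 1
  let p : Module.Dual k H →ₗ[k] Module.Dual k K := a 2
  let q : Module.Dual k H →ₗ[k] Module.Dual k K := a 3
  have hfg : ∀ x, f (g x) = x := hfg
  have hε : ∀ x, T.counit (f x) = S.counit x := LinearMap.congr_fun (h.counit 0)
  have hε₁ : ∀ x, T.counit (f₁ x) = S.counit x := LinearMap.congr_fun (h.counit 1)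
  have hp : ∀ l, p l T.one = l S.one := fun l => LinearMap.congr_fun (h.counit 2) l
  have hq : ∀ l, q l T.one = l S.one := fun l => LinearMap.congr_fun (h.counit 3) l
  have h1 : f S.one = T.one := h.unit 0
  have s₀₀ : TensorProduct.map f f ∘ₗ S.toAlgStr.sigmaAss =
    T.toAlgStr.sigmaAss ∘ₗ TensorProduct.map f f := h.braiding 0 0 le_rfl
  have s₀₂ : TensorProduct.map p f ∘ₗ S.sigmaBi = T.sigmaBi ∘ₗ TensorProduct.map f p :=
    h.braiding 0 2 (by decide)
  have s₁₂ : TensorProduct.map p f₁ ∘ₗ S.op.sigmaBi = T.op.sigmaBi ∘ₗ TensorProduct.map f₁ p :=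
    h.braiding 1 2 (by decide)
  have s₀₃ : TensorProduct.map q f ∘ₗ S.cop.sigmaBi = T.cop.sigmaBi ∘ₗ TensorProduct.map f q :=
    h.braiding 0 3 (by decide)
  have hpl : ∀ l x, p l (f x) = l x := fun l x => apply_of_map_sigmaBi hS hT s₀₂ hp hε x l
  have hql : ∀ l x, q l (f x) = l x :=
    fun l x => apply_of_map_sigmaBi hS.cop hT.cop s₀₃ hq hε x l
  have hpl₁ : ∀ l x, p l (f₁ x) = l x :=
    fun l x => apply_of_map_sigmaBi hS.op hT.op s₁₂ hp hε₁ x l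
  have ep : p = g.dualMap := LinearMap.ext fun l => LinearMap.ext fun y => by
    have := hpl l (g y)
    rwa [hfg] at this
  have eq : q = g.dualMap := LinearMap.ext fun l => LinearMap.ext fun y => by
    have := hql l (g y)
    rwa [hfg] at this
  -- The component `p` is linked both to `f` and to `f₁`. Since it is `g^*`, all functionals agree
  -- on `g(f₁ x)` and `x`, whence `f₁ x = f(g(f₁ x)) = f x`.
  have ef : f₁ = f := LinearMap.ext fun x => by
    have e1 : ∀ l : Module.Dual k H, l (g (f₁ x)) = l x := fun l =>
      (LinearMap.congr_fun (LinearMap.congr_fun ep.symm l) (f₁ x)).trans (hpl₁ l x)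
    have e2 : g (f₁ x) = x := by
      rw [← sub_eq_zero, ← Module.forall_dual_apply_eq_zero_iff k]
      exact fun l => (map_sub l _ _).trans (sub_eq_zero.2 (e1 l))
    rw [← hfg (f₁ x), e2]
  have hm : ∀ x y, f (S.mul (x ⊗ₜ y)) = T.mul (f x ⊗ₜ f y) :=
    map_mul_of_map_sigmaAss hT.counit_one h1 s₀₀
  have hc : ∀ x, T.comul (f x) = TensorProduct.map f f (S.comul x) :=
    map_comul_of_map_sigmaBi hS hT s₀₂ hp hpl hfg
  exact ⟨⟨hm, h1, hc, hε⟩, funext (forall_fin_four rfl ef ep eq)⟩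

end Bprime

/-! ### Full faithfulness of the functor. -/

section Functor

variable {k : Type u} [Field k]

theorem BialgStr.isHom_of_bialgHom {H K : Type u} [Ring H] [Bialgebra k H] [Ring K] [Bialgebra k K]
    (f : H →ₐc[k] K) : (BialgStr.of k H).IsHom (BialgStr.of k K) (f : H →ₗ[k] K) where
  map_mul a b := by simp [BialgStr.of]
  map_one := by simp [BialgStr.of]
  map_comul a := by simp [BialgStr.of]
  map_counit a := by simp [BialgStr.of]

theorem BialgStr.IsHom.exists_bialgHom {H K : Type u} [Ring H] [Bialgebra k H] [Ring K]
    [Bialgebra k K] {f : H →ₗ[k] K} (h : (BialgStr.of k H).IsHom (BialgStr.of k K) f) :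
    ∃ F : H →ₐc[k] K, (F : H →ₗ[k] K) = f :=
  ⟨{ f with
      counit_comp := LinearMap.ext h.map_counit
      map_comp_comul := LinearMap.ext fun a => (h.map_comul a).symm
      map_one' := h.map_one
      map_mul' := h.map_mul }, rfl⟩

theorem isMorphism_lin (H K : FdBialg k) (f : H ≅ K) :
    BraidedData.IsMorphism (Bprime k H.obj).toBraidedData (Bprime k K.obj).toBraidedData
      (BprimeMap (FdBialg.lin f.hom) (FdBialg.lin f.inv)) :=
  isMorphism_BprimeMap (BialgStr.isHom_of_bialgHom _) (BialgStr.isHom_of_bialgHom _)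
    fun a => congrArg (fun q : H ⟶ H => FdBialg.lin q a) f.hom_inv_id

theorem FdBialg.lin_injective {H K : FdBialg k} {f g : H ⟶ K} (h : FdBialg.lin f = FdBialg.lin g) :
    f = g :=
  ObjectProperty.hom_ext _ (BialgCat.hom_ext _ _ (BialgHom.ext fun x => LinearMap.congr_fun h x))

variable (hobj : ∀ H : FdBialg k, (Bprime k H.obj).toBraidedData.IsBipointedBraided)
  (hmap : ∀ (H K : FdBialg k) (f : H ≅ K),
    BraidedData.IsMorphism (Bprime k H.obj).toBraidedData (Bprime k K.obj).toBraidedData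
      (BprimeMap (FdBialg.lin f.hom) (FdBialg.lin f.inv)))

/-- The first component of the image of an isomorphism is its underlying linear map. -/
theorem faithful_BprimeFunctor : (BprimeFunctor k hobj hmap).Faithful where
  map_injective {X Y f g} h := by
    refine Core.hom_ext (FdBialg.lin_injective ?_)
    have h1 := congrArg (fun q : (BprimeFunctor k hobj hmap).obj X ⟶
      (BprimeFunctor k hobj hmap).obj Y => q.iso.hom) h
    exact congrArg (fun q : (⟨(Bprime k X.of.obj).toBraidedData, hobj X.of⟩ : BrSyst k 4) ⟶
      ⟨(Bprime k Y.of.obj).toBraidedData, hobj Y.of⟩ => q.app 0) h1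

theorem full_BprimeFunctor : (BprimeFunctor k hobj hmap).Full where
  map_surjective {X Y} φ := by
    let SX : BrSyst k 4 := ⟨(Bprime k X.of.obj).toBraidedData, hobj X.of⟩
    let SY : BrSyst k 4 := ⟨(Bprime k Y.of.obj).toBraidedData, hobj Y.of⟩
    let e : SX ≅ SY := φ.iso
    let f : X.of.obj →ₗ[k] Y.of.obj := e.hom.app 0
    let g : Y.of.obj →ₗ[k] X.of.obj := e.inv.app 0
    have hgf : ∀ x, g (f x) = x := fun x =>
      congrArg (fun q : SX ⟶ SX => q.app 0 x) e.hom_inv_id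
    have hfg : ∀ x, f (g x) = x := fun x =>
      congrArg (fun q : SY ⟶ SY => q.app 0 x) e.inv_hom_id
    obtain ⟨h1, h2⟩ := isHom_of_isMorphism e.hom.isMorphism hfg
    obtain ⟨h3, -⟩ := isHom_of_isMorphism e.inv.isMorphism hgf
    obtain ⟨F, hF⟩ := h1.exists_bialgHom
    obtain ⟨G, hG⟩ := h3.exists_bialgHom
    have hF' : ∀ x, F x = f x := LinearMap.congr_fun hF
    have hG' : ∀ x, G x = g x := LinearMap.congr_fun hG
    let F' : X.of ⟶ Y.of := ObjectProperty.homMk ⟨F⟩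
    let G' : Y.of ⟶ X.of := ObjectProperty.homMk ⟨G⟩
    have lF : FdBialg.lin F' = f := hF
    have lG : FdBialg.lin G' = g := hG
    let i : X.of ≅ Y.of :=
      { hom := F'
        inv := G'
        hom_inv_id := FdBialg.lin_injective (LinearMap.ext fun x =>
          (hG' _).trans ((congrArg g (hF' x)).trans (hgf x)))
        inv_hom_id := FdBialg.lin_injective (LinearMap.ext fun x =>
          (hF' _).trans ((congrArg f (hG' x)).trans (hfg x))) }
    refine ⟨⟨i⟩, Core.hom_ext (BrSyst.Hom.ext ?_)⟩
    -- By `h2`, an isomorphism of systems is determined by its first component and the inverse of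
    -- that component.
    refine Eq.trans ?_ h2.symm
    change BprimeMap (FdBialg.lin F') (FdBialg.lin G') = BprimeMap f g
    rw [lF, lG]

end Functor
end HopfBraid
end

theorem mainTheorem3 (k : Type u) [Field k] :
    -- the fully faithful functor
    (∃ (hobj : ∀ H : HopfBraid.FdBialg k,
          (HopfBraid.Bprime k H.obj).toBraidedData.IsBipointedBraided)
        (hmap : ∀ (H K : HopfBraid.FdBialg k) (f : H ≅ K),
          HopfBraid.BraidedData.IsMorphism (HopfBraid.Bprime k H.obj).toBraidedData
            (HopfBraid.Bprime k K.obj).toBraidedData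
            (HopfBraid.BprimeMap (HopfBraid.FdBialg.lin f.hom) (HopfBraid.FdBialg.lin f.inv))),
      (HopfBraid.BprimeFunctor k hobj hmap).Full ∧
        (HopfBraid.BprimeFunctor k hobj hmap).Faithful) ∧
    -- Hopf bimodules over a bialgebra
    (∀ (H : Type u) [Ring H] [Bialgebra k H] [Module.Finite k H],
      (HopfBraid.Bprime k H).IsSystemOfUAAs ∧
      (HopfBraid.W k H).IsUAA ∧
      (∃ h : ∀ X : HopfBraid.HopfBimod k H,
          (HopfBraid.Bprime k H).toBraidedData.IsModule X.M X.act,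
        (HopfBraid.HopfBimod.toBrMod h).IsEquivalence) ∧
      (∃ h : ∀ X : HopfBraid.BrMod (HopfBraid.Bprime k H).toBraidedData,
          (HopfBraid.W k H).IsModule X.M X.iterAct,
        (HopfBraid.BrMod.toAlgMod (HopfBraid.Bprime k H) h).IsEquivalence)) ∧
    -- component permutations for a Hopf algebra
    (∀ (H : Type u) [Ring H] [HopfAlgebra k H] [Module.Finite k H],
      (∀ (i j : Fin 4) (h : i < j),
        Function.Bijective ((HopfBraid.Bprime k H).σ i j h.le)) ∧
      (∀ θ : Equiv.Perm (Fin 4),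
        ((HopfBraid.Bprime k H).perm θ).IsSystemOfUAAs ∧
        (HopfBraid.thetaW k H θ).IsUAA ∧
        (∃ (h : ∀ X : HopfBraid.HopfBimod k H,
              (HopfBraid.Bprime k H).toBraidedData.IsModule X.M X.act)
            (h' : ∀ X : HopfBraid.BrMod (HopfBraid.Bprime k H).toBraidedData,
              ((HopfBraid.Bprime k H).perm θ).toBraidedData.IsModule X.M
                (fun i => X.ρ (θ⁻¹ i))),
          (HopfBraid.HopfBimod.toBrMod h ⋙
            HopfBraid.BrMod.permFunctor (HopfBraid.Bprime k H) θ h').IsEquivalence) ∧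
        (∃ h : ∀ X : HopfBraid.BrMod ((HopfBraid.Bprime k H).perm θ).toBraidedData,
            (HopfBraid.thetaW k H θ).IsModule X.M X.iterAct,
          (HopfBraid.BrMod.toAlgMod ((HopfBraid.Bprime k H).perm θ) h).IsEquivalence)) ∧
      (∃ Φ : ∀ θ : Equiv.Perm (Fin 4),
          (HopfBraid.Bprime k H).BTP ≃ₗ[k] ((HopfBraid.Bprime k H).perm θ).BTP,
        (HopfBraid.Bprime k H).IsPermFamily Φ ∧
        ∀ θ : Equiv.Perm (Fin 4),
          ∃ hΦ : HopfBraid.IsAlgIso (HopfBraid.W k H) (HopfBraid.thetaW k H θ) (Φ θ),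
            (HopfBraid.AlgMod.transport (Φ θ) hΦ).IsEquivalence ∧
            ∀ (X : HopfBraid.BrMod (HopfBraid.Bprime k H).toBraidedData)
              (h' : ((HopfBraid.Bprime k H).perm θ).toBraidedData.IsModule X.M
                (fun i => X.ρ (θ⁻¹ i))),
              HopfBraid.BrMod.iterAct (S := (HopfBraid.Bprime k H).perm θ)
                  { M := X.M, ρ := fun i => X.ρ (θ⁻¹ i), isModule := h' } =
                X.iterAct ∘ₗ LinearMap.lTensor X.M (Φ θ).symm.toLinearMap) ∧
      HopfBraid.IsAlgIso (HopfBraid.algX k H) (HopfBraid.thetaW k H HopfBraid.permX)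
        (HopfBraid.rebracketX k H) ∧
      HopfBraid.IsAlgIso (HopfBraid.algY k H) (HopfBraid.thetaW k H HopfBraid.permY)
        (HopfBraid.rebracketY k H) ∧
      HopfBraid.IsAlgIso (HopfBraid.algZ k H) (HopfBraid.thetaW k H HopfBraid.permZ)
        (HopfBraid.rebracketZ k H)) := by
  open HopfBraid in
  refine ⟨⟨fun H => (isSystemOfUAAs_Bprime k H.obj).isBraided, isMorphism_lin,
    full_BprimeFunctor _ _, faithful_BprimeFunctor _ _⟩, ?_, ?_⟩
  · intro H _ _ _
    have hS := isSystemOfUAAs_Bprime k H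
    exact ⟨hS, hS.isUAA_btp, ⟨HopfBimod.isModule_act, HopfBimod.isEquivalence_toBrMod _⟩,
      ⟨AlgSystem.isModule_iterAct, AlgSystem.isEquivalence_toAlgMod hS _⟩⟩
  · intro H _ _ _
    have hS := isSystemOfUAAs_Bprime k H
    have hb := bijectiveBraiding_Bprime k H
    refine ⟨hb, fun θ => ⟨hS.perm hb θ, (hS.perm hb θ).isUAA_btp, ?_,
      AlgSystem.isModule_iterAct, AlgSystem.isEquivalence_toAlgMod (hS.perm hb θ) _⟩,
      ⟨AlgSystem.toPerm hS hb, AlgSystem.isPermFamily_toPerm hS hb, fun θ =>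
        ⟨AlgSystem.isAlgIso_toPerm hS hb θ, AlgMod.isEquivalence_transport _ _,
          fun X h' => AlgSystem.iterAct_perm hS hb θ X h'⟩⟩,
      isAlgIso_rebracketX k H, isAlgIso_rebracketY k H, isAlgIso_rebracketZ k H⟩
    refine ⟨HopfBimod.isModule_act, fun X => (AlgSystem.isModule_perm_iff hb θ).2 X.isModule, ?_⟩
    have := HopfBimod.isEquivalence_toBrMod (k := k) (H := H) HopfBimod.isModule_act
    have := AlgSystem.isEquivalence_permFunctor hb θ
      fun X => (AlgSystem.isModule_perm_iff hb θ).2 X.isModule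
    exact Functor.isEquivalence_trans _ _
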